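/- **Theorem (Cartan–Ambrose–Hicks).** Let $M$, $N$ be (finite-dimensional, Hausdorff) smooth manifolds endowed with arbitrary smooth connections $\nabla^M$, $\nabla^N$ on their tangent bundles (not assumed symmetric), with torsion tensors $T^M,T^N$, where $T(X,Y)=\nabla_XY-\nabla_YX-[X,Y]$, and curvature tensors $R^M,R^N$, where $R(X,Y)Z=\nabla_X\nabla_YZ-\nabla_Y\nabla_XZ-\nabla_{[X,Y]}Z$. Assume that $M$ is connected and simply connected and that $\nabla^N$ is geodesically complete, i.e. for every $y\in N$ the exponential map of $N$ at $y$ is defined on all of $T_yN$. Let $x_0\in M$, $y_0\in N$ and a linear map $\sigma_0:T_{x_0}M\to T_{y_0}N$ be given. A *piecewise geodesic* $\gamma:[a,b]\to M$ is a curve for which there is a partition $a=t_0<t_1<\dots<t_k=b$ such that each $\gamma|_{[t_i,t_{i+1}]}$ is a geodesic. Given a geodesic $\gamma:[a,b]\to M$, a point $y\in N$ and a linear map $\sigma:T_{\gamma(a)}M\to T_yN$, the geodesic *induced* by $\gamma$ and $\sigma$ is the geodesic $\mu:[a,b]\to N$ with $\mu(a)=y$ and $\mu'(a)=\sigma(\gamma'(a))$;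 the linear map *induced* by $\gamma$ and $\sigma$ is the map $T_{\gamma(b)}M\to T_{\mu(b)}N$ obtained by composing parallel transport along $\gamma$ from $\gamma(b)$ to $\gamma(a)$, the map $\sigma$, and parallel transport along $\mu$ from $\mu(a)$ to $\mu(b)$. For a piecewise geodesic $\gamma:[a,b]\to M$ with $\gamma(a)=x_0$, let $\mu_\gamma:[a,b]\to N$ and $\sigma_\gamma:T_{\gamma(b)}M\to T_{\mu_\gamma(b)}N$ be the piecewise geodesic and the linear map obtained by performing this construction successively on $[t_0,t_1],\dots,[t_{k-1},t_k]$, starting with $y_0$ and $\sigma_0$, the final point and linear map of each step being the initial data of the next one. Assume that for every piecewise geodesic $\gamma:[a,b]\to M$ with $\gamma(a)=x_0$ the linear map $\sigma_\gamma$ relates $T^M$ with $T^N$ and $R^M$ with $R^N$, that is, for all $u,v,w\in T_{\gamma(b)}M$, $$\sigma_\gamma\big(T^M(u,v)\big)=T^N\big(\sigma_\gamma u,\sigma_\gamma v\big),\qquad \sigma_\gamma\big(R^M(u,v)w\big)=R^N\big(\sigma_\gamma u,\sigma_\gamma v\big)\sigma_\gamma w .$$ Then there exists a smooth map $f:M\to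 N$ that is affine, i.e. $\mathrm df_x(\nabla^M_vX)=\nabla^N_v(\mathrm df\circ X)$ for all $x\in M$, $v\in T_xM$ and all smooth vector fields $X$ on $M$ (where $\mathrm df\circ X$ is regarded as a vector field along $f$), such that for every piecewise geodesic $\gamma:[a,b]\to M$ with $\gamma(a)=x_0$ we have $f\circ\gamma=\mu_\gamma$ and $\mathrm df(\gamma(b))=\sigma_\gamma$; in particular, $f(x_0)=y_0$ and $\mathrm df(x_0)=\sigma_0$. -/

import Mathlib

open Set Bundle
open scoped Manifold ContDiff

noncomputable section

namespace AffineGeometry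

variable {E : Type*} [NormedAddCommGroup E] [NormedSpace ℝ E]
  {M : Type*} [TopologicalSpace M] [ChartedSpace E M] [IsManifold 𝓘(ℝ, E) ∞ M]
  {F : Type*} [NormedAddCommGroup F] [NormedSpace ℝ F]
  {N : Type*} [TopologicalSpace N] [ChartedSpace F N] [IsManifold 𝓘(ℝ, F) ∞ N]

variable (E M) in
/-- A covariant derivative on the tangent bundle of `M`. With Mathlib's argument order,
`cov X x v` is `∇_v X` for a vector field `X` and `v ∈ T_x M`. -/
abbrev TangentConnection :=
  CovariantDerivative 𝓘(ℝ, E) E (TangentSpace 𝓘(ℝ, E) : M → Type _)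

variable (E M F N) in
/-- Points of the bundle `Lin(TM, TN)` over `M × N`: triples `(x, y, σ)` with `σ : T_x M → T_y N`
linear. Equality of two such triples is equality of base points and of linear maps. -/
abbrev LinBundle :=
  Σ p : M × N, TangentSpace 𝓘(ℝ, E) p.1 →L[ℝ] TangentSpace 𝓘(ℝ, F) p.2

/-! ### Covariant derivative along a map -/

section Along

variable {A : Type*} [NormedAddCommGroup A] [NormedSpace ℝ A]
  {P : Type*} [TopologicalSpace P] [ChartedSpace A P]

/-- The pull-back connection `f^*∇` of `∇ = cov` by a map `f : P → N`, applied at `p` to a vector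
field `s` along `f`, i.e. `s q ∈ T_{f q} N`; all derivatives are taken within `S` (`S = univ` is
the usual case, closed intervals are needed for curves). If `e₁, …, e_n` is the frame of `TN` near
`f p` given by the local trivialization at `f p` and `s = ∑ cⁱ (eᵢ ∘ f)` near `p`, then
`(f^*∇)_v s = ∑ dcⁱ(v) eᵢ + ∑ cⁱ(p) ∇_{df(v)} eᵢ`.
The first sum is the first summand below. In the second one, `FiberBundle.extend F (s p)` is
the vector field `∑ cⁱ(p) eᵢ`, with coefficients that are constant near `f p`. -/
def covAlong (cov : TangentConnection F N) (f : P → N)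
    (s : (q : P) → TangentSpace 𝓘(ℝ, F) (f q)) (S : Set P) (p : P) :
    TangentSpace 𝓘(ℝ, A) p →L[ℝ] TangentSpace 𝓘(ℝ, F) (f p) :=
  ((trivializationAt F (TangentSpace 𝓘(ℝ, F) : N → Type _) (f p)).symmL ℝ (f p)) ∘L
      (mvfderivWithin 𝓘(ℝ, A)
        (fun q ↦ (trivializationAt F (TangentSpace 𝓘(ℝ, F) : N → Type _) (f p)
          ⟨f q, s q⟩).2) S p)
    + (cov (FiberBundle.extend F (s p)) (f p)) ∘L (mfderivWithin 𝓘(ℝ, A) 𝓘(ℝ, F) f S p)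

end Along

/-! ### Geodesics and parallel transport -/

/-- The velocity `γ'(t)` of a curve defined on `S`. -/
def velocity (γ : ℝ → M) (S : Set ℝ) (t : ℝ) : TangentSpace 𝓘(ℝ, E) (γ t) :=
  mfderivWithin 𝓘(ℝ, ℝ) 𝓘(ℝ, E) γ S t (1 : ℝ)

/-- The covariant derivative `DV/dt` of a vector field `V` along a curve `γ` defined on `S`. -/
def covDt (cov : TangentConnection E M) (γ : ℝ → M)
    (V : (t : ℝ) → TangentSpace 𝓘(ℝ, E) (γ t)) (S : Set ℝ) (t : ℝ) :
    TangentSpace 𝓘(ℝ, E) (γ t) :=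
  covAlong cov γ V S t (1 : ℝ)

/-- `V` is a smooth parallel vector field along the curve `γ : S → M`. -/
def IsParallelOn (cov : TangentConnection E M) (γ : ℝ → M)
    (V : (t : ℝ) → TangentSpace 𝓘(ℝ, E) (γ t)) (S : Set ℝ) : Prop :=
  ContMDiffOn 𝓘(ℝ, ℝ) 𝓘(ℝ, E).tangent ∞
      (fun t ↦ (⟨γ t, V t⟩ : TangentBundle 𝓘(ℝ, E) M)) S ∧
    ∀ t ∈ S, covDt cov γ V S t = 0

/-- `P` is the parallel transport `T_{γ(t₁)} M → T_{γ(t₂)} M` along the curve `γ : S → M`, with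
`t₁` and `t₂` in `S` in any order. -/
def IsParallelTransport (cov : TangentConnection E M) (γ : ℝ → M) (S : Set ℝ) (t₁ t₂ : ℝ)
    (P : TangentSpace 𝓘(ℝ, E) (γ t₁) →L[ℝ] TangentSpace 𝓘(ℝ, E) (γ t₂)) : Prop :=
  ∀ v, ∃ V : (t : ℝ) → TangentSpace 𝓘(ℝ, E) (γ t),
    IsParallelOn cov γ V S ∧ V t₁ = v ∧ V t₂ = P v

/-- `γ : S → M` is a (smooth, affinely parametrized) geodesic. -/
def IsGeodesicOn (cov : TangentConnection E M) (γ : ℝ → M) (S : Set ℝ) : Prop :=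
  ContMDiffOn 𝓘(ℝ, ℝ) 𝓘(ℝ, E) ∞ γ S ∧ ∀ t ∈ S, covDt cov γ (velocity γ S) S t = 0

/-- `w ∈ T_y M` is in the domain of the exponential map: the geodesic with initial velocity `w` is
defined on `[0, 1]`. -/
def InExpDomain (cov : TangentConnection E M) (y : M) (w : TangentSpace 𝓘(ℝ, E) y) : Prop :=
  ∃ γ : ℝ → M, IsGeodesicOn cov γ (Icc 0 1) ∧
    (⟨γ 0, velocity γ (Icc 0 1) 0⟩ : TangentBundle 𝓘(ℝ, E) M) = ⟨y, w⟩

/-- Geodesic completeness: every exponential map is defined on the whole tangent space. -/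
def GeodesicallyComplete (cov : TangentConnection E M) : Prop :=
  ∀ (y : M) (w : TangentSpace 𝓘(ℝ, E) y), InExpDomain cov y w

/-- `IsPiecewiseGeodesic cov γ a b`: there is a partition `a = t₀ < t₁ < ⋯ < t_k = b`, `k ≥ 1`,
such that each restriction `γ|[tᵢ, tᵢ₊₁]` is a geodesic. -/
inductive IsPiecewiseGeodesic (cov : TangentConnection E M) (γ : ℝ → M) (a : ℝ) : ℝ → Prop
  | single {b : ℝ} (hab : a < b) (hγ : IsGeodesicOn cov γ (Icc a b)) :
      IsPiecewiseGeodesic cov γ a b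
  | append {b c : ℝ} (h : IsPiecewiseGeodesic cov γ a b) (hbc : b < c)
      (hγ : IsGeodesicOn cov γ (Icc b c)) : IsPiecewiseGeodesic cov γ a c

/-! ### Induced curves and induced linear maps -/

/-- `μ : [a, b] → N` and `τ : T_{γ(b)} M → T_{μ(b)} N` are the geodesic and the linear map induced
by the geodesic `γ : [a, b] → M` and by `σ : T_{γ(a)} M → T_{μ(a)} N`. -/
structure IsInducedByGeodesic (covM : TangentConnection E M) (covN : TangentConnection F N)
    (γ : ℝ → M) (μ : ℝ → N) (a b : ℝ)
    (σ : TangentSpace 𝓘(ℝ, E) (γ a) →L[ℝ] TangentSpace 𝓘(ℝ, F) (μ a))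
    (τ : TangentSpace 𝓘(ℝ, E) (γ b) →L[ℝ] TangentSpace 𝓘(ℝ, F) (μ b)) : Prop where
  lt : a < b
  geodesic_source : IsGeodesicOn covM γ (Icc a b)
  geodesic_target : IsGeodesicOn covN μ (Icc a b)
  velocity_eq : velocity μ (Icc a b) a = σ (velocity γ (Icc a b) a)
  /-- `τ` is parallel transport along `γ` from `b` back to `a`, then `σ`, then parallel transport
  along `μ` from `a` to `b`. -/
  transport : ∃ (P : TangentSpace 𝓘(ℝ, E) (γ b) →L[ℝ] TangentSpace 𝓘(ℝ, E) (γ a))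
    (Q : TangentSpace 𝓘(ℝ, F) (μ a) →L[ℝ] TangentSpace 𝓘(ℝ, F) (μ b)),
    IsParallelTransport covM γ (Icc a b) b a P ∧ IsParallelTransport covN μ (Icc a b) a b Q ∧
      τ = Q ∘L σ ∘L P

/-- The piecewise version, by induction over the pieces of a partition of `[a, b]`: the linear map
induced by one piece is the initial linear map of the next piece. -/
inductive IsInducedFrom (covM : TangentConnection E M) (covN : TangentConnection F N)
    (γ : ℝ → M) (μ : ℝ → N) (a : ℝ)
    (σ : TangentSpace 𝓘(ℝ, E) (γ a) →L[ℝ] TangentSpace 𝓘(ℝ, F) (μ a)) :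
    (b : ℝ) → (TangentSpace 𝓘(ℝ, E) (γ b) →L[ℝ] TangentSpace 𝓘(ℝ, F) (μ b)) → Prop
  | single {b : ℝ} {τ : TangentSpace 𝓘(ℝ, E) (γ b) →L[ℝ] TangentSpace 𝓘(ℝ, F) (μ b)}
      (h : IsInducedByGeodesic covM covN γ μ a b σ τ) : IsInducedFrom covM covN γ μ a σ b τ
  | append {b c : ℝ} {τ : TangentSpace 𝓘(ℝ, E) (γ b) →L[ℝ] TangentSpace 𝓘(ℝ, F) (μ b)}
      {ρ : TangentSpace 𝓘(ℝ, E) (γ c) →L[ℝ] TangentSpace 𝓘(ℝ, F) (μ c)}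
      (h : IsInducedFrom covM covN γ μ a σ b τ)
      (h' : IsInducedByGeodesic covM covN γ μ b c τ ρ) : IsInducedFrom covM covN γ μ a σ c ρ

/-- `μ : [a, b] → N` and `σ : T_{γ(b)} M → T_{μ(b)} N` are the piecewise geodesic and the linear
map induced by the piecewise geodesic `γ : [a, b] → M`, `γ(a) = x₀`, and by
`σ₀ : T_{x₀} M → T_{y₀} N`. -/
def IsInduced (covM : TangentConnection E M) (covN : TangentConnection F N) {x₀ : M} {y₀ : N}
    (σ₀ : TangentSpace 𝓘(ℝ, E) x₀ →L[ℝ] TangentSpace 𝓘(ℝ, F) y₀)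
    (γ : ℝ → M) (a b : ℝ) (μ : ℝ → N)
    (σ : TangentSpace 𝓘(ℝ, E) (γ b) →L[ℝ] TangentSpace 𝓘(ℝ, F) (μ b)) : Prop :=
  ∃ σa : TangentSpace 𝓘(ℝ, E) (γ a) →L[ℝ] TangentSpace 𝓘(ℝ, F) (μ a),
    (⟨(γ a, μ a), σa⟩ : LinBundle E M F N) = ⟨(x₀, y₀), σ₀⟩ ∧
      IsInducedFrom covM covN γ μ a σa b σ

/-! ### Torsion, curvature, affine maps -/

/-- The torsion tensor `T_x(u, v)`, where `T(X, Y) = ∇_X Y - ∇_Y X - [X, Y]`. -/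
def torsion [FiniteDimensional ℝ E] (cov : TangentConnection E M) (x : M)
    (u v : TangentSpace 𝓘(ℝ, E) x) : TangentSpace 𝓘(ℝ, E) x :=
  haveI : CompleteSpace E := FiniteDimensional.complete ℝ E
  haveI : IsManifold 𝓘(ℝ, E) 2 M := inferInstance
  CovariantDerivative.torsion cov x u v

/-- `R(X, Y) Z = ∇_X ∇_Y Z - ∇_Y ∇_X Z - ∇_{[X, Y]} Z` for vector fields `X`, `Y`, `Z`. -/
def curvatureField (cov : TangentConnection E M) (X Y Z : (x : M) → TangentSpace 𝓘(ℝ, E) x)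
    (x : M) : TangentSpace 𝓘(ℝ, E) x :=
  cov (fun z ↦ cov Z z (Y z)) x (X x) - cov (fun z ↦ cov Z z (X z)) x (Y x)
    - cov Z x (VectorField.mlieBracket 𝓘(ℝ, E) X Y x)

/-- The curvature tensor `R_x(u, v) w`: the value at `x` of `R(X, Y) Z` for vector fields `X`, `Y`,
`Z` extending `u`, `v`, `w` (smooth near `x`, with constant components in a local trivialization);
by tensoriality, the choice of the extensions is irrelevant. -/
def curvature (cov : TangentConnection E M) (x : M) (u v w : TangentSpace 𝓘(ℝ, E) x) :
    TangentSpace 𝓘(ℝ, E) x :=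
  curvatureField cov (FiberBundle.extend E u) (FiberBundle.extend E v) (FiberBundle.extend E w) x

/-- `σ : T_x M → T_y N` relates `T^M` with `T^N`. -/
def RelatesTorsion [FiniteDimensional ℝ E] [FiniteDimensional ℝ F]
    (covM : TangentConnection E M) (covN : TangentConnection F N) {x : M} {y : N}
    (σ : TangentSpace 𝓘(ℝ, E) x →L[ℝ] TangentSpace 𝓘(ℝ, F) y) : Prop :=
  ∀ u v, σ (torsion covM x u v) = torsion covN y (σ u) (σ v)

/-- `σ : T_x M → T_y N` relates `R^M` with `R^N`. -/
def RelatesCurvature (covM : TangentConnection E M) (covN : TangentConnection F N) {x : M} {y : N}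
    (σ : TangentSpace 𝓘(ℝ, E) x →L[ℝ] TangentSpace 𝓘(ℝ, F) y) : Prop :=
  ∀ u v w, σ (curvature covM x u v w) = curvature covN y (σ u) (σ v) (σ w)

/-- A smooth map `f : M → N` is affine if `df_x(∇^M_v X) = ∇^N_v (df ∘ X)` for all `v ∈ T_x M` and
all smooth vector fields `X` on `M`, where `df ∘ X` is a vector field along `f`. -/
def IsAffineMap (covM : TangentConnection E M) (covN : TangentConnection F N) (f : M → N) : Prop :=
  ContMDiff 𝓘(ℝ, E) 𝓘(ℝ, F) ∞ f ∧
    ∀ X : (x : M) → TangentSpace 𝓘(ℝ, E) x,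
      ContMDiff 𝓘(ℝ, E) 𝓘(ℝ, E).tangent ∞ (fun x ↦ (⟨x, X x⟩ : TangentBundle 𝓘(ℝ, E) M)) →
      ∀ (x : M) (v : TangentSpace 𝓘(ℝ, E) x),
        mfderiv 𝓘(ℝ, E) 𝓘(ℝ, F) f x (covM X x v) =
          covAlong covN f (fun z ↦ mfderiv 𝓘(ℝ, E) 𝓘(ℝ, F) f z (X z)) univ x v

end AffineGeometry

end

/-! A development is a curve (γ, μ, Σ) of points of Lin(TM, TN) such that γ and μ are geodesics, Σ
maps γ' to μ', and Σ maps parallel fields along γ to parallel fields along μ. The geodesic and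
linear map induced by a geodesic are the final data of a development, and conversely
(`IsDevelopmentOn.isInducedByGeodesic`, `IsInducedByGeodesic.exists_isDevelopmentOn`). So the
hypothesis says that every triple reachable from (x₀, y₀, σ₀) by finitely many developments relates
the torsions and the curvatures.

In charts, f is affine as soon as S = df satisfies dS(d) = S ∘ Γ(d) - Γ'(S d) ∘ S. Together with df
= S this is a total differential system for (f, S), and its integrability conditions are the two
tensor relations. They are available only at reachable triples, which are not known to fill an open
set of Lin(TM, TN), so the Frobenius theorem does not apply directly. Cartan's radial argument
replaces it. From a reachable triple, let (u, w, y, S)(v, t) be the coordinates of the development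
whose geodesic has initial velocity v, and vary v. The defects A = S δu - δy and B = δS - (S ∘ Γ(δu)
- Γ'(δy) ∘ S) measure the failure of y to have derivative S and of S to be parallel. Under the
tensor relations the variational equations become a homogeneous linear system for (A, B)
(`hasDerivAt_developmentDefect`). The defects vanish at t = 0, hence identically
(`developmentDefect_eq_zero`). Since v ↦ u(v, T) is a local diffeomorphism at 0 for a small T > 0,
the final triples of the radial developments are the 1-jets of an affine map near the starting point
(`exists_radialDevelopment`, `exists_radial`).

To globalize, give the set of reachable triples the étale topology in which the 1-jets of local
affine maps form open sets (`Leaf`). An affine map is determined near a point by its 1-jet there,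
and maps with different jets at a point have different jets nearby
(`IsAffineAt.eventually_jet_eq_iff`); this makes the projection to M a separated local
homeomorphism. Completeness of N provides developments along every geodesic of M with a prescribed
initial or final triple, that is, lifts of geodesics. Every point of M has a neighbourhood that
contracts along geodesics, so the projection is a covering (`Leaf.isCoveringMap_proj`).

As M is simply connected, the covering has a section through (x₀, y₀, σ₀), and its N-component is f
(`exists_forall_isAffineAt`). Along a piecewise geodesic from x₀ the jets of f form a piecewise
development; uniqueness of developments (`IsPiecewiseDevelopment.eqOn_jet`) identifies it with the
induced data. -/

open Filter Topology

noncomputable section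

namespace AffineGeometry

section Shortcuts

variable {E : Type*} [NormedAddCommGroup E] [NormedSpace ℝ E]
  {F : Type*} [NormedAddCommGroup F] [NormedSpace ℝ F]

/-! Instance shortcuts: the search for these on iterated spaces of operators is very slow. -/

scoped instance instNormedAddCommGroupCLM : NormedAddCommGroup (E →L[ℝ] F) :=
  ContinuousLinearMap.toNormedAddCommGroup
scoped instance instSeminormedAddCommGroupCLM : SeminormedAddCommGroup (E →L[ℝ] F) :=
  ContinuousLinearMap.toSeminormedAddCommGroup
scoped instance instSeminormedAddGroupCLM : SeminormedAddGroup (E →L[ℝ] F) :=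
  SeminormedAddCommGroup.toSeminormedAddGroup
scoped instance instAddCommGroupCLM : AddCommGroup (E →L[ℝ] F) :=
  ContinuousLinearMap.addCommGroup
scoped instance instContinuousAddCLM : ContinuousAdd (E →L[ℝ] F) :=
  IsTopologicalAddGroup.toContinuousAdd
scoped instance instNormedSpaceCLM : NormedSpace ℝ (E →L[ℝ] F) :=
  ContinuousLinearMap.toNormedSpace
scoped instance instTopologicalSpaceCLM : TopologicalSpace (E →L[ℝ] F) :=
  ContinuousLinearMap.topologicalSpace
scoped instance instAddCommMonoidCLM : AddCommMonoid (E →L[ℝ] F) :=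
  ContinuousLinearMap.addCommMonoid
scoped instance instModuleCLM : Module ℝ (E →L[ℝ] F) :=
  ContinuousLinearMap.module

end Shortcuts

/-! ### Superposition operators on spaces of continuous functions -/

section Nemytskii

universe u v

variable {K : Type v} [TopologicalSpace K] [CompactSpace K]
  {Z W : Type u} [NormedAddCommGroup Z] [NormedSpace ℝ Z]
  [NormedAddCommGroup W] [NormedSpace ℝ W]

variable {V : Type u} [NormedAddCommGroup V] [NormedSpace ℝ V]

variable (K) in
/-- Pointwise application of a bilinear map to a pair of continuous functions. -/
def pointwiseBilin (B : V →L[ℝ] Z →L[ℝ] W) : C(K, V) →L[ℝ] C(K, Z) →L[ℝ] C(K, W) :=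
  LinearMap.mkContinuous₂
    (LinearMap.mk₂ ℝ (fun (A : C(K, V)) (h : C(K, Z)) ↦
        (⟨fun t ↦ B (A t) (h t), by fun_prop⟩ : C(K, W)))
      (fun _ _ _ ↦ by ext; simp) (fun _ _ _ ↦ by ext; simp)
      (fun _ _ _ ↦ by ext; simp) (fun _ _ _ ↦ by ext; simp)) ‖B‖
    (fun A h ↦ by
      rw [ContinuousMap.norm_le _ (by positivity)]
      intro t
      refine (B.le_opNorm₂ _ _).trans ?_
      gcongr
      exacts [A.norm_coe_le_norm t, h.norm_coe_le_norm t])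

@[simp] lemma pointwiseBilin_apply (B : V →L[ℝ] Z →L[ℝ] W) (A : C(K, V)) (h : C(K, Z)) (t : K) :
    pointwiseBilin K B A h t = B (A t) (h t) := rfl

/-- The linearization error is uniform in the parameter: the functions involved take values in a
fixed compact ball, where `fderiv ℝ Ψ` is uniformly continuous, and the mean value inequality
applies pointwise. -/
lemma hasFDerivAt_compLeft [FiniteDimensional ℝ Z] {Ψ : Z → W} (hΨ : ContDiff ℝ 1 Ψ)
    (α : C(K, Z)) :
    HasFDerivAt (fun β : C(K, Z) ↦ (ContinuousMap.comp ⟨Ψ, hΨ.continuous⟩ β : C(K, W)))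
      (pointwiseBilin K (ContinuousLinearMap.id ℝ (Z →L[ℝ] W))
        (ContinuousMap.comp ⟨fderiv ℝ Ψ, hΨ.continuous_fderiv one_ne_zero⟩ α)) α := by
  rw [hasFDerivAt_iff_isLittleO_nhds_zero, Asymptotics.isLittleO_iff]
  intro c hc
  have : ProperSpace Z := FiniteDimensional.proper ℝ Z
  have hunif : UniformContinuousOn (fderiv ℝ Ψ) (Metric.closedBall 0 (‖α‖ + 1)) :=
    (isCompact_closedBall _ _).uniformContinuousOn_of_continuous
      (hΨ.continuous_fderiv one_ne_zero).continuousOn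
  rw [Metric.uniformContinuousOn_iff] at hunif
  obtain ⟨δ, hδ, H⟩ := hunif c hc
  filter_upwards [Metric.ball_mem_nhds (0 : C(K, Z)) (lt_min hδ one_pos)] with h hh
  rw [mem_ball_zero_iff, lt_min_iff] at hh
  rw [ContinuousMap.norm_le _ (by positivity)]
  intro t
  have hmem : ∀ z ∈ segment ℝ (α t) (α t + h t), ‖z - α t‖ ≤ ‖h t‖ := by
    intro z hz
    simpa using norm_sub_le_of_mem_segment hz
  have hht : ‖h t‖ ≤ ‖h‖ := h.norm_coe_le_norm t
  have hαt : ‖α t‖ ≤ ‖α‖ := α.norm_coe_le_norm t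
  have key := (convex_segment (𝕜 := ℝ) (α t) (α t + h t)).norm_image_sub_le_of_norm_fderiv_le'
    (f := Ψ) (φ := fderiv ℝ Ψ (α t)) (C := c)
    (fun z _ ↦ hΨ.differentiable one_ne_zero z) (fun z hz ↦ by
      have h1 := hmem z hz
      have h2 : ‖z‖ ≤ ‖α t‖ + ‖z - α t‖ := by
        simpa using norm_add_le (α t) (z - α t)
      have := H z (by rw [mem_closedBall_zero_iff]; linarith) (α t)
        (by rw [mem_closedBall_zero_iff]; linarith) (by rw [dist_eq_norm]; linarith)
      rw [dist_eq_norm] at this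
      exact this.le)
    (left_mem_segment ℝ _ _) (right_mem_segment ℝ _ _)
  rw [add_sub_cancel_left] at key
  exact key.trans (mul_le_mul_of_nonneg_left hht hc.le)

/-- Composition with a smooth map is a smooth operator on spaces of continuous functions. -/
lemma contDiff_compLeft [FiniteDimensional ℝ Z] (n : ℕ) :
    ∀ {W : Type u} [NormedAddCommGroup W] [NormedSpace ℝ W] {Ψ : Z → W} (hΨ : ContDiff ℝ ∞ Ψ),
    ContDiff ℝ n
      (fun β : C(K, Z) ↦ (ContinuousMap.comp ⟨Ψ, hΨ.continuous⟩ β : C(K, W))) := by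
  induction n with
  | zero =>
    intro W _ _ Ψ hΨ
    exact contDiff_zero.2 (ContinuousMap.continuous_postcomp _)
  | succ n ih =>
    intro W _ _ Ψ hΨ
    -- The derivative of the superposition operator of `Ψ` is that of `fderiv ℝ Ψ` followed by a
    -- bounded linear map, so the induction must let the target space `W` vary.
    have hd : ContDiff ℝ ∞ (fderiv ℝ Ψ) := hΨ.fderiv_right (by simp)
    have key := fun α ↦ hasFDerivAt_compLeft (K := K) (hΨ.of_le (by simp : (1 : ℕ∞ω) ≤ ∞)) α
    rw [Nat.cast_add, Nat.cast_one, contDiff_succ_iff_fderiv]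
    refine ⟨fun α ↦ (key α).differentiableAt, by simp, ?_⟩
    rw [funext fun α ↦ (key α).fderiv]
    exact (pointwiseBilin K (ContinuousLinearMap.id ℝ (Z →L[ℝ] W))).contDiff.comp (ih hd)

end Nemytskii

/-! ### Local flows of class C² and their variational equation -/

section Flow

variable {Z : Type*} [NormedAddCommGroup Z] [NormedSpace ℝ Z]

lemma norm_integral_le_of_Icc (β : C(Icc (-1 : ℝ) 1, Z)) (t : Icc (-1 : ℝ) 1) :
    ‖∫ s in (0 : ℝ)..t, IccExtend (by norm_num : (-1 : ℝ) ≤ 1) β s‖ ≤ ‖β‖ := by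
  refine (intervalIntegral.norm_integral_le_of_norm_le_const (C := ‖β‖) fun s _ ↦
    β.norm_coe_le_norm _).trans ?_
  have : |(t : ℝ) - 0| ≤ 1 := by rw [sub_zero, abs_le]; exact t.2
  nlinarith [norm_nonneg β]

variable (Z) in
/-- The primitive vanishing at `0`, as an operator on `C([-1, 1], Z)`. -/
def primitive : C(Icc (-1 : ℝ) 1, Z) →L[ℝ] C(Icc (-1 : ℝ) 1, Z) :=
  LinearMap.mkContinuous
    { toFun := fun β ↦ ⟨fun t ↦ ∫ s in (0 : ℝ)..t, IccExtend (by norm_num : (-1 : ℝ) ≤ 1) β s,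
        (intervalIntegral.continuous_primitive
          (fun _ _ ↦ (β.continuous.Icc_extend').intervalIntegrable _ _) 0).comp
          continuous_subtype_val⟩
      map_add' := fun β γ ↦ by
        ext t
        exact intervalIntegral.integral_add ((β.continuous.Icc_extend').intervalIntegrable _ _)
          ((γ.continuous.Icc_extend').intervalIntegrable _ _)
      map_smul' := fun c β ↦ by
        ext t
        exact intervalIntegral.integral_smul _ _ } 1
    (fun β ↦ by
      rw [one_mul, ContinuousMap.norm_le _ (by positivity)]
      exact norm_integral_le_of_Icc β)

variable [FiniteDimensional ℝ Z]

/-- Existence of a smooth local flow for a globally defined smooth autonomous field. -/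
lemma exists_flow_of_contDiff {Ψ : Z → Z} (hΨ : ContDiff ℝ ∞ Ψ) (z₀ : Z) :
    ∃ φ : Z × ℝ → Z, φ (z₀, 0) = z₀ ∧ ContDiffAt ℝ 2 φ (z₀, 0) ∧
      ∀ᶠ p in 𝓝 (z₀, (0 : ℝ)), φ (p.1, 0) = p.1 ∧
        HasDerivAt (fun t ↦ φ (p.1, t)) (Ψ (φ p)) p.2 := by
  have : CompleteSpace Z := FiniteDimensional.complete ℝ Z
  let I := Icc (-1 : ℝ) 1
  let N : C(I, Z) → C(I, Z) := fun β ↦ ContinuousMap.comp ⟨Ψ, hΨ.continuous⟩ β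
  have hN : ContDiff ℝ 2 N := contDiff_compLeft 2 hΨ
  let c : Z →L[ℝ] C(I, Z) := ContinuousLinearMap.const ℝ I
  -- A zero β of `f ((z, ε), ·)` solves β' = ε Ψ(β), β(0) = z on [-1, 1]. At ε = 0 the derivative in
  -- β is the identity, so the implicit function theorem yields β = ψ(z, ε), of class C² in (z, ε);
  -- the flow is its value at 1.
  let f : (Z × ℝ) × C(I, Z) → C(I, Z) := fun p ↦ p.2 - c p.1.1 - p.1.2 • primitive Z (N p.2)
  have hf : ContDiff ℝ 2 f := by
    have h2 : ContDiff ℝ 2 (fun p : (Z × ℝ) × C(I, Z) ↦ N p.2) := hN.comp contDiff_snd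
    exact (contDiff_snd.sub (c.contDiff.comp (contDiff_fst.comp contDiff_fst))).sub
      ((contDiff_snd.comp contDiff_fst).smul ((primitive Z).contDiff.comp h2))
  let u : (Z × ℝ) × C(I, Z) := ((z₀, 0), c z₀)
  have hfu : f u = 0 := by simp [f, u]
  have hder : fderiv ℝ f u ∘L .inr ℝ (Z × ℝ) C(I, Z) = ContinuousLinearMap.id ℝ _ := by
    have h1 : HasFDerivAt (fun β ↦ f ((z₀, 0), β)) (fderiv ℝ f u ∘L .inr ℝ (Z × ℝ) C(I, Z))
        (c z₀) :=
      HasFDerivAt.comp (c z₀) (f := fun β ↦ ((z₀, (0 : ℝ)), β))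
        (hf.differentiable two_ne_zero u).hasFDerivAt (hasFDerivAt_prodMk_right _ _)
    have h2 : HasFDerivAt (fun β ↦ f ((z₀, 0), β)) (ContinuousLinearMap.id ℝ _) (c z₀) := by
      have : (fun β ↦ f ((z₀, 0), β)) = fun β ↦ β - c z₀ := by ext; simp [f]
      rw [this]
      exact (hasFDerivAt_id _).sub_const _
    exact h1.unique h2
  have hinv : (fderiv ℝ f u ∘L .inr ℝ (Z × ℝ) C(I, Z)).IsInvertible := by
    rw [hder]; exact ⟨ContinuousLinearEquiv.refl ℝ _, rfl⟩
  let ψ := hf.contDiffAt.implicitFunction (u := u) two_ne_zero hinv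
  have hψu : ψ (z₀, 0) = c z₀ := hf.contDiffAt.implicitFunction_apply_self two_ne_zero hinv
  have hψc : ContDiffAt ℝ 2 ψ (z₀, 0) :=
    hf.contDiffAt.contDiffAt_implicitFunction (u := u) two_ne_zero hinv
  have hψ1 : ∀ᶠ x in 𝓝 (z₀, (0 : ℝ)), f (x, ψ x) = 0 := by
    have := hf.contDiffAt.eventually_apply_implicitFunction (u := u) two_ne_zero hinv
    rwa [hfu] at this
  have hψ2 : ∀ᶠ v in 𝓝 u, f v = 0 ↔ ψ v.1 = v.2 := by
    have := hf.contDiffAt.eventually_apply_eq_iff_implicitFunction (u := u) two_ne_zero hinv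
    rwa [hfu] at this
  let e1 : I := ⟨1, by norm_num, le_rfl⟩
  let ev : C(I, Z) →L[ℝ] Z := ContinuousMap.evalCLM ℝ e1
  refine ⟨fun p ↦ ev (ψ p), ?_, ev.contDiff.contDiffAt.comp _ hψc, ?_⟩
  · simp only [hψu]; rfl
  -- reparametrization by `s ∈ [-1, 1]`
  let m : ℝ → C(I, I) := fun s ↦ ⟨fun t ↦ ⟨t * (projIcc (-1) 1 (by norm_num) s : ℝ), by
      have h1 := t.2
      have h2 := (projIcc (-1 : ℝ) 1 (by norm_num) s).2
      rw [mem_Icc, ← abs_le] at h1 h2 ⊢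
      rw [abs_mul]; exact mul_le_one₀ h1 (abs_nonneg _) h2⟩,
    by fun_prop⟩
  obtain ⟨r, hr, hr1, hr2⟩ : ∃ r > 0, (∀ x ∈ Metric.ball (z₀, (0 : ℝ)) r, f (x, ψ x) = 0) ∧
      (∀ v ∈ Metric.ball u r, f v = 0 ↔ ψ v.1 = v.2) := by
    obtain ⟨r1, h1, h1'⟩ := Metric.eventually_nhds_iff_ball.1 hψ1
    obtain ⟨r2, h2, h2'⟩ := Metric.eventually_nhds_iff_ball.1 hψ2
    exact ⟨min r1 r2, lt_min h1 h2,
      fun x hx ↦ h1' x (Metric.ball_subset_ball (min_le_left _ _) hx),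
      fun x hx ↦ h2' x (Metric.ball_subset_ball (min_le_right _ _) hx)⟩
  obtain ⟨r', hr', hr'r, hψr⟩ : ∃ r' > 0, r' ≤ r ∧
      ∀ x ∈ Metric.ball (z₀, (0 : ℝ)) r', ψ x ∈ Metric.ball (c z₀) r := by
    have : ∀ᶠ x in 𝓝 (z₀, (0 : ℝ)), ψ x ∈ Metric.ball (c z₀) r :=
      hψc.continuousAt (by rw [hψu]; exact Metric.ball_mem_nhds _ hr)
    obtain ⟨r1, h1, h1'⟩ := Metric.eventually_nhds_iff_ball.1 this
    exact ⟨min r1 r, lt_min h1 hr, min_le_right _ _,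
      fun x hx ↦ h1' x (Metric.ball_subset_ball (min_le_left _ _) hx)⟩
  have heq : ∀ x ∈ Metric.ball (z₀, (0 : ℝ)) r', ∀ t : I,
      ψ x t = x.1 +
        x.2 • ∫ s in (0 : ℝ)..t, Ψ (IccExtend (by norm_num : (-1 : ℝ) ≤ 1) (ψ x) s) := by
    intro x hx t
    have := congrArg (fun β : C(I, Z) ↦ β t) (hr1 x (Metric.ball_subset_ball hr'r hx))
    simp only [f, ContinuousMap.sub_apply, ContinuousMap.smul_apply,
      ContinuousMap.zero_apply] at this
    have h3 : c x.1 t = x.1 := rfl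
    rw [h3, sub_sub, sub_eq_zero] at this
    exact this
  -- If β solves the equation with parameter ε, then t ↦ β(s t) solves it with parameter ε s. The
  -- uniqueness part of the implicit function theorem identifies the two, so the values at 1 for
  -- varying ε trace out a single integral curve.
  have hscale : ∀ x ∈ Metric.ball (z₀, (0 : ℝ)) r', ∀ s : I, ψ x s = ψ (x.1, x.2 * s) e1 := by
    intro x hx s
    have hs1 : |(s : ℝ)| ≤ 1 := abs_le.2 s.2
    have hx' : (x.1, x.2 * s) ∈ Metric.ball (z₀, (0 : ℝ)) r := by
      rw [Metric.mem_ball, Prod.dist_eq, max_lt_iff] at hx ⊢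
      refine ⟨hx.1.trans_le hr'r, ?_⟩
      have h2 := hx.2
      simp only [Real.dist_eq, sub_zero] at h2 ⊢
      rw [abs_mul]
      nlinarith [abs_nonneg x.2]
    let β : C(I, Z) := (ψ x).comp (m s)
    have hm : ∀ t : I, (m s t : ℝ) = t * s := fun t ↦ by
      simp only [m, ContinuousMap.coe_mk, projIcc_val]
    have hβ : ∀ t : I, β t = ψ x (m s t) := fun _ ↦ rfl
    have hmem : ((x.1, x.2 * (s : ℝ)), β) ∈ Metric.ball u r := by
      rw [Metric.mem_ball, Prod.dist_eq, max_lt_iff]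
      refine ⟨hx', ?_⟩
      have := hψr x hx
      rw [Metric.mem_ball] at this
      refine lt_of_le_of_lt ?_ this
      rw [ContinuousMap.dist_le dist_nonneg]
      intro t
      exact ContinuousMap.dist_apply_le_dist (f := ψ x) (g := c z₀) (m s t)
    have h0 : f ((x.1, x.2 * (s : ℝ)), β) = 0 := by
      ext t
      simp only [f, ContinuousMap.sub_apply, ContinuousMap.smul_apply, ContinuousMap.zero_apply]
      have h3 : c x.1 t = x.1 := rfl
      rw [h3, hβ, heq x hx, hm, sub_sub, sub_eq_zero]
      congr 1
      rw [mul_smul]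
      congr 1
      have := intervalIntegral.smul_integral_comp_mul_right (a := 0) (b := (t : ℝ))
        (fun s ↦ Ψ (IccExtend (by norm_num : (-1 : ℝ) ≤ 1) (ψ x) s)) (s : ℝ)
      rw [zero_mul] at this
      rw [← this]
      congr 1
      apply intervalIntegral.integral_congr
      intro τ hτ
      have hτI : τ ∈ I := by
        have h1 := t.2
        have := uIcc_subset_Icc (a₂ := (-1 : ℝ)) (b₂ := 1) ⟨by norm_num, by norm_num⟩ h1 hτ
        exact this
      have hτs : τ * s ∈ I := by
        have := (m s ⟨τ, hτI⟩).2
        rwa [hm] at this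
      simp only
      rw [IccExtend_of_mem _ _ hτs, IccExtend_of_mem _ _ hτI]
      change _ = Ψ (ψ x (m s ⟨τ, hτI⟩))
      congr 2
      ext; exact (hm ⟨τ, hτI⟩).symm
    have := (hr2 _ hmem).1 h0
    simp only at this
    rw [this, hβ]
    congr 1
    ext
    rw [hm]; simp [e1]
  have hball : Metric.ball z₀ r' ×ˢ Metric.ball (0 : ℝ) (r' / 2) ∈ 𝓝 (z₀, (0 : ℝ)) :=
    prod_mem_nhds (Metric.ball_mem_nhds _ hr') (Metric.ball_mem_nhds _ (by positivity))
  filter_upwards [hball] with ⟨z, ε⟩ ⟨hz, hε⟩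
  simp only at hz hε ⊢
  have hx : (z, r' / 2) ∈ Metric.ball (z₀, (0 : ℝ)) r' := by
    rw [Metric.mem_ball, Prod.dist_eq, max_lt_iff]
    refine ⟨hz, ?_⟩
    simp only [Real.dist_eq, sub_zero, abs_of_pos (by positivity : 0 < r' / 2)]
    linarith
  -- along the curve `φ (z, ·)`
  have hcurve : ∀ t ∈ Metric.ball (0 : ℝ) (r' / 2), ev (ψ (z, t)) =
      z + (r' / 2) • ∫ s in (0 : ℝ)..(t / (r' / 2)),
        Ψ (IccExtend (by norm_num : (-1 : ℝ) ≤ 1) (ψ (z, r' / 2)) s) := by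
    intro t ht
    have ht1 : t / (r' / 2) ∈ I := by
      rw [Metric.mem_ball, Real.dist_eq, sub_zero] at ht
      rw [mem_Icc, ← abs_le, abs_div, abs_of_pos (by positivity : 0 < r' / 2)]
      exact (div_le_one (by positivity)).2 ht.le
    have h1 := hscale _ hx ⟨_, ht1⟩
    have h2 := heq _ hx ⟨_, ht1⟩
    simp only at h1 h2
    rw [mul_div_cancel₀ t (by positivity : r' / 2 ≠ 0)] at h1
    rw [← h2, h1]; rfl
  constructor
  · rw [hcurve 0 (Metric.mem_ball_self (by positivity))]; simp
  have hcont : Continuous fun s ↦ Ψ (IccExtend (by norm_num : (-1 : ℝ) ≤ 1) (ψ (z, r' / 2)) s) :=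
    hΨ.continuous.comp ((ψ (z, r' / 2)).continuous.Icc_extend')
  have hd : HasDerivAt (fun t ↦ z + (r' / 2) • ∫ s in (0 : ℝ)..(t / (r' / 2)),
      Ψ (IccExtend (by norm_num : (-1 : ℝ) ≤ 1) (ψ (z, r' / 2)) s))
      (Ψ (IccExtend (by norm_num : (-1 : ℝ) ≤ 1) (ψ (z, r' / 2)) (ε / (r' / 2)))) ε := by
    have h1 := (hcont.integral_hasStrictDerivAt 0 (ε / (r' / 2))).hasDerivAt
    have h2 := h1.scomp ε ((hasDerivAt_id ε).div_const (r' / 2))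
    have h3 := (h2.const_smul (r' / 2)).const_add z
    have h4 : r' / 2 * (1 / (r' / 2)) = 1 := by field_simp
    rw [smul_smul, h4, one_smul] at h3
    exact h3
  have heps1 : ε / (r' / 2) ∈ I := by
    rw [Metric.mem_ball, Real.dist_eq, sub_zero] at hε
    rw [mem_Icc, ← abs_le, abs_div, abs_of_pos (by positivity : 0 < r' / 2)]
    exact (div_le_one (by positivity)).2 hε.le
  have h5 : IccExtend (by norm_num : (-1 : ℝ) ≤ 1) (ψ (z, r' / 2)) (ε / (r' / 2)) =
      ev (ψ (z, ε)) := by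
    rw [IccExtend_of_mem _ _ heps1]
    have h1 := hscale _ hx ⟨_, heps1⟩
    simp only at h1
    rw [mul_div_cancel₀ ε (by positivity : r' / 2 ≠ 0)] at h1
    exact h1
  rw [h5] at hd
  refine hd.congr_of_eventuallyEq ?_
  filter_upwards [Metric.isOpen_ball.mem_nhds hε] with t ht using hcurve t ht

/-- Existence of a local flow of class `C²` for a smooth autonomous field on an open set. -/
lemma exists_localFlow {Ψ : Z → Z} {Ω : Set Z} (hΩ : IsOpen Ω) (hΨ : ContDiffOn ℝ ∞ Ψ Ω) {z₀ : Z}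
    (hz₀ : z₀ ∈ Ω) :
    ∃ φ : Z × ℝ → Z, ∃ ε > 0, ContDiffOn ℝ 2 φ (Metric.ball z₀ ε ×ˢ Metric.ball 0 ε) ∧
      (∀ z ∈ Metric.ball z₀ ε, φ (z, 0) = z) ∧
      (∀ z ∈ Metric.ball z₀ ε, ∀ t ∈ Metric.ball (0 : ℝ) ε, φ (z, t) ∈ Ω ∧
        HasDerivAt (fun t ↦ φ (z, t)) (Ψ (φ (z, t))) t) ∧
      (Ψ z₀ = 0 → ∀ t ∈ Metric.ball (0 : ℝ) ε, φ (z₀, t) = z₀) := by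
  obtain ⟨R, hR, hRΩ⟩ := Metric.isOpen_iff.1 hΩ z₀ hz₀
  -- The cut-off field is globally smooth and agrees with `Ψ` on the ball of radius R / 4, in which
  -- the flow stays for small data.
  let b : ContDiffBump z₀ := ⟨R / 4, R / 2, by positivity, by linarith⟩
  have hsm : ContDiff ℝ ∞ (fun z ↦ b z • Ψ z) := by
    rw [contDiff_iff_contDiffAt]
    intro z
    by_cases hz : z ∈ Ω
    · exact b.contDiffAt.smul (hΨ.contDiffAt (hΩ.mem_nhds hz))
    · have : z ∉ tsupport b := fun h ↦ hz (hRΩ (by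
        rw [b.tsupport_eq] at h
        exact Metric.closedBall_subset_ball (by change R / 2 < R; linarith) h))
      have h0 : (fun z ↦ b z • Ψ z) =ᶠ[𝓝 z] fun _ ↦ 0 := by
        filter_upwards [notMem_tsupport_iff_eventuallyEq.1 this] with x hx
        simp [hx]
      exact contDiffAt_const.congr_of_eventuallyEq h0
  obtain ⟨φ, hφ0, hφ2, hφ⟩ := exists_flow_of_contDiff hsm z₀
  obtain ⟨K, U, hU, hUK⟩ :=
    ((hΨ.contDiffAt (hΩ.mem_nhds hz₀)).of_le (by simp)).exists_lipschitzOnWith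
  have h1 : ∀ᶠ p in 𝓝 (z₀, (0 : ℝ)), φ p ∈ U ∩ Metric.ball z₀ (R / 4) :=
    hφ2.continuousAt (by
      rw [hφ0]; exact inter_mem hU (Metric.ball_mem_nhds _ (by positivity)))
  have h2 : ∀ᶠ p in 𝓝 (z₀, (0 : ℝ)), ContDiffAt ℝ 2 φ p := hφ2.eventually (by simp)
  obtain ⟨ε, hε, H⟩ := Metric.eventually_nhds_iff_ball.1 (h1.and (h2.and hφ))
  simp only [← ball_prod_same] at H
  have hode : ∀ z ∈ Metric.ball z₀ ε, ∀ t ∈ Metric.ball (0 : ℝ) ε,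
      HasDerivAt (fun t ↦ φ (z, t)) (Ψ (φ (z, t))) t := by
    intro z hz t ht
    have := (H (z, t) ⟨hz, ht⟩).2.2.2
    rwa [b.one_of_mem_closedBall (Metric.ball_subset_closedBall (H (z, t) ⟨hz, ht⟩).1.2),
      one_smul] at this
  refine ⟨φ, ε, hε, fun p hp ↦ (H p hp).2.1.contDiffWithinAt,
    fun z hz ↦ (H (z, 0) ⟨hz, Metric.mem_ball_self hε⟩).2.2.1, fun z hz t ht ↦
      ⟨hRΩ (Metric.ball_subset_ball (by linarith) (H (z, t) ⟨hz, ht⟩).1.2), hode z hz t ht⟩, ?_⟩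
  intro h0 t ht
  have hz : z₀ ∈ Metric.ball z₀ ε := Metric.mem_ball_self hε
  rw [Real.ball_eq_Ioo, zero_sub, zero_add] at *
  exact ODE_solution_unique_of_mem_Ioo (v := fun _ ↦ Ψ) (s := fun _ ↦ U) (K := K)
    (f := fun t ↦ φ (z₀, t)) (g := fun _ ↦ z₀) (t₀ := 0)
    (fun _ _ ↦ hUK) ⟨by linarith, hε⟩
    (fun t ht ↦ ⟨hode z₀ hz t ht, (H (z₀, t) ⟨hz, ht⟩).1.1⟩)
    (fun t _ ↦ ⟨by simpa [h0] using hasDerivAt_const t z₀, mem_of_mem_nhds hU⟩) hφ0 ht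

omit [FiniteDimensional ℝ Z] in
/-- The variational equation. -/
lemma hasDerivAt_fderiv_flow {V : Type*} [NormedAddCommGroup V] [NormedSpace ℝ V]
    {Ψ : Z → Z} {q : V × ℝ → Z} {D : Set (V × ℝ)} (hD : IsOpen D) (hq : ContDiffOn ℝ 2 q D)
    (hode : ∀ p ∈ D, HasDerivAt (fun t ↦ q (p.1, t)) (Ψ (q p)) p.2) {v : V} {t : ℝ}
    (hp : (v, t) ∈ D) (hΨ : DifferentiableAt ℝ Ψ (q (v, t))) (δ : V) :
    HasDerivAt (fun t ↦ fderiv ℝ q (v, t) (δ, 0))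
      (fderiv ℝ Ψ (q (v, t)) (fderiv ℝ q (v, t) (δ, 0))) t := by
  have hDp : D ∈ 𝓝 (v, t) := hD.mem_nhds hp
  have hq2 : ContDiffAt ℝ 2 q (v, t) := hq.contDiffAt hDp
  have hfd : DifferentiableAt ℝ (fderiv ℝ q) (v, t) :=
    (hq2.fderiv_right (m := 1) (by norm_num)).differentiableAt one_ne_zero
  have hline : HasDerivAt (fun t : ℝ ↦ (v, t)) ((0 : V), (1 : ℝ)) t :=
    (hasDerivAt_const t v).prodMk (hasDerivAt_id t)
  have h1 : HasDerivAt (fun t ↦ fderiv ℝ q (v, t) (δ, 0))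
      (fderiv ℝ (fderiv ℝ q) (v, t) (0, 1) (δ, 0)) t :=
    (hfd.hasFDerivAt.comp_hasDerivAt t hline).clm_apply (hasDerivAt_const t _) |>.congr_deriv
      (by simp)
  -- Exchanging the order of differentiation in t and in the parameter is the only place that needs
  -- the flow to be C² rather than C¹.
  have hsymm := hq2.isSymmSndFDerivAt (by simp) (0, 1) (δ, 0)
  rw [hsymm] at h1
  have h2 : HasFDerivAt (fun p ↦ fderiv ℝ q p (0, 1))
      ((ContinuousLinearMap.apply ℝ Z ((0 : V), (1 : ℝ))) ∘L fderiv ℝ (fderiv ℝ q) (v, t))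
      (v, t) := (ContinuousLinearMap.apply ℝ Z ((0 : V), (1 : ℝ))).hasFDerivAt.comp _
        hfd.hasFDerivAt
  have h3 : (fun p ↦ fderiv ℝ q p (0, 1)) =ᶠ[𝓝 (v, t)] fun p ↦ Ψ (q p) := by
    filter_upwards [hDp] with p hp
    have hqp : HasFDerivAt q (fderiv ℝ q p) p :=
      ((hq.contDiffAt (hD.mem_nhds hp)).differentiableAt two_ne_zero).hasFDerivAt
    have hl : HasDerivAt (fun t : ℝ ↦ (p.1, t)) ((0 : V), (1 : ℝ)) p.2 :=
      (hasDerivAt_const _ _).prodMk (hasDerivAt_id _)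
    exact (hqp.comp_hasDerivAt p.2 hl).unique (hode p hp)
  have h4 : HasFDerivAt (fun p ↦ Ψ (q p)) (fderiv ℝ Ψ (q (v, t)) ∘L fderiv ℝ q (v, t)) (v, t) :=
    hΨ.hasFDerivAt.comp _ (hq2.differentiableAt two_ne_zero).hasFDerivAt
  have h5 := (h2.congr_of_eventuallyEq h3.symm).unique h4
  have h6 := DFunLike.congr_fun h5 (δ, 0)
  simp only [ContinuousLinearMap.comp_apply, ContinuousLinearMap.apply_apply] at h6
  rwa [h6] at h1

end Flow

/-! ### Torsion, curvature and the development defect in coordinates -/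

section Coordinates

variable {E : Type*} [NormedAddCommGroup E] [NormedSpace ℝ E]
  {F : Type*} [NormedAddCommGroup F] [NormedSpace ℝ F]

/-- Torsion of the connection with Christoffel symbols `Γ`, where `∇_v X = dX(v) + Γ v X`. -/
def coordTorsion (Γ : E → E →L[ℝ] E →L[ℝ] E) (x u v : E) : E := Γ x u v - Γ x v u

/-- Curvature of the connection with Christoffel symbols `Γ`. -/
def coordCurvature (Γ : E → E →L[ℝ] E →L[ℝ] E) (x u v w : E) : E :=
  fderiv ℝ Γ x u v w - fderiv ℝ Γ x v u w + Γ x u (Γ x v w) - Γ x v (Γ x u w)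

/-- The derivative in direction `v` of a field `S` of linear maps which is parallel along a map
with derivative `S`. -/
def parallelDeriv (Γ : E → E →L[ℝ] E →L[ℝ] E) (Γ' : F → F →L[ℝ] F →L[ℝ] F) (x : E) (y : F)
    (S : E →L[ℝ] F) (v : E) (v' : F) : E →L[ℝ] F :=
  S ∘L Γ x v - Γ' y v' ∘L S

/-- The integrability computation. In the derivative of A = S δu - δy the exchange of `Γ w δu` and
`Γ δu w` costs torsion terms, which `hT` matches on both sides; in that of B = δS - (parallel
derivative) the mixed derivatives of `Γ` and `Γ'` combine into curvatures, which `hR` matches up to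
a term linear in A. What remains is linear and homogeneous in (A, B). The variation `dw` of the
velocity cancels, so no equation for it is required. -/
lemma hasDerivAt_developmentDefect {Γ : E → E →L[ℝ] E →L[ℝ] E} {Γ' : F → F →L[ℝ] F →L[ℝ] F}
    {u du : ℝ → E} {y dy : ℝ → F} {S dS : ℝ → E →L[ℝ] F} {w dw : E} {t : ℝ}
    (hu : HasDerivAt u w t) (hy : HasDerivAt y (S t w) t)
    (hS : HasDerivAt S (parallelDeriv Γ Γ' (u t) (y t) (S t) w (S t w)) t)
    (hdu : HasDerivAt du dw t) (hdy : HasDerivAt dy (dS t w + S t dw) t)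
    (hdS : HasDerivAt dS (dS t ∘L Γ (u t) w + S t ∘L (fderiv ℝ Γ (u t) (du t) w)
      + S t ∘L Γ (u t) dw - (fderiv ℝ Γ' (y t) (dy t) (S t w)) ∘L S t
      - Γ' (y t) (dS t w + S t dw) ∘L S t - Γ' (y t) (S t w) ∘L dS t) t)
    (hΓ : DifferentiableAt ℝ Γ (u t)) (hΓ' : DifferentiableAt ℝ Γ' (y t))
    (hT : ∀ a b, S t (coordTorsion Γ (u t) a b) = coordTorsion Γ' (y t) (S t a) (S t b))
    (hR : ∀ a b c, S t (coordCurvature Γ (u t) a b c) =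
      coordCurvature Γ' (y t) (S t a) (S t b) (S t c)) :
    ∃ (A : F) (B : E →L[ℝ] F), A = S t (du t) - dy t ∧
      B = dS t - parallelDeriv Γ Γ' (u t) (y t) (S t) (du t) (dy t) ∧
      HasDerivAt (fun t ↦ S t (du t) - dy t) (-(Γ' (y t) A (S t w)) - B w) t ∧
      ∃ D, HasDerivAt
        (fun t ↦ dS t - parallelDeriv Γ Γ' (u t) (y t) (S t) (du t) (dy t)) D t ∧
        ∀ z, D z = B (Γ (u t) w z) - Γ' (y t) (S t w) (B z) +
          coordCurvature Γ' (y t) A (S t w) (S t z) := by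
  refine ⟨_, _, rfl, rfl, ?_, ?_⟩
  · refine ((hS.clm_apply hdu).sub hdy).congr_deriv ?_
    have h1 := hT w (du t)
    simp only [coordTorsion, map_sub, parallelDeriv, sub_apply,
      ContinuousLinearMap.comp_apply] at h1 ⊢
    linear_combination (norm := module) h1
  · have h1 : HasDerivAt (fun t ↦ Γ (u t) (du t)) (fderiv ℝ Γ (u t) w (du t) + Γ (u t) dw) t :=
      (hΓ.hasFDerivAt.comp_hasDerivAt t hu).clm_apply hdu
    have h2 : HasDerivAt (fun t ↦ Γ' (y t) (dy t))
        (fderiv ℝ Γ' (y t) (S t w) (dy t) + Γ' (y t) (dS t w + S t dw)) t :=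
      (hΓ'.hasFDerivAt.comp_hasDerivAt t hy).clm_apply hdy
    refine ⟨_, hdS.sub ((hS.clm_comp h1).sub (h2.clm_comp hS)), fun z ↦ ?_⟩
    have h3 := hR (du t) w z
    simp only [coordCurvature, map_sub, map_add, parallelDeriv, sub_apply,
      add_apply, ContinuousLinearMap.comp_apply] at h3 ⊢
    linear_combination (norm := module) h3

set_option synthInstance.maxHeartbeats 400000 in
/-- Vanishing of the development defect along a curve. -/
lemma developmentDefect_eq_zero {Γ : E → E →L[ℝ] E →L[ℝ] E} {Γ' : F → F →L[ℝ] F →L[ℝ] F}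
    {u du w dw : ℝ → E} {y dy : ℝ → F} {S dS : ℝ → E →L[ℝ] F} {T : ℝ}
    (hu : ∀ t ∈ Icc 0 T, HasDerivAt u (w t) t) (hw : ContinuousOn w (Icc 0 T))
    (hy : ∀ t ∈ Icc 0 T, HasDerivAt y (S t (w t)) t)
    (hS : ∀ t ∈ Icc 0 T,
      HasDerivAt S (parallelDeriv Γ Γ' (u t) (y t) (S t) (w t) (S t (w t))) t)
    (hdu : ∀ t ∈ Icc 0 T, HasDerivAt du (dw t) t)
    (hdy : ∀ t ∈ Icc 0 T, HasDerivAt dy (dS t (w t) + S t (dw t)) t)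
    (hdS : ∀ t ∈ Icc 0 T, HasDerivAt dS (dS t ∘L Γ (u t) (w t)
      + S t ∘L (fderiv ℝ Γ (u t) (du t) (w t))
      + S t ∘L Γ (u t) (dw t) - (fderiv ℝ Γ' (y t) (dy t) (S t (w t))) ∘L S t
      - Γ' (y t) (dS t (w t) + S t (dw t)) ∘L S t - Γ' (y t) (S t (w t)) ∘L dS t) t)
    {Ω : Set E} (hΩ : IsOpen Ω) (hΓ : ContDiffOn ℝ ∞ Γ Ω) (huΩ : ∀ t ∈ Icc 0 T, u t ∈ Ω)
    {Ω' : Set F} (hΩ' : IsOpen Ω') (hΓ' : ContDiffOn ℝ ∞ Γ' Ω') (hyΩ : ∀ t ∈ Icc 0 T, y t ∈ Ω')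
    (hT : ∀ t ∈ Icc 0 T, ∀ a b,
      S t (coordTorsion Γ (u t) a b) = coordTorsion Γ' (y t) (S t a) (S t b))
    (hR : ∀ t ∈ Icc 0 T, ∀ a b c, S t (coordCurvature Γ (u t) a b c) =
      coordCurvature Γ' (y t) (S t a) (S t b) (S t c))
    (hdu0 : du 0 = 0) (hdy0 : dy 0 = 0) (hdS0 : dS 0 = 0) :
    ∀ t ∈ Icc 0 T, dy t = S t (du t) ∧
      dS t = parallelDeriv Γ Γ' (u t) (y t) (S t) (du t) (dy t) := by
  have hcu : ContinuousOn u (Icc 0 T) := fun t ht ↦ (hu t ht).continuousAt.continuousWithinAt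
  have hcy : ContinuousOn y (Icc 0 T) := fun t ht ↦ (hy t ht).continuousAt.continuousWithinAt
  have hcS : ContinuousOn S (Icc 0 T) := fun t ht ↦ (hS t ht).continuousAt.continuousWithinAt
  have c1 : ContinuousOn (fun t ↦ Γ (u t)) (Icc 0 T) := hΓ.continuousOn.comp hcu huΩ
  have c2 : ContinuousOn (fun t ↦ Γ' (y t)) (Icc 0 T) := hΓ'.continuousOn.comp hcy hyΩ
  have c3 : ContinuousOn (fun t ↦ fderiv ℝ Γ' (y t)) (Icc 0 T) :=
    (hΓ'.continuousOn_fderiv_of_isOpen hΩ' (by simp)).comp hcy hyΩ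
  obtain ⟨C₁, b₁⟩ := isCompact_Icc.exists_bound_of_continuousOn hw
  obtain ⟨C₂, b₂⟩ := isCompact_Icc.exists_bound_of_continuousOn hcS
  obtain ⟨C₃, b₃⟩ := isCompact_Icc.exists_bound_of_continuousOn c1
  obtain ⟨C₄, b₄⟩ := isCompact_Icc.exists_bound_of_continuousOn c2
  obtain ⟨C₅, b₅⟩ := isCompact_Icc.exists_bound_of_continuousOn
    (E := F →L[ℝ] F →L[ℝ] F →L[ℝ] F) (f := fun t ↦ fderiv ℝ Γ' (y t)) c3
  obtain ⟨C, hC⟩ : ∃ C, ∀ t ∈ Icc 0 T, ‖w t‖ ≤ C ∧ ‖S t‖ ≤ C ∧ ‖Γ (u t)‖ ≤ C ∧ ‖Γ' (y t)‖ ≤ C ∧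
      ‖fderiv ℝ Γ' (y t)‖ ≤ C := by
    refine ⟨max C₁ (max C₂ (max C₃ (max C₄ C₅))), fun t ht ↦
      ⟨(b₁ t ht).trans ?_, (b₂ t ht).trans ?_, (b₃ t ht).trans ?_, (b₄ t ht).trans ?_,
        (b₅ t ht).trans ?_⟩⟩ <;> simp
  let A : ℝ → F := fun t ↦ S t (du t) - dy t
  let B : ℝ → E →L[ℝ] F := fun t ↦ dS t - parallelDeriv Γ Γ' (u t) (y t) (S t) (du t) (dy t)
  -- A Grönwall estimate for the pair (A, B), with all coefficients bounded by `C` on the compact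
  -- interval. In the curvature term the two summands with `fderiv ℝ Γ'` contribute C⁴ each and the
  -- two products contribute C⁵ each, which gives 2 (C + C²) C³.
  have key : ∀ t ∈ Icc 0 T, ∃ A' B', HasDerivAt A A' t ∧ HasDerivAt B B' t ∧
      ‖A'‖ ≤ (C ^ 3 + C) * ‖(A t, B t)‖ ∧ ‖B'‖ ≤ (C ^ 3 + C ^ 2 + 2 * (C + C ^ 2) * C ^ 3) *
        ‖(A t, B t)‖ := by
    intro t ht
    obtain ⟨a, b, ha, hb, hA, D, hB, hD⟩ := hasDerivAt_developmentDefect (hu t ht) (hy t ht)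
      (hS t ht) (hdu t ht) (hdy t ht) (hdS t ht)
      ((hΓ.contDiffAt (hΩ.mem_nhds (huΩ t ht))).differentiableAt (by simp))
      ((hΓ'.contDiffAt (hΩ'.mem_nhds (hyΩ t ht))).differentiableAt (by simp)) (hT t ht) (hR t ht)
    obtain ⟨n1, n2, n3, n4, n5⟩ := hC t ht
    have hC0 : 0 ≤ C := (norm_nonneg _).trans n1
    have na : ‖a‖ ≤ ‖(A t, B t)‖ := by rw [ha]; exact norm_fst_le (A t, B t)
    have nb : ‖b‖ ≤ ‖(A t, B t)‖ := by rw [hb]; exact norm_snd_le (A t, B t)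
    set m := ‖(A t, B t)‖ with hm
    have hm0 : 0 ≤ m := norm_nonneg _
    have nSw : ‖S t (w t)‖ ≤ C * C := (S t).le_of_opNorm_le_of_le n2 n1
    have nG : ∀ p q : F, ‖Γ' (y t) p q‖ ≤ C * ‖p‖ * ‖q‖ := fun p q ↦
      (Γ' (y t)).le_of_opNorm₂_le_of_le n4 le_rfl le_rfl
    have ndG : ∀ p q r : F, ‖fderiv ℝ Γ' (y t) p q r‖ ≤ C * ‖p‖ * ‖q‖ * ‖r‖ := fun p q r ↦
      (ContinuousLinearMap.le_of_opNorm₂_le_of_le _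
        ((fderiv ℝ Γ' (y t)).le_of_opNorm_le n5 p) le_rfl le_rfl)
    refine ⟨_, D, hA, hB, ?_, ?_⟩
    · refine (norm_sub_le _ _).trans ?_
      rw [norm_neg, add_mul]
      refine add_le_add ((nG _ _).trans ?_) ?_
      · calc C * ‖a‖ * ‖S t (w t)‖ ≤ C * m * (C * C) := by gcongr
          _ = C ^ 3 * m := by ring
      · calc ‖b (w t)‖ ≤ m * C := b.le_of_opNorm_le_of_le nb n1
          _ = C * m := by ring
    · refine D.opNorm_le_bound (by positivity) fun z ↦ ?_
      rw [hD]
      have nSz : ‖S t z‖ ≤ C * ‖z‖ := (S t).le_of_opNorm_le n2 z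
      have e1 : ‖b (Γ (u t) (w t) z)‖ ≤ C ^ 2 * m * ‖z‖ := by
        calc ‖b (Γ (u t) (w t) z)‖ ≤ m * (C * C * ‖z‖) := b.le_of_opNorm_le_of_le nb
              ((Γ (u t)).le_of_opNorm₂_le_of_le n3 n1 le_rfl)
          _ = C ^ 2 * m * ‖z‖ := by ring
      have e2 : ‖Γ' (y t) (S t (w t)) (b z)‖ ≤ C ^ 3 * m * ‖z‖ := by
        calc _ ≤ C * ‖S t (w t)‖ * ‖b z‖ := nG _ _
          _ ≤ C * (C * C) * (m * ‖z‖) := by gcongr; exact b.le_of_opNorm_le nb z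
          _ = _ := by ring
      have e3 : ‖coordCurvature Γ' (y t) a (S t (w t)) (S t z)‖ ≤
          2 * (C + C ^ 2) * C ^ 3 * m * ‖z‖ := by
        have f1 : ‖fderiv ℝ Γ' (y t) a (S t (w t)) (S t z)‖ ≤ C * m * (C * C) * (C * ‖z‖) :=
          (ndG _ _ _).trans (by gcongr)
        have f2 : ‖fderiv ℝ Γ' (y t) (S t (w t)) a (S t z)‖ ≤ C * (C * C) * m * (C * ‖z‖) :=
          (ndG _ _ _).trans (by gcongr)
        have f3 : ‖Γ' (y t) a (Γ' (y t) (S t (w t)) (S t z))‖ ≤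
            C * m * (C * (C * C) * (C * ‖z‖)) :=
          (nG _ _).trans (by gcongr; exact (nG _ _).trans (by gcongr))
        have f4 : ‖Γ' (y t) (S t (w t)) (Γ' (y t) a (S t z))‖ ≤
            C * (C * C) * (C * m * (C * ‖z‖)) :=
          (nG _ _).trans (by gcongr; exact (nG _ _).trans (by gcongr))
        unfold coordCurvature
        refine (norm_sub_le _ _).trans ((add_le_add (norm_add_le _ _) le_rfl).trans ?_)
        refine (add_le_add (add_le_add (norm_sub_le _ _) le_rfl) le_rfl).trans ?_
        linarith
      refine (norm_add_le _ _).trans ((add_le_add (norm_sub_le _ _) le_rfl).trans ?_)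
      linarith
  choose! A' B' hA hB nA nB using key
  have hzero : ∀ t ∈ Icc 0 T, (A t, B t) = 0 := by
    refine eq_zero_of_abs_deriv_le_mul_abs_self_of_eq_zero_right (f := fun t ↦ (A t, B t))
      (f' := fun t ↦ (A' t, B' t))
      (K := max (C ^ 3 + C) (C ^ 3 + C ^ 2 + 2 * (C + C ^ 2) * C ^ 3))
      (fun t ht ↦ ((hA t ht).prodMk (hB t ht)).continuousAt.continuousWithinAt)
      (fun t ht ↦ ((hA t (Ico_subset_Icc_self ht)).prodMk
        (hB t (Ico_subset_Icc_self ht))).hasDerivWithinAt) ?_ ?_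
    · simp [A, B, hdu0, hdy0, hdS0, parallelDeriv]
    · intro t ht
      have ht := Ico_subset_Icc_self ht
      rw [Prod.norm_def, max_le_iff]
      exact ⟨(nA t ht).trans (by gcongr; exact le_max_left _ _),
        (nB t ht).trans (by gcongr; exact le_max_right _ _)⟩
  intro t ht
  have := hzero t ht
  rw [Prod.mk_eq_zero] at this
  exact ⟨(sub_eq_zero.1 this.1).symm, sub_eq_zero.1 this.2⟩

end Coordinates

/-! ### The local Cartan theorem in coordinates -/

section RadialDevelopment

lemma hasDerivAt_fst {X Y : Type*} [NormedAddCommGroup X] [NormedSpace ℝ X]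
    [NormedAddCommGroup Y] [NormedSpace ℝ Y] {f : ℝ → X × Y} {f' : X × Y} {t : ℝ}
    (h : HasDerivAt f f' t) : HasDerivAt (fun t ↦ (f t).1) f'.1 t :=
  (ContinuousLinearMap.fst ℝ X Y).hasFDerivAt.comp_hasDerivAt t h

lemma hasDerivAt_snd {X Y : Type*} [NormedAddCommGroup X] [NormedSpace ℝ X]
    [NormedAddCommGroup Y] [NormedSpace ℝ Y] {f : ℝ → X × Y} {f' : X × Y} {t : ℝ}
    (h : HasDerivAt f f' t) : HasDerivAt (fun t ↦ (f t).2) f'.2 t :=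
  (ContinuousLinearMap.snd ℝ X Y).hasFDerivAt.comp_hasDerivAt t h

variable {E : Type*} [NormedAddCommGroup E] [NormedSpace ℝ E]
  {F : Type*} [NormedAddCommGroup F] [NormedSpace ℝ F]

/-- The autonomous field whose integral curves `(u, w, y, S)` consist of a geodesic `u` with
velocity `w`, its development `y`, and a parallel field `S` of linear maps along them. -/
def developmentField (Γ : E → E →L[ℝ] E →L[ℝ] E) (Γ' : F → F →L[ℝ] F →L[ℝ] F)
    (z : E × E × F × (E →L[ℝ] F)) : E × E × F × (E →L[ℝ] F) :=
  (z.2.1, -Γ z.1 z.2.1 z.2.1, z.2.2.2 z.2.1,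
    parallelDeriv Γ Γ' z.1 z.2.2.1 z.2.2.2 z.2.1 (z.2.2.2 z.2.1))

variable {Γ : E → E →L[ℝ] E →L[ℝ] E} {Γ' : F → F →L[ℝ] F →L[ℝ] F} {Ω : Set E} {Ω' : Set F}

lemma contDiffOn_developmentField (hΓ : ContDiffOn ℝ ∞ Γ Ω) (hΓ' : ContDiffOn ℝ ∞ Γ' Ω')
    {O : Set (E × E × F × (E →L[ℝ] F))} (hO : ∀ z ∈ O, z.1 ∈ Ω ∧ z.2.2.1 ∈ Ω') :
    ContDiffOn ℝ ∞ (developmentField Γ Γ') O := by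
  have h1 : ContDiffOn ℝ ∞ (fun z : E × E × F × (E →L[ℝ] F) ↦ Γ z.1) O :=
    hΓ.comp contDiff_fst.contDiffOn fun z hz ↦ (hO z hz).1
  have h2 : ContDiffOn ℝ ∞ (fun z : E × E × F × (E →L[ℝ] F) ↦ Γ' z.2.2.1) O :=
    hΓ'.comp (contDiff_fst.comp (contDiff_snd.comp contDiff_snd)).contDiffOn
      fun z hz ↦ (hO z hz).2
  have h3 : ContDiffOn ℝ ∞ (fun z : E × E × F × (E →L[ℝ] F) ↦ z.2.1) O :=
    (contDiff_fst.comp contDiff_snd).contDiffOn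
  have h4 : ContDiffOn ℝ ∞ (fun z : E × E × F × (E →L[ℝ] F) ↦ z.2.2.2) O :=
    (contDiff_snd.comp (contDiff_snd.comp contDiff_snd)).contDiffOn
  have h5 := h4.clm_apply h3
  exact h3.prodMk (((h1.clm_apply h3).clm_apply h3).neg.prodMk (h5.prodMk
    ((h4.clm_comp (h1.clm_apply h3)).sub ((h2.clm_apply h5).clm_comp h4))))

/-- Product rule along the line s ↦ z + s X. The velocity component is left out because the defect
equations do not involve it. -/
lemma fderiv_developmentField {z : E × E × F × (E →L[ℝ] F)}
    (hz : DifferentiableAt ℝ (developmentField Γ Γ') z) (hΓ : DifferentiableAt ℝ Γ z.1)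
    (hΓ' : DifferentiableAt ℝ Γ' z.2.2.1) (X : E × E × F × (E →L[ℝ] F)) :
    (fderiv ℝ (developmentField Γ Γ') z X).1 = X.2.1 ∧
    (fderiv ℝ (developmentField Γ Γ') z X).2.2.1 = X.2.2.2 z.2.1 + z.2.2.2 X.2.1 ∧
    (fderiv ℝ (developmentField Γ Γ') z X).2.2.2 =
      X.2.2.2 ∘L Γ z.1 z.2.1 + z.2.2.2 ∘L (fderiv ℝ Γ z.1 X.1 z.2.1)
      + z.2.2.2 ∘L Γ z.1 X.2.1 - (fderiv ℝ Γ' z.2.2.1 X.2.2.1 (z.2.2.2 z.2.1)) ∘L z.2.2.2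
      - Γ' z.2.2.1 (X.2.2.2 z.2.1 + z.2.2.2 X.2.1) ∘L z.2.2.2
      - Γ' z.2.2.1 (z.2.2.2 z.2.1) ∘L X.2.2.2 := by
  obtain ⟨u, w, y, S⟩ := z
  obtain ⟨du, dw, dy, dS⟩ := X
  have lu : HasDerivAt (fun s : ℝ ↦ u + s • du) du 0 := by
    simpa using ((hasDerivAt_id (0 : ℝ)).smul_const du).const_add u
  have lw : HasDerivAt (fun s : ℝ ↦ w + s • dw) dw 0 := by
    simpa using ((hasDerivAt_id (0 : ℝ)).smul_const dw).const_add w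
  have ly : HasDerivAt (fun s : ℝ ↦ y + s • dy) dy 0 := by
    simpa using ((hasDerivAt_id (0 : ℝ)).smul_const dy).const_add y
  have lS : HasDerivAt (fun s : ℝ ↦ S + s • dS) dS 0 := by
    simpa using ((hasDerivAt_id (0 : ℝ)).smul_const dS).const_add S
  have hl := lu.prodMk (lw.prodMk (ly.prodMk lS))
  have h0 : HasFDerivAt (developmentField Γ Γ')
      (fderiv ℝ (developmentField Γ Γ') (u, w, y, S))
      (u + (0 : ℝ) • du, w + (0 : ℝ) • dw, y + (0 : ℝ) • dy, S + (0 : ℝ) • dS) := by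
    simpa using hz.hasFDerivAt
  have h1 := h0.comp_hasDerivAt (0 : ℝ) hl
  have hG : HasDerivAt (fun s : ℝ ↦ Γ (u + s • du)) (fderiv ℝ Γ u du) 0 := by
    have h2 : HasFDerivAt Γ (fderiv ℝ Γ u) (u + (0 : ℝ) • du) := by simpa using hΓ.hasFDerivAt
    exact h2.comp_hasDerivAt (0 : ℝ) lu
  have hG' : HasDerivAt (fun s : ℝ ↦ Γ' (y + s • dy)) (fderiv ℝ Γ' y dy) 0 := by
    have h2 : HasFDerivAt Γ' (fderiv ℝ Γ' y) (y + (0 : ℝ) • dy) := by simpa using hΓ'.hasFDerivAt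
    exact h2.comp_hasDerivAt (0 : ℝ) ly
  have hSw := lS.clm_apply lw
  have h3 := (lS.clm_comp (hG.clm_apply lw)).sub ((hG'.clm_apply hSw).clm_comp lS)
  refine ⟨(hasDerivAt_fst h1).unique lw,
    ((hasDerivAt_fst (hasDerivAt_snd (hasDerivAt_snd h1))).unique hSw).trans (by simp),
    ((hasDerivAt_snd (hasDerivAt_snd (hasDerivAt_snd h1))).unique h3).trans ?_⟩
  ext v
  simp
  abel

variable [FiniteDimensional ℝ E] [FiniteDimensional ℝ F]

/-- Coordinate version of the local Cartan theorem. -/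
theorem exists_radialDevelopment (hΩ : IsOpen Ω) (hΓ : ContDiffOn ℝ ∞ Γ Ω) (hΩ' : IsOpen Ω')
    (hΓ' : ContDiffOn ℝ ∞ Γ' Ω') {O : Set (E × E × F × (E →L[ℝ] F))} (hO : IsOpen O)
    (hOΩ : ∀ z ∈ O, z.1 ∈ Ω ∧ z.2.2.1 ∈ Ω') {x₀ : E} {y₀ : F} {S₀ : E →L[ℝ] F}
    (hz₀ : (x₀, 0, y₀, S₀) ∈ O) :
    ∃ (q : E × ℝ → E × E × F × (E →L[ℝ] F)) (r T : ℝ) (e : OpenPartialHomeomorph E E), 0 < r ∧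
      0 < T ∧ (∀ v ∈ Metric.ball 0 r, q (v, 0) = (x₀, v, y₀, S₀)) ∧
      (∀ v ∈ Metric.ball 0 r, ∀ t ∈ Icc 0 T, q (v, t) ∈ O ∧
        HasDerivAt (fun t ↦ q (v, t)) (developmentField Γ Γ' (q (v, t))) t) ∧
      ContinuousOn q (Metric.ball 0 r ×ˢ Icc 0 T) ∧
      e.source ⊆ Metric.ball 0 r ∧ (∀ v ∈ e.source, e v = (q (v, T)).1) ∧ x₀ ∈ e.target ∧
      e.symm x₀ = 0 ∧ (∀ t ∈ Icc 0 T, q (0, t) = (x₀, 0, y₀, S₀)) ∧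
      ((∀ v ∈ Metric.ball 0 r, ∀ t ∈ Icc 0 T,
          (∀ a b, (q (v, t)).2.2.2 (coordTorsion Γ (q (v, t)).1 a b) =
            coordTorsion Γ' (q (v, t)).2.2.1 ((q (v, t)).2.2.2 a) ((q (v, t)).2.2.2 b)) ∧
          (∀ a b c, (q (v, t)).2.2.2 (coordCurvature Γ (q (v, t)).1 a b c) =
            coordCurvature Γ' (q (v, t)).2.2.1 ((q (v, t)).2.2.2 a) ((q (v, t)).2.2.2 b)
              ((q (v, t)).2.2.2 c))) →
        ∀ x ∈ e.target, HasFDerivAt (fun x ↦ (q (e.symm x, T)).2.2.1) (q (e.symm x, T)).2.2.2 x ∧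
          ∃ S' : E →L[ℝ] E →L[ℝ] F, HasFDerivAt (fun x ↦ (q (e.symm x, T)).2.2.2) S' x ∧
            ∀ d, S' d = parallelDeriv Γ Γ' x (q (e.symm x, T)).2.2.1 (q (e.symm x, T)).2.2.2 d
              ((q (e.symm x, T)).2.2.2 d)) := by
  have hΨ := contDiffOn_developmentField hΓ hΓ' hOΩ
  obtain ⟨φ, ε, hε, hφ2, hφ0, hφ, hφst⟩ := exists_localFlow hO hΨ hz₀
  let j : E × ℝ → (E × E × F × (E →L[ℝ] F)) × ℝ := fun p ↦ ((x₀, p.1, y₀, S₀), p.2)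
  have hj : ContDiff ℝ 2 j := (contDiff_const.prodMk (contDiff_fst.prodMk
    (contDiff_const.prodMk contDiff_const))).prodMk contDiff_snd
  let D : Set (E × ℝ) := Metric.ball 0 ε ×ˢ Metric.ball 0 ε
  have hD : IsOpen D := Metric.isOpen_ball.prod Metric.isOpen_ball
  have hball : ∀ v : E, v ∈ Metric.ball (0 : E) ε → (x₀, v, y₀, S₀) ∈
      Metric.ball (x₀, (0 : E), y₀, S₀) ε := by
    intro v hv
    rw [Metric.mem_ball] at hv ⊢
    simpa [Prod.dist_eq, hε] using hv
  let q : E × ℝ → E × E × F × (E →L[ℝ] F) := fun p ↦ φ (j p)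
  have hq2 : ContDiffOn ℝ 2 q D := hφ2.comp hj.contDiffOn fun p hp ↦ ⟨hball _ hp.1, hp.2⟩
  have hq0 : ∀ v ∈ Metric.ball (0 : E) ε, q (v, 0) = (x₀, v, y₀, S₀) := fun v hv ↦
    hφ0 _ (hball v hv)
  have hqO : ∀ p ∈ D, q p ∈ O := fun p hp ↦ (hφ _ (hball _ hp.1) _ hp.2).1
  have hqd : ∀ p ∈ D, HasDerivAt (fun t ↦ q (p.1, t)) (developmentField Γ Γ' (q p)) p.2 :=
    fun p hp ↦ (hφ _ (hball _ hp.1) _ hp.2).2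
  have hdiff : ∀ p ∈ D, DifferentiableAt ℝ (developmentField Γ Γ') (q p) := fun p hp ↦
    (hΨ.contDiffAt (hO.mem_nhds (hqO p hp))).differentiableAt (by simp)
  have hdΓ : ∀ p ∈ D, DifferentiableAt ℝ Γ (q p).1 := fun p hp ↦
    (hΓ.contDiffAt (hΩ.mem_nhds (hOΩ _ (hqO p hp)).1)).differentiableAt (by simp)
  have hdΓ' : ∀ p ∈ D, DifferentiableAt ℝ Γ' (q p).2.2.1 := fun p hp ↦
    (hΓ'.contDiffAt (hΩ'.mem_nhds (hOΩ _ (hqO p hp)).2)).differentiableAt (by simp)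
  have hvar : ∀ p ∈ D, ∀ δ, HasDerivAt (fun t ↦ fderiv ℝ q (p.1, t) (δ, 0))
      (fderiv ℝ (developmentField Γ Γ') (q p) (fderiv ℝ q p (δ, 0))) p.2 := fun p hp δ ↦
    hasDerivAt_fderiv_flow hD hq2 hqd (v := p.1) (t := p.2) hp (hdiff p hp) δ
  -- derivative in the parameter
  let inlE : E →L[ℝ] E × ℝ := .inl ℝ E ℝ
  let fstE : E × E × F × (E →L[ℝ] F) →L[ℝ] E := .fst ℝ E _
  let A : E × ℝ → E →L[ℝ] E := fun p ↦ fstE ∘L fderiv ℝ q p ∘L inlE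
  have hpar : ∀ p ∈ D, HasFDerivAt (fun v ↦ q (v, p.2)) (fderiv ℝ q p ∘L inlE) p.1 := by
    intro p hp
    have h1 : HasFDerivAt q (fderiv ℝ q p) (p.1, p.2) :=
      ((hq2.contDiffAt (hD.mem_nhds hp)).differentiableAt two_ne_zero).hasFDerivAt
    exact HasFDerivAt.comp (f := fun v : E ↦ (v, p.2)) p.1 h1 (hasFDerivAt_prodMk_left p.1 p.2)
  have hinit : ∀ v ∈ Metric.ball (0 : E) ε, ∀ δ, fderiv ℝ q (v, 0) (δ, 0) = (0, δ, 0, 0) := by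
    intro v hv δ
    have h1 := hpar (v, 0) ⟨hv, Metric.mem_ball_self hε⟩
    have h2 : HasFDerivAt (fun v ↦ q (v, (0 : ℝ)))
        ((0 : E →L[ℝ] E).prod ((ContinuousLinearMap.id ℝ E).prod
          ((0 : E →L[ℝ] F).prod (0 : E →L[ℝ] (E →L[ℝ] F))))) v := by
      refine HasFDerivAt.congr_of_eventuallyEq (f := fun v ↦ (x₀, v, y₀, S₀)) ?_ ?_
      · exact (hasFDerivAt_const _ _).prodMk ((hasFDerivAt_id _).prodMk
          ((hasFDerivAt_const _ _).prodMk (hasFDerivAt_const _ _)))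
      · filter_upwards [Metric.isOpen_ball.mem_nhds hv] with v' hv' using hq0 v' hv'
    exact DFunLike.congr_fun (h1.unique h2) δ
  have hcfd : ContinuousOn (fderiv ℝ q) D := hq2.continuousOn_fderiv_of_isOpen hD (by norm_num)
  have hcA : ContinuousOn A D := (continuousOn_const.clm_comp (hcfd.clm_comp continuousOn_const))
  have h0D : ((0 : E), (0 : ℝ)) ∈ D := ⟨Metric.mem_ball_self hε, Metric.mem_ball_self hε⟩
  -- the derivative of the exponential map at the origin
  have hA0 : HasDerivAt (fun t : ℝ ↦ A (0, t)) (ContinuousLinearMap.id ℝ E) 0 := by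
    have h1 : DifferentiableAt ℝ (fderiv ℝ q) (0, 0) :=
      ((hq2.contDiffAt (hD.mem_nhds h0D)).fderiv_right (m := 1) (by norm_num)).differentiableAt
        one_ne_zero
    have h2 : HasDerivAt (fun t : ℝ ↦ ((0 : E), t)) ((0 : E), (1 : ℝ)) 0 :=
      (hasDerivAt_const _ _).prodMk (hasDerivAt_id _)
    have h3 := h1.hasFDerivAt.comp_hasDerivAt (0 : ℝ) h2
    have h4 := (hasDerivAt_const (0 : ℝ) fstE).clm_comp
      (h3.clm_comp (hasDerivAt_const (0 : ℝ) inlE))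
    refine h4.congr_deriv ?_
    ext δ
    have h5 := (hasDerivAt_fst (hvar _ h0D δ)).unique ((h4.clm_apply (hasDerivAt_const (0 : ℝ) δ)))
    have h6 := (fderiv_developmentField (hdiff _ h0D) (hdΓ _ h0D) (hdΓ' _ h0D)
      (fderiv ℝ q (0, 0) (δ, 0))).1
    rw [h6, hinit 0 h0D.1 δ] at h5
    simpa using h5.symm
  have hA00 : A (0, 0) = 0 := by
    ext δ
    change (fderiv ℝ q (0, 0) (δ, 0)).1 = 0
    rw [hinit 0 h0D.1 δ]
  have : CompleteSpace E := FiniteDimensional.complete ℝ E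
  have hopen : IsOpen (range ((↑) : (E ≃L[ℝ] E) → E →L[ℝ] E)) := ContinuousLinearEquiv.isOpen
  obtain ⟨T, hT, hTε, hTA⟩ : ∃ T : ℝ, 0 < T ∧ T < ε ∧
      A (0, T) ∈ range ((↑) : (E ≃L[ℝ] E) → E →L[ℝ] E) := by
    have h1 := hasDerivAt_iff_tendsto_slope_zero.1 hA0
    simp only [zero_add, hA00, sub_zero] at h1
    have h2 := h1.eventually (hopen.mem_nhds ⟨ContinuousLinearEquiv.refl ℝ E, rfl⟩)
    have h3 : ∀ᶠ t in 𝓝[>] (0 : ℝ), t⁻¹ • A (0, t) ∈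
        range ((↑) : (E ≃L[ℝ] E) → E →L[ℝ] E) :=
      h2.filter_mono (nhdsWithin_mono _ fun t ht ↦ ne_of_gt ht)
    obtain ⟨t, ht, ⟨L, hL⟩, ht'⟩ :=
      ((eventually_mem_nhdsWithin (s := Ioi (0 : ℝ)) (a := 0)).and (h3.and
      (eventually_nhdsWithin_of_eventually_nhds (Iio_mem_nhds hε)))).exists
    refine ⟨t, ht, ht', L.trans (ContinuousLinearEquiv.smulLeft (Units.mk0 t ht.ne')), ?_⟩
    ext δ
    have := DFunLike.congr_fun hL δ
    simp only [ContinuousLinearEquiv.coe_coe] at this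
    have ht0 : t ≠ 0 := ne_of_gt ht
    simp [this, smul_smul, inv_mul_cancel₀ ht0]
  have hIccD : ∀ v ∈ Metric.ball (0 : E) ε, ∀ t ∈ Icc 0 T, (v, t) ∈ D := by
    refine fun v hv t ht ↦ ⟨hv, ?_⟩
    rw [Real.ball_eq_Ioo]
    exact ⟨by linarith [ht.1], by linarith [ht.2]⟩
  have hTI : T ∈ Icc 0 T := ⟨hT.le, le_rfl⟩
  have h0I : (0 : ℝ) ∈ Icc 0 T := ⟨le_rfl, hT.le⟩
  have h0b : (0 : E) ∈ Metric.ball (0 : E) ε := Metric.mem_ball_self hε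
  obtain ⟨L, hL⟩ := hTA
  let ex : E → E := fun v ↦ (q (v, T)).1
  have hexA : ∀ v ∈ Metric.ball (0 : E) ε, HasFDerivAt ex (A (v, T)) v := fun v hv ↦
    (hpar _ (hIccD v hv T hTI)).fst
  have hexc : ContDiffAt ℝ 2 ex 0 := by
    have h1 : ContDiffAt ℝ 2 (fun v : E ↦ q (v, T)) 0 :=
      ContDiffAt.comp (f := fun v : E ↦ (v, T)) (0 : E)
        (hq2.contDiffAt (hD.mem_nhds (hIccD 0 h0b T hTI)))
        (contDiffAt_id.prodMk contDiffAt_const)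
    exact contDiffAt_fst.comp _ h1
  have hex0 : HasFDerivAt ex (L : E →L[ℝ] E) 0 := by rw [hL]; exact hexA 0 h0b
  let e₀ := hexc.toOpenPartialHomeomorph ex hex0 two_ne_zero
  have he₀ : ∀ v, e₀ v = ex v := fun v ↦ rfl
  have h0e₀ : (0 : E) ∈ e₀.source := hexc.mem_toOpenPartialHomeomorph_source hex0 two_ne_zero
  -- The inverse must be differentiable on all of `e.target`, so the source is shrunk to the
  -- parameters at which the derivative is invertible.
  let V : Set E := Metric.ball 0 ε ∩
    (fun v ↦ A (v, T)) ⁻¹' (range ((↑) : (E ≃L[ℝ] E) → E →L[ℝ] E))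
  have hV : IsOpen V := by
    refine ContinuousOn.isOpen_inter_preimage ?_ Metric.isOpen_ball hopen
    exact hcA.comp (by fun_prop) fun v hv ↦ hIccD v hv T hTI
  let e := e₀.restrOpen V hV
  have hes : e.source = e₀.source ∩ V := rfl
  have hst : ∀ t ∈ Icc 0 T, q (0, t) = (x₀, 0, y₀, S₀) := by
    intro t ht
    refine hφst ?_ t (hIccD 0 h0b t ht).2
    simp [developmentField, parallelDeriv]
  have hex00 : e 0 = x₀ := by
    change (q (0, T)).1 = x₀
    rw [hst T hTI]
  have h0e : (0 : E) ∈ e.source := ⟨h0e₀, h0b, L, hL⟩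
  refine ⟨q, ε, T, e, hε, hT, hq0, fun v hv t ht ↦ ⟨hqO _ (hIccD v hv t ht),
    hqd _ (hIccD v hv t ht)⟩, hq2.continuousOn.mono fun p hp ↦ hIccD p.1 hp.1 p.2 hp.2,
    fun v hv ↦ hv.2.1, fun v _ ↦ rfl, ?_, ?_, hst, ?_⟩
  · rw [← hex00]; exact e.map_source h0e
  · rw [← hex00]; exact e.left_inv h0e
  intro hrel x hx
  set v := e.symm x with hv
  have hvs : v ∈ e.source := e.map_target hx
  have hvb : v ∈ Metric.ball (0 : E) ε := hvs.2.1
  obtain ⟨Lv, hLv⟩ := hvs.2.2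
  have hxv : x = (q (v, T)).1 := (e.right_inv hx).symm
  have hesymm : HasFDerivAt e.symm (Lv.symm : E →L[ℝ] E) x := by
    refine e.hasFDerivAt_symm hx ?_
    change HasFDerivAt ex (Lv : E →L[ℝ] E) v
    rw [hLv]
    exact hexA v hvb
  have hqT := (hpar _ (hIccD v hvb T hTI))
  have hcomp : HasFDerivAt (fun x ↦ q (e.symm x, T))
      ((fderiv ℝ q (v, T) ∘L inlE) ∘L (Lv.symm : E →L[ℝ] E)) x := by
    rw [hv] at hqT
    exact HasFDerivAt.comp (g := fun v ↦ q (v, T)) x hqT hesymm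
  -- The defect vanishes at time T for every variation δ of the initial velocity: at t = 0 only the
  -- velocity varies (`hinit`), so the defect starts from zero.
  have hdef : ∀ δ, (fderiv ℝ q (v, T) (δ, 0)).2.2.1 =
        (q (v, T)).2.2.2 (fderiv ℝ q (v, T) (δ, 0)).1 ∧
      (fderiv ℝ q (v, T) (δ, 0)).2.2.2 = parallelDeriv Γ Γ' (q (v, T)).1 (q (v, T)).2.2.1
        (q (v, T)).2.2.2 (fderiv ℝ q (v, T) (δ, 0)).1 (fderiv ℝ q (v, T) (δ, 0)).2.2.1 := by
    intro δ
    have hc := fun t ht ↦ hqd _ (hIccD v hvb t ht)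
    have hX := fun t ht ↦ hvar _ (hIccD v hvb t ht) δ
    have hf := fun t ht ↦ fderiv_developmentField (hdiff _ (hIccD v hvb t ht))
      (hdΓ _ (hIccD v hvb t ht)) (hdΓ' _ (hIccD v hvb t ht)) (fderiv ℝ q (v, t) (δ, 0))
    refine developmentDefect_eq_zero (Γ := Γ) (Γ' := Γ') (T := T)
      (u := fun t ↦ (q (v, t)).1) (w := fun t ↦ (q (v, t)).2.1) (y := fun t ↦ (q (v, t)).2.2.1)
      (S := fun t ↦ (q (v, t)).2.2.2) (du := fun t ↦ (fderiv ℝ q (v, t) (δ, 0)).1)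
      (dw := fun t ↦ (fderiv ℝ q (v, t) (δ, 0)).2.1)
      (dy := fun t ↦ (fderiv ℝ q (v, t) (δ, 0)).2.2.1)
      (dS := fun t ↦ (fderiv ℝ q (v, t) (δ, 0)).2.2.2)
      (fun t ht ↦ (hasDerivAt_fst (hc t ht)))
      (fun t ht ↦ (hasDerivAt_fst (hasDerivAt_snd (hc t ht))).continuousAt.continuousWithinAt)
      (fun t ht ↦ (hasDerivAt_fst (hasDerivAt_snd (hasDerivAt_snd (hc t ht)))))
      (fun t ht ↦ (hasDerivAt_snd (hasDerivAt_snd (hasDerivAt_snd (hc t ht)))))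
      (fun t ht ↦ (hasDerivAt_fst (hX t ht)).congr_deriv (hf t ht).1)
      (fun t ht ↦ (hasDerivAt_fst (hasDerivAt_snd (hasDerivAt_snd (hX t ht)))).congr_deriv
        (hf t ht).2.1)
      (fun t ht ↦ (hasDerivAt_snd (hasDerivAt_snd (hasDerivAt_snd (hX t ht)))).congr_deriv
        (hf t ht).2.2)
      hΩ hΓ (fun t ht ↦ (hOΩ _ (hqO _ (hIccD v hvb t ht))).1)
      hΩ' hΓ' (fun t ht ↦ (hOΩ _ (hqO _ (hIccD v hvb t ht))).2)
      (fun t ht ↦ (hrel v hvb t ht).1) (fun t ht ↦ (hrel v hvb t ht).2) ?_ ?_ ?_ T hTI <;>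
    simp only [hinit v hvb δ]
  have hLd : ∀ d, (fderiv ℝ q (v, T) (Lv.symm d, 0)).1 = d := by
    intro d
    have := DFunLike.congr_fun hLv (Lv.symm d)
    simp only [ContinuousLinearEquiv.coe_coe, ContinuousLinearEquiv.apply_symm_apply] at this
    exact this.symm
  refine ⟨hcomp.snd.snd.fst.congr_fderiv ?_, _, hcomp.snd.snd.snd, fun d ↦ ?_⟩
  · ext d
    have := (hdef (Lv.symm d)).1
    rw [hLd] at this
    exact this
  · have := (hdef (Lv.symm d)).2
    rw [(hdef (Lv.symm d)).1, hLd, ← hxv] at this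
    exact this

end RadialDevelopment

/-! ### Tangent vectors, vector fields and derivatives in charts -/

section Coordinates

variable {E : Type*} [NormedAddCommGroup E] [NormedSpace ℝ E]
  {M : Type*} [TopologicalSpace M] [ChartedSpace E M] [IsManifold 𝓘(ℝ, E) ∞ M]

/-- Components of tangent vectors at `z` in the chart at `x₀`. -/
def toCoord (x₀ z : M) : TangentSpace 𝓘(ℝ, E) z →L[ℝ] E :=
  (trivializationAt E (TangentSpace 𝓘(ℝ, E) : M → Type _) x₀).continuousLinearMapAt ℝ z

/-- The tangent vector at `z` with given components in the chart at `x₀`. -/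
def ofCoord (x₀ z : M) : E →L[ℝ] TangentSpace 𝓘(ℝ, E) z :=
  (trivializationAt E (TangentSpace 𝓘(ℝ, E) : M → Type _) x₀).symmL ℝ z

lemma mem_baseSet {x₀ z : M} (hz : z ∈ (chartAt E x₀).source) :
    z ∈ (trivializationAt E (TangentSpace 𝓘(ℝ, E) : M → Type _) x₀).baseSet := by
  simpa using hz

@[simp] lemma toCoord_ofCoord {x₀ z : M} (hz : z ∈ (chartAt E x₀).source) (e : E) :
    toCoord x₀ z (ofCoord x₀ z e) = e :=
  Trivialization.continuousLinearMapAt_symmL _ (mem_baseSet hz) e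

@[simp] lemma ofCoord_toCoord {x₀ z : M} (hz : z ∈ (chartAt E x₀).source)
    (v : TangentSpace 𝓘(ℝ, E) z) : ofCoord x₀ z (toCoord x₀ z v) = v :=
  Trivialization.symmL_continuousLinearMapAt _ (mem_baseSet hz) v

lemma toCoord_injective {x₀ z : M} (hz : z ∈ (chartAt E x₀).source) :
    Function.Injective (toCoord (E := E) x₀ z) :=
  Function.LeftInverse.injective (ofCoord_toCoord hz)

lemma toCoord_apply {x₀ z : M} (hz : z ∈ (chartAt E x₀).source) (v : TangentSpace 𝓘(ℝ, E) z) :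
    toCoord x₀ z v = (trivializationAt E (TangentSpace 𝓘(ℝ, E) : M → Type _) x₀ ⟨z, v⟩).2 :=
  Trivialization.continuousLinearMapAt_apply_of_mem (R := ℝ) _ (mem_baseSet hz) v

lemma ofCoord_apply {x₀ z : M} (hz : z ∈ (chartAt E x₀).source) (e : E) :
    ofCoord x₀ z e = (trivializationAt E (TangentSpace 𝓘(ℝ, E) : M → Type _) x₀).symm z e :=
  Trivialization.symmL_apply _ (mem_baseSet hz) e

lemma hasMFDerivAt_chart {x₀ z : M} (hz : z ∈ (chartAt E x₀).source) :
    HasMFDerivAt 𝓘(ℝ, E) 𝓘(ℝ, E) (chartAt E x₀) z (toCoord x₀ z) := by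
  have h := (mdifferentiableAt_extChartAt (I := 𝓘(ℝ, E)) hz).hasMFDerivAt
  rw [← TangentBundle.continuousLinearMapAt_trivializationAt hz] at h
  exact h

lemma hasMFDerivAt_chart_symm {x₀ : M} {e : E} (he : e ∈ (chartAt E x₀).target) :
    HasMFDerivAt 𝓘(ℝ, E) 𝓘(ℝ, E) (chartAt E x₀).symm e
      (ofCoord (E := E) x₀ ((chartAt E x₀).symm e)) := by
  have hz : (chartAt E x₀).symm e ∈ (chartAt E x₀).source := (chartAt E x₀).map_target he
  have h := (mdifferentiableWithinAt_extChartAt_symm (I := 𝓘(ℝ, E)) (x := x₀) (z := e)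
    (by simpa using he)).hasMFDerivWithinAt
  have h' := TangentBundle.symmL_trivializationAt (𝕜 := ℝ) (I := 𝓘(ℝ, E)) hz
  rw [extChartAt_coe, Function.comp_apply, (chartAt E x₀).right_inv he] at h'
  have h'' : HasMFDerivWithinAt 𝓘(ℝ, E) 𝓘(ℝ, E) (chartAt E x₀).symm univ e
      (mfderivWithin 𝓘(ℝ, E) 𝓘(ℝ, E) (extChartAt 𝓘(ℝ, E) x₀).symm (range 𝓘(ℝ, E)) e) := by
    have hr : range 𝓘(ℝ, E) = (univ : Set E) := by simp
    have := h
    rw [hr] at this ⊢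
    exact this
  replace h'' := hasMFDerivWithinAt_univ.1 h''
  have h3 : ofCoord (E := E) x₀ ((chartAt E x₀).symm e) =
    mfderivWithin 𝓘(ℝ, E) 𝓘(ℝ, E) (extChartAt 𝓘(ℝ, E) x₀).symm (range 𝓘(ℝ, E)) e := h'
  have h4 : HasMFDerivAt 𝓘(ℝ, E) 𝓘(ℝ, E) (chartAt E x₀).symm e
      (ofCoord (E := E) x₀ ((chartAt E x₀).symm e)) ↔
    HasMFDerivAt 𝓘(ℝ, E) 𝓘(ℝ, E) (chartAt E x₀).symm e
      (mfderivWithin 𝓘(ℝ, E) 𝓘(ℝ, E) (extChartAt 𝓘(ℝ, E) x₀).symm (range 𝓘(ℝ, E)) e) := by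
    exact iff_of_eq (congrArg _ h3)
  exact h4.2 h''

lemma toCoord_hasMFDerivWithinAt {A P : Type*} [NormedAddCommGroup A] [NormedSpace ℝ A]
    [TopologicalSpace P] [ChartedSpace A P] {f : P → M} {S : Set P} {p : P} {x₀ : M}
    (hp : f p ∈ (chartAt E x₀).source)
    {L : TangentSpace 𝓘(ℝ, A) p →L[ℝ] TangentSpace 𝓘(ℝ, E) (f p)}
    (h : HasMFDerivWithinAt 𝓘(ℝ, A) 𝓘(ℝ, E) f S p L) :
    HasMFDerivWithinAt 𝓘(ℝ, A) 𝓘(ℝ, E) (chartAt E x₀ ∘ f) S p (toCoord (E := E) x₀ (f p) ∘L L) :=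
  (hasMFDerivAt_chart hp).comp_hasMFDerivWithinAt p h

lemma hasMFDerivWithinAt_of_chart {A P : Type*} [NormedAddCommGroup A] [NormedSpace ℝ A]
    [TopologicalSpace P] [ChartedSpace A P] {f : P → M} {S : Set P} {p : P} {x₀ : M}
    (hc : ContinuousWithinAt f S p) (hp : f p ∈ (chartAt E x₀).source)
    {L : TangentSpace 𝓘(ℝ, A) p →L[ℝ] E}
    (h : HasMFDerivWithinAt 𝓘(ℝ, A) 𝓘(ℝ, E) (chartAt E x₀ ∘ f) S p L) :
    HasMFDerivWithinAt 𝓘(ℝ, A) 𝓘(ℝ, E) f S p (ofCoord x₀ (f p) ∘L L) := by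
  have h1 := (hasMFDerivAt_chart_symm ((chartAt E x₀).map_source hp)).comp_hasMFDerivWithinAt
    (f := chartAt E x₀ ∘ f) p h
  have h2 : f =ᶠ[𝓝[S] p] (chartAt E x₀).symm ∘ (chartAt E x₀ ∘ f) := by
    filter_upwards [hc ((chartAt E x₀).open_source.mem_nhds hp)] with q hq
    exact ((chartAt E x₀).left_inv hq).symm
  have h3 := h1.congr_of_eventuallyEq h2 ((chartAt E x₀).left_inv hp).symm
  have key : ∀ z, z = f p → ∀ L' : E →L[ℝ] TangentSpace 𝓘(ℝ, E) z,
      L' = ofCoord x₀ z → (show E →L[ℝ] E from L') = ofCoord x₀ (f p) := by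
    rintro z rfl L' rfl; rfl
  have h4 : (show E →L[ℝ] E from ofCoord x₀ ((chartAt E x₀).symm (chartAt E x₀ (f p)))) =
      ofCoord x₀ (f p) := key _ ((chartAt E x₀).left_inv hp) _ rfl
  have h5 : HasMFDerivWithinAt 𝓘(ℝ, A) 𝓘(ℝ, E) f S p
    ((show E →L[ℝ] E from ofCoord x₀ ((chartAt E x₀).symm (chartAt E x₀ (f p)))) ∘L
      (show A →L[ℝ] E from L)) := h3
  rw [h4] at h5
  exact h5

/-- Derivatives of vector-valued functions, computed in a chart. -/
lemma hasFDerivAt_comp_chart_symm {V : Type*} [NormedAddCommGroup V] [NormedSpace ℝ V]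
    {g : M → V} {x₀ z : M} (hz : z ∈ (chartAt E x₀).source)
    (hg : MDifferentiableAt 𝓘(ℝ, E) 𝓘(ℝ, V) g z) :
    HasFDerivAt (g ∘ (chartAt E x₀).symm) (mvfderiv 𝓘(ℝ, E) g z ∘L ofCoord x₀ z)
      (chartAt E x₀ z) := by
  have h1 := hasMFDerivAt_chart_symm ((chartAt E x₀).map_source hz)
  have hz' := (chartAt E x₀).left_inv hz
  have h2 : HasMFDerivAt 𝓘(ℝ, E) 𝓘(ℝ, V) g ((chartAt E x₀).symm (chartAt E x₀ z))
    (mfderiv 𝓘(ℝ, E) 𝓘(ℝ, V) g ((chartAt E x₀).symm (chartAt E x₀ z))) := by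
    rw [hz']; exact hg.hasMFDerivAt
  have h3 := (h2.comp _ h1).hasFDerivAt
  convert! h3 using 1
  rw [hz']
  rfl

lemma mdifferentiableAt_of_comp_chart_symm {V : Type*} [NormedAddCommGroup V] [NormedSpace ℝ V]
    {g : M → V} {x₀ z : M} (hz : z ∈ (chartAt E x₀).source)
    (hg : DifferentiableAt ℝ (g ∘ (chartAt E x₀).symm) (chartAt E x₀ z)) :
    MDifferentiableAt 𝓘(ℝ, E) 𝓘(ℝ, V) g z := by
  have h1 := hg.mdifferentiableAt.comp z (hasMFDerivAt_chart hz).mdifferentiableAt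
  refine h1.congr_of_eventuallyEq ?_
  filter_upwards [(chartAt E x₀).open_source.mem_nhds hz] with q hq
  simp [(chartAt E x₀).left_inv hq]

/-- The components of a vector field in a chart. -/
def coordField (x₀ : M) (X : (z : M) → TangentSpace 𝓘(ℝ, E) z) (e : E) : E :=
  toCoord x₀ ((chartAt E x₀).symm e) (X ((chartAt E x₀).symm e))

lemma coordField_chart {x₀ z : M} (hz : z ∈ (chartAt E x₀).source)
    (X : (z : M) → TangentSpace 𝓘(ℝ, E) z) :
    coordField x₀ X (chartAt E x₀ z) = toCoord x₀ z (X z) := by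
  simp only [coordField]
  rw [(chartAt E x₀).left_inv hz]

lemma mdifferentiableAt_field_iff {x₀ z : M} (hz : z ∈ (chartAt E x₀).source)
    (X : (z : M) → TangentSpace 𝓘(ℝ, E) z) :
    MDifferentiableAt 𝓘(ℝ, E) 𝓘(ℝ, E).tangent
        (fun z ↦ (⟨z, X z⟩ : TangentBundle 𝓘(ℝ, E) M)) z ↔
      DifferentiableAt ℝ (coordField x₀ X) (chartAt E x₀ z) := by
  rw [Trivialization.mdifferentiableAt_section_iff 𝓘(ℝ, E) _ X (mem_baseSet hz)]
  have key : (coordField x₀ X ∘ chartAt E x₀) =ᶠ[𝓝 z] fun z ↦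
      (trivializationAt E (TangentSpace 𝓘(ℝ, E) : M → Type _) x₀ ⟨z, X z⟩).2 := by
    filter_upwards [(chartAt E x₀).open_source.mem_nhds hz] with q hq
    rw [Function.comp_apply, coordField_chart hq, toCoord_apply hq]
  rw [← key.mdifferentiableAt_iff]
  refine ⟨fun h ↦ ?_, fun h ↦ h.mdifferentiableAt.comp z (hasMFDerivAt_chart hz).mdifferentiableAt⟩
  refine (hasFDerivAt_comp_chart_symm hz h).differentiableAt.congr_of_eventuallyEq ?_
  filter_upwards [(chartAt E x₀).open_target.mem_nhds ((chartAt E x₀).map_source hz)] with e he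
  simp [(chartAt E x₀).right_inv he]

end Coordinates

/-! ### Christoffel symbols and the coordinate form of a connection -/

section Christoffel

variable {E : Type*} [NormedAddCommGroup E] [NormedSpace ℝ E]
  {M : Type*} [TopologicalSpace M] [ChartedSpace E M] [IsManifold 𝓘(ℝ, E) ∞ M]

lemma coordField_ofCoord {x₀ : M} (w : E) {e : E} (he : e ∈ (chartAt E x₀).target) :
    coordField x₀ (fun z ↦ ofCoord x₀ z w) e = w :=
  toCoord_ofCoord ((chartAt E x₀).map_target he) w

lemma mdifferentiableAt_ofCoord {x₀ z : M} (hz : z ∈ (chartAt E x₀).source) (w : E) :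
    MDifferentiableAt 𝓘(ℝ, E) 𝓘(ℝ, E).tangent
        (fun z ↦ (⟨z, ofCoord x₀ z w⟩ : TangentBundle 𝓘(ℝ, E) M)) z := by
  rw [mdifferentiableAt_field_iff hz]
  refine (differentiableAt_const w).congr_of_eventuallyEq ?_
  filter_upwards [(chartAt E x₀).open_target.mem_nhds ((chartAt E x₀).map_source hz)] with e he
  exact coordField_ofCoord w he

/-- The change of components from the chart at `x₀` to the chart at `x₁`. -/
def transition (x₀ x₁ z : M) : E →L[ℝ] E := toCoord x₁ z ∘L ofCoord x₀ z

lemma transition_toCoord {x₀ x₁ z : M} (hz : z ∈ (chartAt E x₀).source)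
    (v : TangentSpace 𝓘(ℝ, E) z) : transition x₀ x₁ z (toCoord x₀ z v) = toCoord x₁ z v := by
  simp [transition, ofCoord_toCoord hz]

lemma transition_transition {x₀ x₁ z : M} (hz : z ∈ (chartAt E x₀).source)
    (hz₁ : z ∈ (chartAt E x₁).source) (v : E) :
    transition x₁ x₀ z (transition x₀ x₁ z v) = v := by
  simp [transition, ofCoord_toCoord hz₁, toCoord_ofCoord hz]

lemma contMDiffAt_transition {x₀ x₁ z : M} (hz : z ∈ (chartAt E x₀).source)
    (hz₁ : z ∈ (chartAt E x₁).source) :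
    ContMDiffAt 𝓘(ℝ, E) 𝓘(ℝ, E →L[ℝ] E) ∞ (transition (E := E) x₀ x₁) z := by
  have h := contMDiffAt_coordChangeL (n := ∞) (IB := 𝓘(ℝ, E)) (mem_baseSet (E := E) hz)
    (mem_baseSet (E := E) hz₁)
  refine h.congr_of_eventuallyEq ?_
  filter_upwards [(chartAt E x₀).open_source.mem_nhds hz, (chartAt E x₁).open_source.mem_nhds hz₁]
    with q hq hq₁
  ext v
  simp only [transition, ContinuousLinearMap.comp_apply, ContinuousLinearEquiv.coe_coe]
  rw [Trivialization.coordChangeL_apply _ _ ⟨mem_baseSet hq, mem_baseSet hq₁⟩,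
    ofCoord_apply hq, toCoord_apply hq₁]

lemma contMDiffAt_chart_symm {x₀ : M} {e : E} (he : e ∈ (chartAt E x₀).target) :
    ContMDiffAt 𝓘(ℝ, E) 𝓘(ℝ, E) ∞ (chartAt E x₀).symm e :=
  contMDiffOn_chart_symm.contMDiffAt ((chartAt E x₀).open_target.mem_nhds he)

lemma contDiffAt_transition {x₀ x₁ x₂ z : M} (hz : z ∈ (chartAt E x₀).source)
    (hz₁ : z ∈ (chartAt E x₁).source) (hz₂ : z ∈ (chartAt E x₂).source) :
    ContDiffAt ℝ ∞ (fun e ↦ transition (E := E) x₀ x₁ ((chartAt E x₂).symm e))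
      (chartAt E x₂ z) := by
  rw [← contMDiffAt_iff_contDiffAt]
  refine ContMDiffAt.comp (g := transition (E := E) x₀ x₁) _ ?_
    (contMDiffAt_chart_symm ((chartAt E x₂).map_source hz₂))
  rw [(chartAt E x₂).left_inv hz₂]
  exact contMDiffAt_transition hz hz₁

/-- The extensions that occur in `covAlong` and `curvature` have constant components in the chart
centred at the base point; in other charts they vary through `transition`. -/
lemma extend_eq {y z : M} (hz : z ∈ (chartAt E y).source) (w : TangentSpace 𝓘(ℝ, E) y) :
    FiberBundle.extend E w z = ofCoord y z (toCoord y y w) := by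
  rw [ofCoord_apply hz, toCoord_apply (mem_chart_source E y)]
  rfl

lemma contMDiffAt_ofCoord {x₀ z : M} (hz : z ∈ (chartAt E x₀).source) (w : E) :
    ContMDiffAt 𝓘(ℝ, E) 𝓘(ℝ, E).tangent ∞
        (fun z ↦ (⟨z, ofCoord x₀ z w⟩ : TangentBundle 𝓘(ℝ, E) M)) z := by
  refine ((trivializationAt E (TangentSpace 𝓘(ℝ, E) : M → Type _) x₀).contMDiffAt_section_iff
    (mem_baseSet hz)).2 ?_
  refine (contMDiffAt_const (c := w)).congr_of_eventuallyEq ?_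
  filter_upwards [(chartAt E x₀).open_source.mem_nhds hz] with q hq
  rw [← toCoord_apply hq, toCoord_ofCoord hq]

lemma cov_sum (cov : TangentConnection E M) {ι : Type*} (s : Finset ι)
    (X : ι → (z : M) → TangentSpace 𝓘(ℝ, E) z) {z : M}
    (hX : ∀ i ∈ s, MDifferentiableAt 𝓘(ℝ, E) 𝓘(ℝ, E).tangent
        (fun z ↦ (⟨z, X i z⟩ : TangentBundle 𝓘(ℝ, E) M)) z) :
    cov (fun z ↦ ∑ i ∈ s, X i z) z = ∑ i ∈ s, cov (X i) z := by
  classical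
  induction s using Finset.induction_on with
  | empty =>
    simp only [Finset.sum_empty]
    exact congrFun cov.zero z
  | insert a s ha ih =>
    simp only [Finset.sum_insert ha]
    rw [← ih fun i hi ↦ hX i (Finset.mem_insert_of_mem hi)]
    exact cov.isCovariantDerivativeOnUniv.add (hX a (Finset.mem_insert_self a s))
      (MDifferentiableAt.sum_section fun i hi ↦ hX i (Finset.mem_insert_of_mem hi))

variable [FiniteDimensional ℝ E]

/-- Christoffel symbols of a connection in the chart at `x₀`: in components, `∇_v X` is
`dX(v) + Γ(v, X)`. -/
def christoffel (cov : TangentConnection E M) (x₀ : M) (e : E) : E →L[ℝ] E →L[ℝ] E :=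
  ∑ i, (ContinuousLinearMap.smulRightL ℝ E E
      (LinearMap.toContinuousLinearMap ((Module.finBasis ℝ E).coord i))) ∘L
    (toCoord x₀ ((chartAt E x₀).symm e) ∘L
      cov (fun z ↦ ofCoord x₀ z (Module.finBasis ℝ E i)) ((chartAt E x₀).symm e) ∘L
      ofCoord x₀ ((chartAt E x₀).symm e))

lemma christoffel_chart (cov : TangentConnection E M) {x₀ z : M}
    (hz : z ∈ (chartAt E x₀).source) (v w : E) :
    christoffel cov x₀ (chartAt E x₀ z) v w = ∑ i, (Module.finBasis ℝ E).repr w i •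
      toCoord x₀ z (cov (fun z ↦ ofCoord x₀ z (Module.finBasis ℝ E i)) z (ofCoord x₀ z v)) := by
  simp only [christoffel]
  rw [(chartAt E x₀).left_inv hz]
  simp

/-- A connection in coordinates. -/
lemma toCoord_cov (cov : TangentConnection E M) {x₀ z : M} (hz : z ∈ (chartAt E x₀).source)
    {X : (z : M) → TangentSpace 𝓘(ℝ, E) z}
    (hX : MDifferentiableAt 𝓘(ℝ, E) 𝓘(ℝ, E).tangent
        (fun z ↦ (⟨z, X z⟩ : TangentBundle 𝓘(ℝ, E) M)) z) (v : TangentSpace 𝓘(ℝ, E) z) :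
    toCoord x₀ z (cov X z v) = fderiv ℝ (coordField x₀ X) (chartAt E x₀ z) (toCoord x₀ z v) +
      christoffel cov x₀ (chartAt E x₀ z) (toCoord x₀ z v) (toCoord x₀ z (X z)) := by
  set b := Module.finBasis ℝ E
  -- Near z the field is a combination of the coordinate frame with coefficients `c`; locality,
  -- additivity and the Leibniz rule reduce `cov X` to the derivatives of the frame.
  let c : Fin (Module.finrank ℝ E) → M → ℝ := fun i z ↦ b.repr (toCoord x₀ z (X z)) i
  have hXd := (mdifferentiableAt_field_iff hz X).1 hX
  have hcomp : ∀ i, HasFDerivAt (c i ∘ (chartAt E x₀).symm)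
      ((LinearMap.toContinuousLinearMap (b.coord i)) ∘L
        fderiv ℝ (coordField x₀ X) (chartAt E x₀ z)) (chartAt E x₀ z) := fun i ↦
    (LinearMap.toContinuousLinearMap (b.coord i)).hasFDerivAt.comp _ hXd.hasFDerivAt
  have hc : ∀ i, MDifferentiableAt 𝓘(ℝ, E) 𝓘(ℝ) (c i) z := fun i ↦
    mdifferentiableAt_of_comp_chart_symm hz (hcomp i).differentiableAt
  have hfr := fun i ↦ mdifferentiableAt_ofCoord hz (b i)
  have hcf : ∀ i, MDifferentiableAt 𝓘(ℝ, E) 𝓘(ℝ, E).tangent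
        (fun z ↦ (⟨z, c i z • ofCoord x₀ z (b i)⟩ : TangentBundle 𝓘(ℝ, E) M)) z := fun i ↦
    (hc i).smul_section (hfr i)
  have hev : ∀ᶠ q in 𝓝 z, X q = ∑ i, c i q • ofCoord x₀ q (b i) := by
    filter_upwards [(chartAt E x₀).open_source.mem_nhds hz] with q hq
    apply toCoord_injective hq
    simp only [map_sum, map_smul, toCoord_ofCoord hq, c]
    exact (b.sum_repr _).symm
  have h1 := cov.isCovariantDerivativeOnUniv.congr_of_eventuallyEq hX
    (MDifferentiableAt.sum_section (s := Finset.univ) fun i _ ↦ hcf i) univ_mem hev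
  have h2 : cov X z = ∑ i, cov (fun q ↦ c i q • ofCoord x₀ q (b i)) z :=
    h1.trans (cov_sum cov Finset.univ _ fun i _ ↦ hcf i)
  have h3 : ∀ i, cov (fun q ↦ c i q • ofCoord x₀ q (b i)) z v =
      c i z • cov (fun q ↦ ofCoord x₀ q (b i)) z v +
        (mvfderiv 𝓘(ℝ, E) (c i) z v) • ofCoord x₀ z (b i) := fun i ↦
    congrArg (fun L ↦ L v) (cov.isCovariantDerivativeOnUniv.leibniz (hfr i) (hc i))
  have h4 : ∀ i, mvfderiv 𝓘(ℝ, E) (c i) z v =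
      b.repr (fderiv ℝ (coordField x₀ X) (chartAt E x₀ z) (toCoord x₀ z v)) i := by
    intro i
    have := (hasFDerivAt_comp_chart_symm hz (hc i)).unique (hcomp i)
    have := congrArg (fun L ↦ L (toCoord x₀ z v)) this
    simpa [ofCoord_toCoord hz] using this
  rw [h2, sum_apply, map_sum, christoffel_chart cov hz]
  simp only [h3, h4, map_add, map_smul, toCoord_ofCoord hz, ofCoord_toCoord hz,
    Finset.sum_add_distrib]
  rw [b.sum_repr, add_comm]

/-- Smoothness of a connection is applied to globally smooth fields, whereas the coordinate frame is
smooth only on the chart domain. The frame is multiplied by a bump function equal to 1 near the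
point, and locality of `cov` removes the factor again. -/
lemma contDiffOn_christoffel [T2Space M] (cov : TangentConnection E M)
    [CovariantDerivative.ContMDiffCovariantDerivative cov ∞] (x₀ : M) :
    ContDiffOn ℝ ∞ (christoffel cov x₀) (chartAt E x₀).target := by
  intro e he
  refine ContDiffAt.contDiffWithinAt ?_
  have hz : (chartAt E x₀).symm e ∈ (chartAt E x₀).source := (chartAt E x₀).map_target he
  set z := (chartAt E x₀).symm e with hzdef
  refine ContDiffAt.sum fun i _ ↦ ?_
  refine ContDiffAt.clm_comp contDiffAt_const ?_
  set X : (z : M) → TangentSpace 𝓘(ℝ, E) z := fun z ↦ ofCoord x₀ z (Module.finBasis ℝ E i)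
  obtain ⟨ψ, hψ⟩ := (SmoothBumpFunction.nhds_basis_tsupport (I := 𝓘(ℝ, E)) z).mem_iff.1
    ((chartAt E x₀).open_source.mem_nhds hz)
  have hY : ContMDiff 𝓘(ℝ, E) 𝓘(ℝ, E).tangent ∞
      (fun q ↦ (⟨q, (ψ : M → ℝ) q • X q⟩ : TangentBundle 𝓘(ℝ, E) M)) :=
    ContMDiffOn.smul_section_of_tsupport ψ.contMDiff.contMDiffOn (chartAt E x₀).open_source hψ.2
      fun q hq ↦ (contMDiffAt_ofCoord hq _).contMDiffWithinAt
  have hcov := (CovariantDerivative.ContMDiffCovariantDerivative.contMDiff (cov := cov)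
    (k := ∞)).contMDiff (σ := fun q ↦ (ψ : M → ℝ) q • X q) (by simpa using! hY.contMDiffOn)
  have hcov1 := hcov.contMDiffAt (x := z) univ_mem
  rw [Trivialization.contMDiffAt_iff (e := Trivialization.continuousLinearMap (RingHom.id ℝ)
    (trivializationAt E (TangentSpace 𝓘(ℝ, E) : M → Type _) x₀)
    (trivializationAt E (TangentSpace 𝓘(ℝ, E) : M → Type _) x₀))
    (he := by simpa [Trivialization.mem_source] using hz)] at hcov1
  have h1 := hcov1.2.comp_of_eq (contMDiffAt_chart_symm he) hzdef.symm
  rw [contMDiffAt_iff_contDiffAt] at h1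
  refine h1.congr_of_eventuallyEq ?_
  have hc : ContinuousAt (chartAt E x₀).symm e := (chartAt E x₀).continuousAt_symm he
  filter_upwards [hc.eventually (eventually_eventually_nhds.2 ψ.eventuallyEq_one),
    hc.eventually ((chartAt E x₀).open_source.mem_nhds hz)] with e' he' hs
  have hX := mdifferentiableAt_ofCoord hs (Module.finBasis ℝ E i)
  have : cov X ((chartAt E x₀).symm e') =
      cov (fun q ↦ (ψ : M → ℝ) q • X q) ((chartAt E x₀).symm e') := by
    refine cov.isCovariantDerivativeOnUniv.congr_of_eventuallyEq hX
      ((hY _).mdifferentiableAt (by simp)) univ_mem ?_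
    filter_upwards [he'] with q hq
    simp [hq]
  rw [this]
  rfl

end Christoffel

/-! ### The covariant derivative along a map in an arbitrary chart -/

section CovAlong

variable {F : Type*} [NormedAddCommGroup F] [NormedSpace ℝ F] [FiniteDimensional ℝ F]
  {N : Type*} [TopologicalSpace N] [ChartedSpace F N] [IsManifold 𝓘(ℝ, F) ∞ N]
  {A : Type*} [NormedAddCommGroup A] [NormedSpace ℝ A]
  {P : Type*} [TopologicalSpace P] [ChartedSpace A P]

/-- The covariant derivative along a map, in any chart. -/
lemma toCoord_covAlong (cov : TangentConnection F N) {f : P → N}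
    {s : (q : P) → TangentSpace 𝓘(ℝ, F) (f q)} {S : Set P} {p : P} {y₀ : N}
    (hp : f p ∈ (chartAt F y₀).source) (hS : UniqueMDiffWithinAt 𝓘(ℝ, A) S p) {u' s' : A →L[ℝ] F}
    (hc : ContinuousWithinAt f S p)
    (hf : HasMFDerivWithinAt 𝓘(ℝ, A) 𝓘(ℝ, F) (chartAt F y₀ ∘ f) S p u')
    (hs : HasMFDerivWithinAt 𝓘(ℝ, A) 𝓘(ℝ, F) (fun q ↦ toCoord y₀ (f q) (s q)) S p s')
    (v : A) :
    toCoord y₀ (f p) (covAlong cov f s S p v) =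
      s' v + christoffel cov y₀ (chartAt F y₀ (f p)) (u' v) (toCoord y₀ (f p) (s p)) := by
  set y := f p with hy
  have hyy := mem_chart_source F y
  -- `covAlong` is defined through the chart centred at y = f p, while the claim concerns the chart
  -- at `y₀`. `D` and `C` are the matrices of the change of components from `y₀` to y and back.
  set D : F → F →L[ℝ] F := fun e ↦ transition y₀ y ((chartAt F y₀).symm e) with hD
  set C : F → F →L[ℝ] F := fun e ↦ transition y y₀ ((chartAt F y₀).symm e) with hC
  set e₀ := chartAt F y₀ y with he₀
  have hDd : HasFDerivAt D (fderiv ℝ D e₀) e₀ :=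
    ((contDiffAt_transition hp hyy hp).differentiableAt (by simp)).hasFDerivAt
  have hCd : HasFDerivAt C (fderiv ℝ C e₀) e₀ :=
    ((contDiffAt_transition hyy hp hp).differentiableAt (by simp)).hasFDerivAt
  have hnear : ∀ᶠ e in 𝓝 e₀, e ∈ (chartAt F y₀).target ∧
      (chartAt F y₀).symm e ∈ (chartAt F y).source := by
    have h1 := (chartAt F y₀).open_target.mem_nhds ((chartAt F y₀).map_source hp)
    have h2 := (chartAt F y₀).continuousAt_symm ((chartAt F y₀).map_source hp)
    have h3 : (chartAt F y).source ∈ 𝓝 ((chartAt F y₀).symm (chartAt F y₀ y)) := by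
      rw [(chartAt F y₀).left_inv hp]; exact (chartAt F y).open_source.mem_nhds hyy
    filter_upwards [h1, h2.eventually h3] with e h h' using ⟨h, h'⟩
  have hCD : ∀ᶠ e in 𝓝 e₀, C e ∘L D e = ContinuousLinearMap.id ℝ F := by
    filter_upwards [hnear] with e he
    ext w
    exact transition_transition ((chartAt F y₀).map_target he.1) he.2 w
  -- Derivative of the identity C D = 1. It makes the inhomogeneous terms cancel: dD comes from the
  -- components of `s`, dC from the extension that is constant in the other chart.
  have hCD' : ∀ w d, fderiv ℝ C e₀ d (D e₀ w) + C e₀ (fderiv ℝ D e₀ d w) = 0 := by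
    intro w d
    have h1 : HasFDerivAt (fun e ↦ C e (D e w)) _ e₀ :=
      hCd.clm_apply (hDd.clm_apply (hasFDerivAt_const w e₀))
    have h2 : HasFDerivAt (fun e ↦ C e (D e w)) (0 : F →L[ℝ] F) e₀ := by
      refine (hasFDerivAt_const w e₀).congr_of_eventuallyEq ?_
      filter_upwards [hCD] with e he
      exact congrArg (fun L ↦ L w) he
    have h3 := congrArg (fun L ↦ L d) (h1.unique h2)
    simp at h3
    rw [add_comm]
    exact h3
  -- components of `s` in the preferred chart
  have hsy : HasMFDerivWithinAt 𝓘(ℝ, A) 𝓘(ℝ, F)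
      (fun q ↦ (trivializationAt F (TangentSpace 𝓘(ℝ, F) : N → Type _) y ⟨f q, s q⟩).2) S p
      (D e₀ ∘L s' + (fderiv ℝ D e₀).flip (toCoord y₀ y (s p)) ∘L u') := by
    have hB : HasFDerivAt (fun z : F × F ↦ D z.1 z.2)
        (((fderiv ℝ D e₀).flip (toCoord y₀ y (s p))).comp (ContinuousLinearMap.fst ℝ F F) +
          (D e₀).comp (ContinuousLinearMap.snd ℝ F F)) (e₀, toCoord y₀ y (s p)) := by
      have hD1 : HasFDerivAt (fun z : F × F ↦ D z.1)
          (fderiv ℝ D e₀ ∘L ContinuousLinearMap.fst ℝ F F) (e₀, toCoord y₀ y (s p)) :=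
        HasFDerivAt.comp (g := D) (e₀, toCoord y₀ y (s p)) hDd hasFDerivAt_fst
      have := hD1.clm_apply (hasFDerivAt_snd (𝕜 := ℝ) (p := (e₀, toCoord y₀ y (s p))))
      exact this.congr_fderiv (ContinuousLinearMap.ext fun a ↦ by simp [add_comm])
    have hpair : HasMFDerivWithinAt 𝓘(ℝ, A) 𝓘(ℝ, F × F)
        (fun q ↦ (chartAt F y₀ (f q), toCoord y₀ (f q) (s q))) S p (u'.prod s') :=
      ⟨hf.1.prodMk hs.1, hf.2.prodMk hs.2⟩
    have hcomp := hB.hasMFDerivAt.comp_hasMFDerivWithinAt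
      (f := fun q ↦ (chartAt F y₀ (f q), toCoord y₀ (f q) (s q))) p hpair
    have hcomp' : HasMFDerivWithinAt 𝓘(ℝ, A) 𝓘(ℝ, F)
        (fun q ↦ D (chartAt F y₀ (f q)) (toCoord y₀ (f q) (s q))) S p
        (D e₀ ∘L s' + (fderiv ℝ D e₀).flip (toCoord y₀ y (s p)) ∘L u') := by
      have hEq : D e₀ ∘L s' + (fderiv ℝ D e₀).flip (toCoord y₀ y (s p)) ∘L u' =
          (((fderiv ℝ D e₀).flip (toCoord y₀ y (s p))).comp (ContinuousLinearMap.fst ℝ F F) +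
          (D e₀).comp (ContinuousLinearMap.snd ℝ F F)) ∘L (u'.prod s') := by
        ext a
        exact add_comm _ _
      rw [hEq]
      exact hcomp
    have hev : ∀ᶠ q in 𝓝[S] p, f q ∈ (chartAt F y₀).source ∩ (chartAt F y).source :=
      hc (((chartAt F y₀).open_source.inter (chartAt F y).open_source).mem_nhds ⟨hp, hyy⟩)
    have hpt : ∀ q, f q ∈ (chartAt F y₀).source ∩ (chartAt F y).source →
        (trivializationAt F (TangentSpace 𝓘(ℝ, F) : N → Type _) y ⟨f q, s q⟩).2 =
          D (chartAt F y₀ (f q)) (toCoord y₀ (f q) (s q)) := by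
      intro q hq
      simp only [hD]
      rw [(chartAt F y₀).left_inv hq.1, transition_toCoord hq.1, toCoord_apply hq.2]
    exact hcomp'.congr_of_eventuallyEq (hev.mono hpt) (hpt p ⟨hp, hyy⟩)
  have hL : (chartAt F y₀).symm e₀ = y := (chartAt F y₀).left_inv hp
  have hCe : ∀ w, C e₀ w = toCoord y₀ y (ofCoord y y w) := by
    intro w; simp only [hC]; rw [hL]; rfl
  have hDs : D e₀ (toCoord y₀ y (s p)) = toCoord y y (s p) := by
    simp only [hD]; rw [hL, transition_toCoord hp]
  have hCDe : ∀ w, C e₀ (D e₀ w) = w := fun w ↦ congrArg (fun L ↦ L w) hCD.self_of_nhds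
  -- the constant extension
  have hX : HasFDerivAt (coordField y₀ (FiberBundle.extend F (s p)))
      ((fderiv ℝ C e₀).flip (toCoord y y (s p))) e₀ := by
    have h1 : HasFDerivAt (fun e ↦ C e (toCoord y y (s p)))
        ((fderiv ℝ C e₀).flip (toCoord y y (s p))) e₀ := by
      simpa using! hCd.clm_apply (hasFDerivAt_const (toCoord y y (s p)) e₀)
    refine h1.congr_of_eventuallyEq ?_
    filter_upwards [hnear] with e he
    simp only [coordField, hC, transition]
    rw [extend_eq he.2]
    rfl
  have hXd := (mdifferentiableAt_field_iff hp (FiberBundle.extend F (s p))).2 hX.differentiableAt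
  have hf' := hasMFDerivWithinAt_of_chart hc hp hf
  have e1 := hf'.mfderivWithin hS
  have e2 := hsy.mfderivWithin hS
  have e3 : covAlong cov f s S p v = ofCoord y y
      (D e₀ (s' v) + fderiv ℝ D e₀ (u' v) (toCoord y₀ y (s p))) +
      cov (FiberBundle.extend F (s p)) y (ofCoord y₀ y (u' v)) := by
    have a1 : mfderivWithin 𝓘(ℝ, A) 𝓘(ℝ, F) f S p v = ofCoord y₀ y (u' v) := by
      rw [e1]; rfl
    have a2 : mvfderivWithin 𝓘(ℝ, A) (fun q ↦ (trivializationAt F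
        (TangentSpace 𝓘(ℝ, F) : N → Type _) (f p) ⟨f q, s q⟩).2) S p v =
        (D e₀ (s' v) + fderiv ℝ D e₀ (u' v) (toCoord y₀ y (s p))) := by
      unfold mvfderivWithin
      rw [e2]; rfl
    have a3 : covAlong cov f s S p v = ofCoord y y (mvfderivWithin 𝓘(ℝ, A) (fun q ↦
        (trivializationAt F (TangentSpace 𝓘(ℝ, F) : N → Type _) (f p) ⟨f q, s q⟩).2) S p v) +
        cov (FiberBundle.extend F (s p)) y (mfderivWithin 𝓘(ℝ, A) 𝓘(ℝ, F) f S p v) := rfl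
    rw [a3, a1, a2]
  rw [e3, map_add, ← hCe, toCoord_cov cov hp hXd, toCoord_ofCoord hp, FiberBundle.extend_apply_self,
    map_add, hCDe, hX.fderiv]
  have := hCD' (toCoord y₀ y (s p)) (u' v)
  rw [hDs] at this
  simp only [ContinuousLinearMap.flip_apply]
  have h5 := eq_neg_of_add_eq_zero_left this
  rw [h5]
  abel

end CovAlong

/-! ### The Lie bracket in charts -/

section LieBracket

variable {E : Type*} [NormedAddCommGroup E] [NormedSpace ℝ E]
  {M : Type*} [TopologicalSpace M] [ChartedSpace E M] [IsManifold 𝓘(ℝ, E) ∞ M]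

/-- The bracket is natural under pullback, and the pullback of a field by the inverse chart is its
coordinate representation. -/
lemma toCoord_mlieBracket [CompleteSpace E] {x₀ z : M} (hz : z ∈ (chartAt E x₀).source)
    {X Y : (z : M) → TangentSpace 𝓘(ℝ, E) z}
    (hX : MDifferentiableAt 𝓘(ℝ, E) 𝓘(ℝ, E).tangent
        (fun z ↦ (⟨z, X z⟩ : TangentBundle 𝓘(ℝ, E) M)) z)
    (hY : MDifferentiableAt 𝓘(ℝ, E) 𝓘(ℝ, E).tangent
        (fun z ↦ (⟨z, Y z⟩ : TangentBundle 𝓘(ℝ, E) M)) z) :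
    toCoord x₀ z (VectorField.mlieBracket 𝓘(ℝ, E) X Y z) =
      fderiv ℝ (coordField x₀ Y) (chartAt E x₀ z) (toCoord x₀ z (X z)) -
        fderiv ℝ (coordField x₀ X) (chartAt E x₀ z) (toCoord x₀ z (Y z)) := by
  have hmem := (chartAt E x₀).map_source hz
  have hL := (chartAt E x₀).left_inv hz
  have hpull : ∀ W : (z : M) → TangentSpace 𝓘(ℝ, E) z, ∀ e ∈ (chartAt E x₀).target,
      VectorField.mpullback 𝓘(ℝ, E) 𝓘(ℝ, E) (chartAt E x₀).symm W e = coordField x₀ W e := by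
    intro W e he
    have hs := (chartAt E x₀).map_target he
    rw [VectorField.mpullback_apply, (hasMFDerivAt_chart_symm he).mfderiv]
    have : (ofCoord (E := E) x₀ ((chartAt E x₀).symm e)).inverse =
        toCoord x₀ ((chartAt E x₀).symm e) :=
      ContinuousLinearMap.inverse_eq (by ext v; exact ofCoord_toCoord hs v)
        (by ext v; exact toCoord_ofCoord hs v)
    exact congrArg (fun L ↦ L (W ((chartAt E x₀).symm e))) this
  have : IsManifold 𝓘(ℝ, E) (minSmoothness ℝ 2) M := by
    rw [minSmoothness_of_isRCLikeNormedField]; infer_instance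
  have : IsManifold 𝓘(ℝ, E) (minSmoothness ℝ 3) M := by
    rw [minSmoothness_of_isRCLikeNormedField]; infer_instance
  have h1 := VectorField.mpullback_mlieBracket (I := 𝓘(ℝ, E)) (I' := 𝓘(ℝ, E)) (n := 2)
    (f := (chartAt E x₀).symm) (x₀ := chartAt E x₀ z) (V := X) (W := Y)
    (by rw [hL]; exact hX) (by rw [hL]; exact hY)
    ((contMDiffAt_chart_symm hmem).of_le (by norm_cast)) (by simp)
  have h2 := hpull (VectorField.mlieBracket 𝓘(ℝ, E) X Y) _ hmem
  rw [coordField_chart hz] at h2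
  have hev : ∀ W : (z : M) → TangentSpace 𝓘(ℝ, E) z,
      VectorField.mpullback 𝓘(ℝ, E) 𝓘(ℝ, E) (chartAt E x₀).symm W =ᶠ[𝓝 (chartAt E x₀ z)]
        coordField x₀ W := fun W ↦
    Filter.eventually_of_mem ((chartAt E x₀).open_target.mem_nhds hmem) (hpull W)
  have h3 := (hev X).mlieBracket_vectorField_eq (I := 𝓘(ℝ, E)) (hev Y)
  have h4 : ∀ (A B : (e : E) → TangentSpace 𝓘(ℝ, E) e) (e : E),
      VectorField.mlieBracket 𝓘(ℝ, E) A B e = VectorField.lieBracket ℝ A B e := by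
    intro A B e
    rw [← VectorField.mlieBracketWithin_univ, VectorField.mlieBracketWithin_eq_lieBracketWithin]
    exact congrFun (VectorField.lieBracketWithin_univ (𝕜 := ℝ) (E := E) (V := A) (W := B)) e
  rw [← h2]
  refine (h1.trans (h3.trans (h4 _ _ _))).trans ?_
  rw [VectorField.lieBracket, coordField_chart hz, coordField_chart hz]

end LieBracket

/-! ### Torsion and curvature in charts -/

section Tensors

variable {E : Type*} [NormedAddCommGroup E] [NormedSpace ℝ E]
  {M : Type*} [TopologicalSpace M] [ChartedSpace E M] [IsManifold 𝓘(ℝ, E) ∞ M]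

lemma contDiffAt_coordField_extend {x₀ z : M} (hz : z ∈ (chartAt E x₀).source)
    (u : TangentSpace 𝓘(ℝ, E) z) :
    ContDiffAt ℝ ∞ (coordField x₀ (FiberBundle.extend E u)) (chartAt E x₀ z) := by
  have h := (contDiffAt_transition (mem_chart_source E z) hz hz).clm_apply
    (contDiffAt_const (c := toCoord z z u))
  refine h.congr_of_eventuallyEq ?_
  have h2 := (chartAt E x₀).continuousAt_symm ((chartAt E x₀).map_source hz)
  have h3 : (chartAt E z).source ∈ 𝓝 ((chartAt E x₀).symm (chartAt E x₀ z)) := by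
    rw [(chartAt E x₀).left_inv hz]
    exact (chartAt E z).open_source.mem_nhds (mem_chart_source E z)
  filter_upwards [h2.eventually h3] with e he
  simp only [coordField, transition]
  rw [extend_eq he]
  rfl

variable [FiniteDimensional ℝ E]

/-- On extensions of the two vectors, the derivatives of the components cancel against the Lie
bracket and only the antisymmetrized Christoffel symbols survive. -/
lemma toCoord_torsion (cov : TangentConnection E M) {x₀ z : M}
    (hz : z ∈ (chartAt E x₀).source) (u v : TangentSpace 𝓘(ℝ, E) z) :
    toCoord x₀ z (torsion cov z u v) =
      coordTorsion (christoffel cov x₀) (chartAt E x₀ z) (toCoord x₀ z u) (toCoord x₀ z v) := by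
  have : CompleteSpace E := FiniteDimensional.complete ℝ E
  have : IsManifold 𝓘(ℝ, E) 2 M := inferInstance
  have hu := (mdifferentiableAt_field_iff hz _).2
    ((contDiffAt_coordField_extend hz u).differentiableAt (by simp))
  have hv := (mdifferentiableAt_field_iff hz _).2
    ((contDiffAt_coordField_extend hz v).differentiableAt (by simp))
  have h1 : torsion cov z u v =
      cov (FiberBundle.extend E v) z u - cov (FiberBundle.extend E u) z v -
      VectorField.mlieBracket 𝓘(ℝ, E) (FiberBundle.extend E u) (FiberBundle.extend E v) z := by
    have := CovariantDerivative.torsion_apply_eq_extend cov u v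
    simp only [FiberBundle.extend_apply_self] at this
    exact this
  rw [h1, map_sub, map_sub, toCoord_cov cov hz hu, toCoord_cov cov hz hv,
    toCoord_mlieBracket hz hu hv]
  simp only [FiberBundle.extend_apply_self, coordTorsion]
  abel

lemma toCoord_curvature [T2Space M] (cov : TangentConnection E M)
    [CovariantDerivative.ContMDiffCovariantDerivative cov ∞] {x₀ z : M}
    (hz : z ∈ (chartAt E x₀).source) (u v w : TangentSpace 𝓘(ℝ, E) z) :
    toCoord x₀ z (curvature cov z u v w) =
      coordCurvature (christoffel cov x₀) (chartAt E x₀ z) (toCoord x₀ z u) (toCoord x₀ z v)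
        (toCoord x₀ z w) := by
  have : CompleteSpace E := FiniteDimensional.complete ℝ E
  have hmem := (chartAt E x₀).map_source hz
  set e₀ := chartAt E x₀ z
  have hd : ∀ a : TangentSpace 𝓘(ℝ, E) z, MDifferentiableAt 𝓘(ℝ, E) 𝓘(ℝ, E).tangent
      (fun q ↦ (⟨q, FiberBundle.extend E a q⟩ : TangentBundle 𝓘(ℝ, E) M)) z := fun a ↦
    (mdifferentiableAt_field_iff hz _).2
      ((contDiffAt_coordField_extend hz a).differentiableAt (by simp))
  set X := coordField x₀ (FiberBundle.extend E u) with hXdef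
  set Y := coordField x₀ (FiberBundle.extend E v) with hYdef
  set Z := coordField x₀ (FiberBundle.extend E w) with hZdef
  have hX : ContDiffAt ℝ ∞ X e₀ := contDiffAt_coordField_extend hz u
  have hY : ContDiffAt ℝ ∞ Y e₀ := contDiffAt_coordField_extend hz v
  have hZ : ContDiffAt ℝ ∞ Z e₀ := contDiffAt_coordField_extend hz w
  have hΓ : ContDiffAt ℝ ∞ (christoffel cov x₀) e₀ :=
    (contDiffOn_christoffel cov x₀).contDiffAt ((chartAt E x₀).open_target.mem_nhds hmem)
  set Γ := christoffel cov x₀ with hΓdef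
  have hXe : X e₀ = toCoord x₀ z u := by
    rw [hXdef, coordField_chart hz, FiberBundle.extend_apply_self]
  have hYe : Y e₀ = toCoord x₀ z v := by
    rw [hYdef, coordField_chart hz, FiberBundle.extend_apply_self]
  have hZe : Z e₀ = toCoord x₀ z w := by
    rw [hZdef, coordField_chart hz, FiberBundle.extend_apply_self]
  have hZev : ∀ᶠ e in 𝓝 e₀, DifferentiableAt ℝ Z e := by
    have := (hZ.of_le (m := 1) (by norm_cast)).eventually (by simp)
    exact this.mono fun e he ↦ he.differentiableAt (by simp)
  have key : ∀ a : TangentSpace 𝓘(ℝ, E) z,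
      coordField x₀ (fun q ↦ cov (FiberBundle.extend E w) q (FiberBundle.extend E a q)) =ᶠ[𝓝 e₀]
        fun e ↦ fderiv ℝ Z e (coordField x₀ (FiberBundle.extend E a) e) +
          Γ e (coordField x₀ (FiberBundle.extend E a) e) (Z e) := by
    intro a
    filter_upwards [hZev, (chartAt E x₀).open_target.mem_nhds hmem] with e he hs
    have hs' := (chartAt E x₀).map_target hs
    have hr := (chartAt E x₀).right_inv hs
    have hd' := (mdifferentiableAt_field_iff hs' (FiberBundle.extend E w)).2 (by rw [hr]; exact he)
    have := toCoord_cov cov hs' hd' (FiberBundle.extend E a ((chartAt E x₀).symm e))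
    rw [hr] at this
    exact this
  have hder : ∀ a : TangentSpace 𝓘(ℝ, E) z, ∀ A : E → E, ContDiffAt ℝ ∞ A e₀ → 
      A = coordField x₀ (FiberBundle.extend E a) → ∀ d : E,
      DifferentiableAt ℝ (coordField x₀ (fun q ↦ cov (FiberBundle.extend E w) q
        (FiberBundle.extend E a q))) e₀ ∧
      fderiv ℝ (coordField x₀ (fun q ↦ cov (FiberBundle.extend E w) q
        (FiberBundle.extend E a q))) e₀ d =
      fderiv ℝ (fderiv ℝ Z) e₀ d (A e₀) + fderiv ℝ Z e₀ (fderiv ℝ A e₀ d) +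
      (fderiv ℝ Γ e₀ d (A e₀) (Z e₀) + Γ e₀ (fderiv ℝ A e₀ d) (Z e₀) +
        Γ e₀ (A e₀) (fderiv ℝ Z e₀ d)) := by
    intro a A hA hAdef d
    have hA' := (hA.differentiableAt (by simp)).hasFDerivAt
    have hZ' := (hZ.differentiableAt (by simp)).hasFDerivAt
    have hΓ' := (hΓ.differentiableAt (by simp)).hasFDerivAt
    have hZ'' : HasFDerivAt (fderiv ℝ Z) (fderiv ℝ (fderiv ℝ Z) e₀) e₀ :=
      ((hZ.fderiv_right (m := ∞) (by simp)).differentiableAt (by simp)).hasFDerivAt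
    have h := (hZ''.clm_apply hA').add ((hΓ'.clm_apply hA').clm_apply hZ')
    have hk := key a
    rw [← hAdef] at hk
    have h' := h.congr_of_eventuallyEq hk
    refine ⟨h'.differentiableAt, ?_⟩
    rw [h'.fderiv]
    simp
    abel
  have hU := hder u X hX hXdef (Y e₀)
  have hV := hder v Y hY hYdef (X e₀)
  -- Symmetry of the second derivative of Z removes the second order terms from the commutator of
  -- the covariant derivatives.
  have hsymm : fderiv ℝ (fderiv ℝ Z) e₀ (X e₀) (Y e₀) =
      fderiv ℝ (fderiv ℝ Z) e₀ (Y e₀) (X e₀) :=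
    ((hZ.of_le (m := 2) (by norm_cast)).isSymmSndFDerivAt (by simp)) (X e₀) (Y e₀)
  simp only [curvature, curvatureField]
  rw [map_sub, map_sub, toCoord_cov cov hz ((mdifferentiableAt_field_iff hz _).2 hV.1),
    toCoord_cov cov hz ((mdifferentiableAt_field_iff hz _).2 hU.1), toCoord_cov cov hz (hd w),
    toCoord_cov cov hz (hd w), toCoord_cov cov hz (hd w), toCoord_mlieBracket hz (hd u) (hd v)]
  simp only [FiberBundle.extend_apply_self]
  rw [← hXe, ← hYe, ← hZe, hU.2, hV.2, hsymm]
  simp only [coordCurvature, map_add, map_sub, sub_apply]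
  abel

end Tensors

/-! ### Regularity and uniqueness for differential equations on intervals -/

section ODE

variable {Z : Type*} [NormedAddCommGroup Z] [NormedSpace ℝ Z]

/-- Solutions of a smooth autonomous differential equation are smooth. -/
lemma contDiffOn_of_hasDerivWithinAt {v : Z → Z} {O : Set Z} {f : ℝ → Z} {S : Set ℝ}
    (hS : UniqueDiffOn ℝ S) (hv : ContDiffOn ℝ ∞ v O) (hf : MapsTo f S O)
    (h : ∀ t ∈ S, HasDerivWithinAt f (v (f t)) S t) : ContDiffOn ℝ ∞ f S := by
  rw [contDiffOn_infty]
  intro n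
  induction n with
  | zero =>
    exact contDiffOn_zero.2 fun t ht ↦ (h t ht).continuousWithinAt
  | succ n ih =>
    push_cast
    rw [contDiffOn_succ_iff_derivWithin hS]
    refine ⟨fun t ht ↦ (h t ht).differentiableWithinAt, by simp, ?_⟩
    refine ContDiffOn.congr ((hv.of_le (by exact_mod_cast le_top)).comp ih hf) ?_
    intro t ht
    exact (h t ht).derivWithin (hS t ht)

/-- Local uniqueness of solutions of autonomous differential equations on intervals. -/
lemma eventuallyEq_of_hasDerivWithinAt {v : Z → Z} {f g : ℝ → Z} {a b t₀ : ℝ}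
    (ht₀ : t₀ ∈ Icc a b) (hv : ContDiffAt ℝ 1 v (f t₀))
    (hf : ∀ᶠ t in 𝓝[Icc a b] t₀, HasDerivWithinAt f (v (f t)) (Icc a b) t)
    (hg : ∀ᶠ t in 𝓝[Icc a b] t₀, HasDerivWithinAt g (v (g t)) (Icc a b) t)
    (hfg : f t₀ = g t₀) : f =ᶠ[𝓝[Icc a b] t₀] g := by
  obtain ⟨K, s, hs, hK⟩ := hv.exists_lipschitzOnWith
  have hfc := (hf.self_of_nhdsWithin ht₀).continuousWithinAt
  have hgc := (hg.self_of_nhdsWithin ht₀).continuousWithinAt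
  have h1 := hf.and (hg.and ((hfc.eventually_mem hs).and (hgc.eventually_mem (hfg ▸ hs))))
  obtain ⟨δ, hδ, h2⟩ := Metric.mem_nhdsWithin_iff.1 h1
  have key : ∀ t ∈ Icc a b, |t - t₀| < δ → HasDerivWithinAt f (v (f t)) (Icc a b) t ∧
      HasDerivWithinAt g (v (g t)) (Icc a b) t ∧ f t ∈ s ∧ g t ∈ s := fun t ht hd ↦
    h2 ⟨by simpa [Real.dist_eq] using hd, ht⟩
  rw [Filter.EventuallyEq, eventually_nhdsWithin_iff]
  filter_upwards [Metric.ball_mem_nhds t₀ hδ] with t hd ht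
  rw [Metric.mem_ball, Real.dist_eq] at hd
  -- The point t₀ may be an endpoint of the interval, so uniqueness is applied separately to the
  -- right and to the left.
  rcases le_total t₀ t with h0 | h0
  · have hsub : ∀ r ∈ Icc t₀ t, r ∈ Icc a b ∧ |r - t₀| < δ := fun r hr ↦
      ⟨⟨ht₀.1.trans hr.1, hr.2.trans ht.2⟩, by
        rw [abs_of_nonneg (by linarith [hr.1])]
        rw [abs_of_nonneg (by linarith)] at hd
        linarith [hr.2]⟩
    have hnb : ∀ r ∈ Ico t₀ t, Icc a b ∈ 𝓝[Ici r] r := fun r hr ↦ by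
      have : r < b := hr.2.trans_le ht.2
      exact mem_of_superset (Icc_mem_nhdsGE this) (Icc_subset_Icc_left (ht₀.1.trans hr.1))
    refine ODE_solution_unique_of_mem_Icc_right (v := fun _ ↦ v) (s := fun _ ↦ s) (K := K)
      (fun _ _ ↦ hK)
      (fun r hr ↦ ((key r (hsub r hr).1 (hsub r hr).2).1.continuousWithinAt.mono
        fun q hq ↦ (hsub q hq).1))
      (fun r hr ↦ (key r (hsub r ⟨hr.1, hr.2.le⟩).1 (hsub r ⟨hr.1, hr.2.le⟩).2).1
        |>.mono_of_mem_nhdsWithin (hnb r hr))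
      (fun r hr ↦ (key r (hsub r ⟨hr.1, hr.2.le⟩).1 (hsub r ⟨hr.1, hr.2.le⟩).2).2.2.1)
      (fun r hr ↦ ((key r (hsub r hr).1 (hsub r hr).2).2.1.continuousWithinAt.mono
        fun q hq ↦ (hsub q hq).1))
      (fun r hr ↦ (key r (hsub r ⟨hr.1, hr.2.le⟩).1 (hsub r ⟨hr.1, hr.2.le⟩).2).2.1
        |>.mono_of_mem_nhdsWithin (hnb r hr))
      (fun r hr ↦ (key r (hsub r ⟨hr.1, hr.2.le⟩).1 (hsub r ⟨hr.1, hr.2.le⟩).2).2.2.2)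
      hfg ⟨h0, le_rfl⟩
  · have hsub : ∀ r ∈ Icc t t₀, r ∈ Icc a b ∧ |r - t₀| < δ := fun r hr ↦
      ⟨⟨ht.1.trans hr.1, hr.2.trans ht₀.2⟩, by
        rw [abs_of_nonpos (by linarith [hr.2])]
        rw [abs_of_nonpos (by linarith)] at hd
        linarith [hr.1]⟩
    have hnb : ∀ r ∈ Ioc t t₀, Icc a b ∈ 𝓝[Iic r] r := fun r hr ↦ by
      have : a < r := ht.1.trans_lt hr.1
      exact mem_of_superset (Icc_mem_nhdsLE this) (Icc_subset_Icc_right (hr.2.trans ht₀.2))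
    refine ODE_solution_unique_of_mem_Icc_left (v := fun _ ↦ v) (s := fun _ ↦ s) (K := K)
      (fun _ _ ↦ hK)
      (fun r hr ↦ ((key r (hsub r hr).1 (hsub r hr).2).1.continuousWithinAt.mono
        fun q hq ↦ (hsub q hq).1))
      (fun r hr ↦ (key r (hsub r ⟨hr.1.le, hr.2⟩).1 (hsub r ⟨hr.1.le, hr.2⟩).2).1
        |>.mono_of_mem_nhdsWithin (hnb r hr))
      (fun r hr ↦ (key r (hsub r ⟨hr.1.le, hr.2⟩).1 (hsub r ⟨hr.1.le, hr.2⟩).2).2.2.1)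
      (fun r hr ↦ ((key r (hsub r hr).1 (hsub r hr).2).2.1.continuousWithinAt.mono
        fun q hq ↦ (hsub q hq).1))
      (fun r hr ↦ (key r (hsub r ⟨hr.1.le, hr.2⟩).1 (hsub r ⟨hr.1.le, hr.2⟩).2).2.1
        |>.mono_of_mem_nhdsWithin (hnb r hr))
      (fun r hr ↦ (key r (hsub r ⟨hr.1.le, hr.2⟩).1 (hsub r ⟨hr.1.le, hr.2⟩).2).2.2.2)
      hfg ⟨le_rfl, h0⟩

end ODE

/-! ### Curves and fields along curves in charts -/

section Curves

variable {E : Type*} [NormedAddCommGroup E] [NormedSpace ℝ E]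
  {M : Type*} [TopologicalSpace M] [ChartedSpace E M] [IsManifold 𝓘(ℝ, E) ∞ M]

/-- Components of the velocity in a chart. -/
lemma hasDerivWithinAt_chart_comp {γ : ℝ → M} {S : Set ℝ} {t : ℝ} {x₀ : M}
    (ht : γ t ∈ (chartAt E x₀).source)
    (h : MDifferentiableWithinAt 𝓘(ℝ, ℝ) 𝓘(ℝ, E) γ S t) :
    HasDerivWithinAt (chartAt E x₀ ∘ γ) (toCoord x₀ (γ t) (velocity γ S t)) S t := by
  have h1 := toCoord_hasMFDerivWithinAt ht h.hasMFDerivWithinAt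
  have h2 : HasFDerivWithinAt (chartAt E x₀ ∘ γ) (show ℝ →L[ℝ] E from
      toCoord (E := E) x₀ (γ t) ∘L mfderivWithin 𝓘(ℝ, ℝ) 𝓘(ℝ, E) γ S t) S t :=
    hasMFDerivWithinAt_iff_hasFDerivWithinAt.1 h1
  exact h2.hasDerivWithinAt

lemma hasMFDerivWithinAt_of_hasDerivWithinAt {V : Type*} [NormedAddCommGroup V] [NormedSpace ℝ V]
    {u : ℝ → V} {S : Set ℝ} {t : ℝ} {w : V} (h : HasDerivWithinAt u w S t) :
    HasMFDerivWithinAt 𝓘(ℝ, ℝ) 𝓘(ℝ, V) u S t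
      (show ℝ →L[ℝ] V from ContinuousLinearMap.toSpanSingleton ℝ w) :=
  hasMFDerivWithinAt_iff_hasFDerivWithinAt.2 h.hasFDerivWithinAt

lemma mdifferentiableWithinAt_of_chart {γ : ℝ → M} {S : Set ℝ} {t : ℝ} {x₀ : M}
    (hc : ContinuousWithinAt γ S t) (ht : γ t ∈ (chartAt E x₀).source) {w : E}
    (h : HasDerivWithinAt (chartAt E x₀ ∘ γ) w S t) :
    MDifferentiableWithinAt 𝓘(ℝ, ℝ) 𝓘(ℝ, E) γ S t :=
  (hasMFDerivWithinAt_of_chart hc ht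
    (hasMFDerivWithinAt_of_hasDerivWithinAt h)).mdifferentiableWithinAt

lemma toCoord_velocity {γ : ℝ → M} {S : Set ℝ} {t : ℝ} {x₀ : M} (hS : UniqueDiffWithinAt ℝ S t)
    (hc : ContinuousWithinAt γ S t) (ht : γ t ∈ (chartAt E x₀).source) {w : E}
    (h : HasDerivWithinAt (chartAt E x₀ ∘ γ) w S t) :
    toCoord x₀ (γ t) (velocity γ S t) = w :=
  hS.eq_deriv _ (hasDerivWithinAt_chart_comp ht (mdifferentiableWithinAt_of_chart hc ht h)) h

lemma toCoord_covDt [FiniteDimensional ℝ E] (cov : TangentConnection E M) {γ : ℝ → M}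
    {V : (t : ℝ) → TangentSpace 𝓘(ℝ, E) (γ t)} {S : Set ℝ} {t : ℝ} {x₀ : M}
    (hS : UniqueDiffWithinAt ℝ S t)
    (hc : ContinuousWithinAt γ S t) (ht : γ t ∈ (chartAt E x₀).source) {w V' : E}
    (h : HasDerivWithinAt (chartAt E x₀ ∘ γ) w S t)
    (hV : HasDerivWithinAt (fun s ↦ toCoord x₀ (γ s) (V s)) V' S t) :
    toCoord x₀ (γ t) (covDt cov γ V S t) =
      V' + christoffel cov x₀ (chartAt E x₀ (γ t)) w (toCoord x₀ (γ t) (V t)) := by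
  have := toCoord_covAlong cov ht (uniqueMDiffWithinAt_iff_uniqueDiffWithinAt.2 hS) hc
    (hasMFDerivWithinAt_of_hasDerivWithinAt h) (hasMFDerivWithinAt_of_hasDerivWithinAt hV) 1
  have h1 : ∀ x : E, (ContinuousLinearMap.toSpanSingleton ℝ x : ℝ →L[ℝ] E) 1 = x := by simp
  rw [h1, h1] at this
  exact this

lemma contMDiffWithinAt_curve_iff {γ : ℝ → M} {S : Set ℝ} {t : ℝ} {x₀ : M}
    (ht : γ t ∈ (chartAt E x₀).source) :
    ContMDiffWithinAt 𝓘(ℝ, ℝ) 𝓘(ℝ, E) ∞ γ S t ↔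
      ContinuousWithinAt γ S t ∧ ContDiffWithinAt ℝ ∞ (chartAt E x₀ ∘ γ) S t := by
  rw [contMDiffWithinAt_iff_target_of_mem_source ht, contMDiffWithinAt_iff_contDiffWithinAt]
  rfl

lemma contMDiffWithinAt_field_iff {γ : ℝ → M} {V : (t : ℝ) → TangentSpace 𝓘(ℝ, E) (γ t)}
    {S : Set ℝ} {t : ℝ} {x₀ : M} (htS : t ∈ S) (ht : γ t ∈ (chartAt E x₀).source) :
    ContMDiffWithinAt 𝓘(ℝ, ℝ) 𝓘(ℝ, E).tangent ∞
      (fun t ↦ (⟨γ t, V t⟩ : TangentBundle 𝓘(ℝ, E) M)) S t ↔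
      ContMDiffWithinAt 𝓘(ℝ, ℝ) 𝓘(ℝ, E) ∞ γ S t ∧
        ContDiffWithinAt ℝ ∞ (fun s ↦ toCoord x₀ (γ s) (V s)) S t := by
  rw [(trivializationAt E (TangentSpace 𝓘(ℝ, E) : M → Type _) x₀).contMDiffWithinAt_iff
    (by rw [Trivialization.mem_source]; exact mem_baseSet ht)]
  refine and_congr_right fun hγ ↦ ?_
  rw [contMDiffWithinAt_iff_contDiffWithinAt]
  have hev : ∀ᶠ s in 𝓝[S] t, γ s ∈ (chartAt E x₀).source :=
    hγ.continuousWithinAt.eventually_mem ((chartAt E x₀).open_source.mem_nhds ht)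
  refine Filter.EventuallyEq.congr_contDiffWithinAt_of_mem ?_ htS
  filter_upwards [hev] with s hs
  rw [toCoord_apply hs]

end Curves

/-! ### Geodesic and parallel equations as first order systems -/

section CoordinateODE

variable {E : Type*} [NormedAddCommGroup E] [NormedSpace ℝ E]

lemma contDiffWithinAt_of_hasDerivWithinAt {v : E → E} {O : Set E} {f : ℝ → E} {S : Set ℝ} {t : ℝ}
    (hS : UniqueDiffOn ℝ S) (hv : ContDiffOn ℝ ∞ v O) (ht : t ∈ S)
    (h : ∀ᶠ s in 𝓝[S] t, f s ∈ O ∧ HasDerivWithinAt f (v (f s)) S s) :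
    ContDiffWithinAt ℝ ∞ f S t := by
  obtain ⟨V, hV, htV, hVS⟩ := mem_nhdsWithin.1 h
  have h1 : ContDiffOn ℝ ∞ f (S ∩ V) := contDiffOn_of_hasDerivWithinAt (hS.inter hV) hv
    (fun s hs ↦ (hVS ⟨hs.2, hs.1⟩).1) fun s hs ↦ (hVS ⟨hs.2, hs.1⟩).2.mono inter_subset_left
  exact (h1 t ⟨ht, htV⟩).mono_of_mem_nhdsWithin (inter_mem_nhdsWithin S (hV.mem_nhds htV))

/-- The geodesic equation as a first order system. -/
def geodesicField (Γ : E → E →L[ℝ] E →L[ℝ] E) (z : E × E) : E × E :=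
  (z.2, -Γ z.1 z.2 z.2)

/-- The geodesic equation together with the equation of parallel fields. -/
def parallelField (Γ : E → E →L[ℝ] E →L[ℝ] E) (z : E × E × E) : E × E × E :=
  (z.2.1, -Γ z.1 z.2.1 z.2.1, -Γ z.1 z.2.1 z.2.2)

variable {Γ : E → E →L[ℝ] E →L[ℝ] E} {Ω : Set E}

lemma contDiffOn_geodesicField (hΓ : ContDiffOn ℝ ∞ Γ Ω) :
    ContDiffOn ℝ ∞ (geodesicField Γ) (Ω ×ˢ univ) := by
  have h1 : ContDiffOn ℝ ∞ (fun z : E × E ↦ Γ z.1) (Ω ×ˢ univ) :=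
    hΓ.comp contDiff_fst.contDiffOn fun z hz ↦ hz.1
  have h2 : ContDiffOn ℝ ∞ (fun z : E × E ↦ z.2) (Ω ×ˢ univ) := contDiff_snd.contDiffOn
  exact h2.prodMk ((h1.clm_apply h2).clm_apply h2).neg

lemma contDiffOn_parallelField (hΓ : ContDiffOn ℝ ∞ Γ Ω) :
    ContDiffOn ℝ ∞ (parallelField Γ) (Ω ×ˢ univ) := by
  have h1 : ContDiffOn ℝ ∞ (fun z : E × E × E ↦ Γ z.1) (Ω ×ˢ univ) :=
    hΓ.comp contDiff_fst.contDiffOn fun z hz ↦ hz.1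
  have h2 : ContDiffOn ℝ ∞ (fun z : E × E × E ↦ z.2.1) (Ω ×ˢ univ) :=
    (contDiff_fst.comp contDiff_snd).contDiffOn
  have h3 : ContDiffOn ℝ ∞ (fun z : E × E × E ↦ z.2.2) (Ω ×ˢ univ) :=
    (contDiff_snd.comp contDiff_snd).contDiffOn
  exact h2.prodMk (((h1.clm_apply h2).clm_apply h2).neg.prodMk
    ((h1.clm_apply h2).clm_apply h3).neg)

/-- Local existence of parallel frames along geodesics, in coordinates. -/
lemma exists_local_frame [FiniteDimensional ℝ E] (hΩ : IsOpen Ω) (hΓ : ContDiffOn ℝ ∞ Γ Ω)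
    {u w : ℝ → E} {a b t₀ : ℝ} (ht₀ : t₀ ∈ Icc a b) (hu₀ : u t₀ ∈ Ω)
    (hu : ∀ᶠ t in 𝓝[Icc a b] t₀, HasDerivWithinAt u (w t) (Icc a b) t ∧
      HasDerivWithinAt w (-Γ (u t) (w t) (w t)) (Icc a b) t) :
    ∃ A : ℝ → E →L[ℝ] E, A t₀ = ContinuousLinearMap.id ℝ E ∧
      ∀ᶠ t in 𝓝[Icc a b] t₀, HasDerivWithinAt A (-(Γ (u t) (w t) ∘L A t)) (Icc a b) t := by
  -- The development field is reused with the flat connection on E as source and `Γ` as target.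
  -- Developing the straight line with velocity `w t₀`, starting from the identity, gives a geodesic
  -- that coincides with `u` by uniqueness, and the linear map component of the solution is the
  -- parallel frame.
  let O : Set (E × E × E × (E →L[ℝ] E)) := {z | z.2.2.1 ∈ Ω}
  have hO : IsOpen O := hΩ.preimage (continuous_fst.comp (continuous_snd.comp continuous_snd))
  have hΨ : ContDiffOn ℝ ∞ (developmentField (fun _ ↦ 0) Γ) O :=
    contDiffOn_developmentField (Ω := univ) contDiffOn_const hΓ fun z hz ↦ ⟨mem_univ _, hz⟩
  let z₀ : E × E × E × (E →L[ℝ] E) := (0, w t₀, u t₀, ContinuousLinearMap.id ℝ E)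
  obtain ⟨φ, ε, hε, -, hφ0, hφ, -⟩ := exists_localFlow hO hΨ (z₀ := z₀) hu₀
  have hz₀ : z₀ ∈ Metric.ball z₀ ε := Metric.mem_ball_self hε
  let z : ℝ → E × E × E × (E →L[ℝ] E) := fun t ↦ φ (z₀, t - t₀)
  have hzt₀ : z t₀ = z₀ := by simp only [z, sub_self]; exact hφ0 _ hz₀
  have hz : ∀ᶠ t in 𝓝 t₀, HasDerivAt z (developmentField (fun _ ↦ 0) Γ (z t)) t := by
    filter_upwards [Metric.ball_mem_nhds t₀ hε] with t ht
    have ht' : t - t₀ ∈ Metric.ball (0 : ℝ) ε := by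
      simpa [Real.dist_eq] using ht
    have h1 := (hφ _ hz₀ _ ht').2
    exact HasDerivAt.comp_sub_const t t₀ h1
  have hzc : ∀ᶠ t in 𝓝 t₀, HasDerivAt (fun t ↦ (z t).2.1) 0 t ∧
      HasDerivAt (fun t ↦ (z t).2.2.1) ((z t).2.2.2 (z t).2.1) t ∧
      HasDerivAt (fun t ↦ (z t).2.2.2)
        (-(Γ (z t).2.2.1 ((z t).2.2.2 (z t).2.1) ∘L (z t).2.2.2)) t := by
    filter_upwards [hz] with t ht
    refine ⟨by simpa [developmentField] using hasDerivAt_fst (hasDerivAt_snd ht),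
      hasDerivAt_fst (hasDerivAt_snd (hasDerivAt_snd ht)), ?_⟩
    have := hasDerivAt_snd (hasDerivAt_snd (hasDerivAt_snd ht))
    simpa [developmentField, parallelDeriv] using this
  have heq : (fun t ↦ (u t, w t)) =ᶠ[𝓝[Icc a b] t₀]
      fun t ↦ ((z t).2.2.1, (z t).2.2.2 (z t).2.1) := by
    refine eventuallyEq_of_hasDerivWithinAt (v := geodesicField Γ) ht₀
      (((contDiffOn_geodesicField hΓ).contDiffAt
        ((hΩ.prod isOpen_univ).mem_nhds ⟨hu₀, mem_univ _⟩)).of_le (by norm_cast)) ?_ ?_ ?_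
    · filter_upwards [hu] with t ht using ht.1.prodMk ht.2
    · filter_upwards [nhdsWithin_le_nhds hzc] with t ht
      have h1 := (ht.2.2.clm_apply ht.1)
      refine (ht.2.1.prodMk (h1.congr_deriv ?_)).hasDerivWithinAt
      simp
    · rw [hzt₀]; simp [z₀]
  refine ⟨fun t ↦ (z t).2.2.2, congrArg (fun p ↦ p.2.2.2) hzt₀, ?_⟩
  filter_upwards [nhdsWithin_le_nhds hzc, heq] with t ht he
  have h1 : u t = (z t).2.2.1 := congrArg Prod.fst he
  have h2 : w t = (z t).2.2.2 (z t).2.1 := congrArg Prod.snd he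
  rw [h1, h2]
  exact ht.2.2.hasDerivWithinAt

end CoordinateODE

/-! ### Propagation of properties along intervals -/

section Interval

/-- Connectedness of the interval: the set where `p` holds is open and closed. It serves to
propagate coincidence of solutions through changing charts. -/
lemma forall_mem_Icc_of_local {a b t₀ : ℝ} {p : ℝ → Prop} (ht₀ : t₀ ∈ Icc a b) (hp : p t₀)
    (h1 : ∀ t ∈ Icc a b, p t → ∀ᶠ s in 𝓝[Icc a b] t, p s)
    (h2 : ∀ t ∈ Icc a b, ¬ p t → ∀ᶠ s in 𝓝[Icc a b] t, ¬ p s) : ∀ t ∈ Icc a b, p t := by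
  intro t ht
  refine (isPreconnected_Icc.induction₂ (fun x y ↦ (p x ↔ p y)) (fun x hx ↦ ?_)
    (fun _ _ _ _ _ _ ↦ Iff.trans) (fun _ _ _ _ ↦ Iff.symm) ht₀ ht).1 hp
  by_cases hpx : p x
  · filter_upwards [h1 x hx hpx] with s hs using ⟨fun _ ↦ hs, fun _ ↦ hpx⟩
  · filter_upwards [h2 x hx hpx] with s hs using ⟨fun h ↦ absurd h hpx, fun h ↦ absurd h hs⟩

end Interval

/-! ### Geodesics and parallel fields in charts -/

section Geodesics

variable {E : Type*} [NormedAddCommGroup E] [NormedSpace ℝ E]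
  {M : Type*} [TopologicalSpace M] [ChartedSpace E M] [IsManifold 𝓘(ℝ, E) ∞ M]
  {cov : TangentConnection E M} {γ : ℝ → M} {S : Set ℝ}

lemma IsGeodesicOn.continuousOn (hγ : IsGeodesicOn cov γ S) : ContinuousOn γ S :=
  hγ.1.continuousOn

lemma IsGeodesicOn.hasDerivWithinAt_chart (hγ : IsGeodesicOn cov γ S) {t : ℝ} (ht : t ∈ S)
    {x₀ : M} (hx : γ t ∈ (chartAt E x₀).source) :
    HasDerivWithinAt (fun s ↦ chartAt E x₀ (γ s)) (toCoord x₀ (γ t) (velocity γ S t)) S t :=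
  hasDerivWithinAt_chart_comp hx ((hγ.1 t ht).mdifferentiableWithinAt (by simp))

lemma IsGeodesicOn.velocity_eq (hγ : IsGeodesicOn cov γ S) {T : Set ℝ} (hTS : T ⊆ S) {t : ℝ}
    (hT : UniqueDiffWithinAt ℝ T t) (ht : t ∈ T) :
    velocity (E := E) γ T t = velocity γ S t := by
  have hx := mem_chart_source E (γ t)
  apply toCoord_injective hx
  exact toCoord_velocity hT ((hγ.continuousOn t (hTS ht)).mono hTS) hx
    ((hγ.hasDerivWithinAt_chart (hTS ht) hx).mono hTS)

variable [FiniteDimensional ℝ E]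

lemma IsGeodesicOn.hasDerivWithinAt_velocity (hγ : IsGeodesicOn cov γ S) (hS : UniqueDiffOn ℝ S)
    {t : ℝ} (ht : t ∈ S) {x₀ : M} (hx : γ t ∈ (chartAt E x₀).source) :
    HasDerivWithinAt (fun s ↦ toCoord x₀ (γ s) (velocity γ S s))
      (-christoffel cov x₀ (chartAt E x₀ (γ t)) (toCoord x₀ (γ t) (velocity γ S t))
        (toCoord x₀ (γ t) (velocity γ S t))) S t := by
  have hc := hγ.continuousOn t ht
  have h1 := ((contMDiffWithinAt_curve_iff hx).1 (hγ.1 t ht)).2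
  have h2 : ContDiffWithinAt ℝ ∞ (derivWithin (chartAt E x₀ ∘ γ) S) S t :=
    (h1.fderivWithin_right hS (m := ∞) (by simp) ht).clm_apply contDiffWithinAt_const
  have h3 : (fun s ↦ toCoord x₀ (γ s) (velocity γ S s)) =ᶠ[𝓝[S] t]
      derivWithin (chartAt E x₀ ∘ γ) S := by
    filter_upwards [hc.eventually_mem ((chartAt E x₀).open_source.mem_nhds hx),
      self_mem_nhdsWithin] with s hs hsS
    exact ((hγ.hasDerivWithinAt_chart hsS hs).derivWithin (hS s hsS)).symm
  have h4 : HasDerivWithinAt (fun s ↦ toCoord x₀ (γ s) (velocity γ S s))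
      (derivWithin (derivWithin (chartAt E x₀ ∘ γ) S) S t) S t :=
    (h2.differentiableWithinAt (by simp)).hasDerivWithinAt.congr_of_eventuallyEq h3
      (h3.self_of_nhdsWithin ht)
  have h5 := toCoord_covDt cov (hS t ht) hc hx (hγ.hasDerivWithinAt_chart ht hx) h4
  rw [hγ.2 t ht, map_zero] at h5
  rwa [← eq_neg_of_add_eq_zero_left h5.symm]

/-- A curve solving the geodesic equation in charts is a geodesic. -/
lemma isGeodesicOn_of_chart [T2Space M] [CovariantDerivative.ContMDiffCovariantDerivative cov ∞]
    (hS : UniqueDiffOn ℝ S) (hc : ContinuousOn γ S)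
    (h : ∀ t ∈ S, ∃ (x₀ : M) (w : ℝ → E), γ t ∈ (chartAt E x₀).source ∧ ∀ᶠ s in 𝓝[S] t,
      HasDerivWithinAt (fun s ↦ chartAt E x₀ (γ s)) (w s) S s ∧
      HasDerivWithinAt w (-christoffel cov x₀ (chartAt E x₀ (γ s)) (w s) (w s)) S s) :
    IsGeodesicOn cov γ S := by
  refine ⟨fun t ht ↦ ?_, fun t ht ↦ ?_⟩
  · obtain ⟨x₀, w, hx, hw⟩ := h t ht
    refine (contMDiffWithinAt_curve_iff hx).2 ⟨hc t ht, ?_⟩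
    have := contDiffWithinAt_of_hasDerivWithinAt (f := fun s ↦ (chartAt E x₀ (γ s), w s)) hS
      (contDiffOn_geodesicField (contDiffOn_christoffel cov x₀)) ht (by
      filter_upwards [hw, (hc t ht).eventually_mem ((chartAt E x₀).open_source.mem_nhds hx)]
        with s hs hs' using ⟨⟨(chartAt E x₀).map_source hs', mem_univ _⟩, hs.1.prodMk hs.2⟩)
    exact this.fst
  · obtain ⟨x₀, w, hx, hw⟩ := h t ht
    apply toCoord_injective hx
    have hev : (fun s ↦ toCoord x₀ (γ s) (velocity γ S s)) =ᶠ[𝓝[S] t] w := by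
      filter_upwards [hw, (hc t ht).eventually_mem ((chartAt E x₀).open_source.mem_nhds hx),
        self_mem_nhdsWithin] with s hs hs' hsS
      exact toCoord_velocity (hS s hsS) (hc s hsS) hs' hs.1
    have hw' := hw.self_of_nhdsWithin ht
    have hev' : toCoord x₀ (γ t) (velocity γ S t) = w t := hev.self_of_nhdsWithin ht
    rw [toCoord_covDt cov (hS t ht) (hc t ht) hx hw'.1
      (hw'.2.congr_of_eventuallyEq hev hev'), map_zero, hev', neg_add_cancel]

/-- Not immediate from the definition, since velocity and covariant derivative are taken within the
set; the equations in charts do restrict. -/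
lemma IsGeodesicOn.mono [T2Space M] [CovariantDerivative.ContMDiffCovariantDerivative cov ∞]
    (hγ : IsGeodesicOn cov γ S) (hS : UniqueDiffOn ℝ S) {T : Set ℝ}
    (hT : UniqueDiffOn ℝ T) (hTS : T ⊆ S) : IsGeodesicOn cov γ T := by
  refine isGeodesicOn_of_chart hT (hγ.continuousOn.mono hTS) fun t ht ↦
    ⟨γ t, fun s ↦ toCoord (γ t) (γ s) (velocity γ S s), mem_chart_source E _, ?_⟩
  filter_upwards [self_mem_nhdsWithin, ((hγ.continuousOn t (hTS ht)).mono hTS).eventually_mem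
    ((chartAt E (γ t)).open_source.mem_nhds (mem_chart_source E _))] with s hs hs'
  exact ⟨(hγ.hasDerivWithinAt_chart (hTS hs) hs').mono hTS,
    (hγ.hasDerivWithinAt_velocity hS (hTS hs) hs').mono hTS⟩

/-! ### Parallel fields along geodesics -/

variable {V V' : (t : ℝ) → TangentSpace 𝓘(ℝ, E) (γ t)}

lemma IsParallelOn.hasDerivWithinAt (hV : IsParallelOn cov γ V S) (hγ : IsGeodesicOn cov γ S)
    (hS : UniqueDiffOn ℝ S) {t : ℝ} (ht : t ∈ S) {x₀ : M} (hx : γ t ∈ (chartAt E x₀).source) :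
    HasDerivWithinAt (fun s ↦ toCoord x₀ (γ s) (V s))
      (-christoffel cov x₀ (chartAt E x₀ (γ t)) (toCoord x₀ (γ t) (velocity γ S t))
        (toCoord x₀ (γ t) (V t))) S t := by
  have h1 := ((contMDiffWithinAt_field_iff ht hx).1 (hV.1 t ht)).2
  have h4 := (h1.differentiableWithinAt (by simp)).hasDerivWithinAt
  have h5 := toCoord_covDt cov (hS t ht) (hγ.continuousOn t ht) hx
    (hγ.hasDerivWithinAt_chart ht hx) h4
  rw [hV.2 t ht, map_zero] at h5
  rwa [← eq_neg_of_add_eq_zero_left h5.symm]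

lemma isParallelOn_of_chart [T2Space M] [CovariantDerivative.ContMDiffCovariantDerivative cov ∞]
    (hγ : IsGeodesicOn cov γ S) (hS : UniqueDiffOn ℝ S)
    (h : ∀ t ∈ S, ∃ x₀ : M, γ t ∈ (chartAt E x₀).source ∧ ∀ᶠ s in 𝓝[S] t,
      HasDerivWithinAt (fun s ↦ toCoord x₀ (γ s) (V s))
      (-christoffel cov x₀ (chartAt E x₀ (γ s)) (toCoord x₀ (γ s) (velocity γ S s))
        (toCoord x₀ (γ s) (V s))) S s) : IsParallelOn cov γ V S := by
  refine ⟨fun t ht ↦ ?_, fun t ht ↦ ?_⟩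
  · obtain ⟨x₀, hx, hw⟩ := h t ht
    refine (contMDiffWithinAt_field_iff ht hx).2 ⟨hγ.1 t ht, ?_⟩
    have := contDiffWithinAt_of_hasDerivWithinAt (f := fun s ↦ (chartAt E x₀ (γ s),
      toCoord x₀ (γ s) (velocity γ S s), toCoord x₀ (γ s) (V s))) hS
      (contDiffOn_parallelField (contDiffOn_christoffel cov x₀)) ht (by
      filter_upwards [hw, (hγ.continuousOn t ht).eventually_mem
        ((chartAt E x₀).open_source.mem_nhds hx), self_mem_nhdsWithin]
        with s hs hs' hsS
      exact ⟨⟨(chartAt E x₀).map_source hs', mem_univ _⟩, (hγ.hasDerivWithinAt_chart hsS hs').prodMk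
        ((hγ.hasDerivWithinAt_velocity hS hsS hs').prodMk hs)⟩)
    exact this.snd.snd
  · obtain ⟨x₀, hx, hw⟩ := h t ht
    apply toCoord_injective hx
    rw [toCoord_covDt cov (hS t ht) (hγ.continuousOn t ht) hx (hγ.hasDerivWithinAt_chart ht hx)
      (hw.self_of_nhdsWithin ht), map_zero, neg_add_cancel]

end Geodesics

/-! ### Gluing derivatives at a common endpoint -/

section Gluing

variable {Z : Type*} [NormedAddCommGroup Z] [NormedSpace ℝ Z]

/-- Each one-sided hypothesis is needed only on its own side: at a point outside a closed interval,
differentiability within that interval holds with any derivative. -/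
lemma hasDerivWithinAt_Icc_union {f : ℝ → Z} {f' : Z} {a b c s : ℝ} (hab : a ≤ b) (hbc : b ≤ c)
    (h1 : s ≤ b → HasDerivWithinAt f f' (Icc a b) s)
    (h2 : b ≤ s → HasDerivWithinAt f f' (Icc b c) s) : HasDerivWithinAt f f' (Icc a c) s := by
  rw [← Icc_union_Icc_eq_Icc hab hbc]
  refine HasDerivWithinAt.union ?_ ?_
  · by_cases h : s ≤ b
    · exact h1 h
    · exact HasFDerivWithinAt.of_notMem_closure (by simp [isClosed_Icc.closure_eq, h])
  · by_cases h : b ≤ s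
    · exact h2 h
    · exact HasFDerivWithinAt.of_notMem_closure (by simp [isClosed_Icc.closure_eq, h])

end Gluing

/-! ### Parallel transport, parallel frames and reparametrization -/

section Parallel

variable {E : Type*} [NormedAddCommGroup E] [NormedSpace ℝ E] [FiniteDimensional ℝ E]
  {M : Type*} [TopologicalSpace M] [ChartedSpace E M] [IsManifold 𝓘(ℝ, E) ∞ M] [T2Space M]
  {cov : TangentConnection E M} [CovariantDerivative.ContMDiffCovariantDerivative cov ∞]
  {γ : ℝ → M} {a b c : ℝ} {V V' : (t : ℝ) → TangentSpace 𝓘(ℝ, E) (γ t)}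

lemma tangentBundle_mk_eq_iff {x₀ x x' : M} (hx : x ∈ (chartAt E x₀).source)
    (v : TangentSpace 𝓘(ℝ, E) x) (v' : TangentSpace 𝓘(ℝ, E) x') :
    (⟨x, v⟩ : TangentBundle 𝓘(ℝ, E) M) = ⟨x', v'⟩ ↔
      x = x' ∧ toCoord x₀ x v = toCoord x₀ x' v' := by
  constructor
  · intro h
    exact ⟨congrArg (fun p ↦ p.1) h, congrArg (fun p ↦ toCoord x₀ p.1 p.2) h⟩
  · rintro ⟨rfl, h⟩
    rw [toCoord_injective hx h]

/-- A geodesic and a parallel field along it are determined by their initial data. -/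
lemma IsParallelOn.mk_eqOn {γ' : ℝ → M} {V' : (t : ℝ) → TangentSpace 𝓘(ℝ, E) (γ' t)}
    (hab : a < b) (hγ : IsGeodesicOn cov γ (Icc a b))
    (hγ' : IsGeodesicOn cov γ' (Icc a b))
    (hV : IsParallelOn cov γ V (Icc a b)) (hV' : IsParallelOn cov γ' V' (Icc a b)) {t₀ : ℝ}
    (ht₀ : t₀ ∈ Icc a b)
    (hv : (⟨γ t₀, velocity γ (Icc a b) t₀⟩ : TangentBundle 𝓘(ℝ, E) M) =
      ⟨γ' t₀, velocity γ' (Icc a b) t₀⟩)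
    (h : (⟨γ t₀, V t₀⟩ : TangentBundle 𝓘(ℝ, E) M) = ⟨γ' t₀, V' t₀⟩) :
    ∀ t ∈ Icc a b, (⟨γ t, velocity γ (Icc a b) t⟩ : TangentBundle 𝓘(ℝ, E) M) =
      ⟨γ' t, velocity γ' (Icc a b) t⟩ ∧
      (⟨γ t, V t⟩ : TangentBundle 𝓘(ℝ, E) M) = ⟨γ' t, V' t⟩ := by
  have hS := uniqueDiffOn_Icc hab
  refine forall_mem_Icc_of_local ht₀ ⟨hv, h⟩ (fun t ht hp ↦ ?_) fun t ht hp ↦ ?_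
  -- Coincidence is an open condition by local uniqueness for the system `parallelField` in a chart.
  · set x₀ := γ t
    have hx : γ t ∈ (chartAt E x₀).source := mem_chart_source E _
    obtain ⟨hp0, hp1⟩ := (tangentBundle_mk_eq_iff hx _ _).1 hp.1
    have hp2 := ((tangentBundle_mk_eq_iff hx _ _).1 hp.2).2
    have hx' : γ' t ∈ (chartAt E x₀).source := by rw [← hp0]; exact hx
    have hnb : ∀ {γ : ℝ → M}, IsGeodesicOn cov γ (Icc a b) → γ t ∈ (chartAt E x₀).source →
        ∀ᶠ s in 𝓝[Icc a b] t, γ s ∈ (chartAt E x₀).source := fun hγ hx ↦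
      (hγ.continuousOn t ht).eventually_mem ((chartAt E x₀).open_source.mem_nhds hx)
    have key : ∀ {γ : ℝ → M} {W : (t : ℝ) → TangentSpace 𝓘(ℝ, E) (γ t)},
        IsGeodesicOn cov γ (Icc a b) → γ t ∈ (chartAt E x₀).source →
        IsParallelOn cov γ W (Icc a b) →
        ∀ᶠ s in 𝓝[Icc a b] t, HasDerivWithinAt (fun s ↦ (chartAt E x₀ (γ s),
          toCoord x₀ (γ s) (velocity γ (Icc a b) s), toCoord x₀ (γ s) (W s)))
          (parallelField (christoffel cov x₀) (chartAt E x₀ (γ s),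
          toCoord x₀ (γ s) (velocity γ (Icc a b) s), toCoord x₀ (γ s) (W s))) (Icc a b) s := by
      intro γ W hγ hx hW
      filter_upwards [hnb hγ hx, self_mem_nhdsWithin] with s hs hsS
      exact (hγ.hasDerivWithinAt_chart hsS hs).prodMk
        ((hγ.hasDerivWithinAt_velocity hS hsS hs).prodMk (hW.hasDerivWithinAt hγ hS hsS hs))
    have heq := eventuallyEq_of_hasDerivWithinAt ht
      (((contDiffOn_parallelField (contDiffOn_christoffel cov x₀)).contDiffAt
        (((chartAt E x₀).open_target.prod isOpen_univ).mem_nhds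
          ⟨(chartAt E x₀).map_source hx, mem_univ _⟩)).of_le (by norm_cast))
      (key hγ hx hV) (key hγ' hx' hV')
      (Prod.ext (congrArg (chartAt E x₀) hp0) (Prod.ext hp1 hp2))
    filter_upwards [heq, hnb hγ hx, hnb hγ' hx'] with s hs h1 h2
    have h3 : γ s = γ' s := (chartAt E x₀).injOn h1 h2 (congrArg (fun z ↦ z.1) hs)
    exact ⟨(tangentBundle_mk_eq_iff h1 _ _).2 ⟨h3, congrArg (fun z ↦ z.2.1) hs⟩,
      (tangentBundle_mk_eq_iff h1 _ _).2 ⟨h3, congrArg (fun z ↦ z.2.2) hs⟩⟩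
  -- Coincidence is a closed condition: different base points are separated by the Hausdorff
  -- property, and over a common base point different components stay different by continuity.
  · by_cases hne : γ t = γ' t
    · have hx : γ t ∈ (chartAt E (γ t)).source := mem_chart_source E _
      have hx' : γ' t ∈ (chartAt E (γ t)).source := by rw [← hne]; exact hx
      have hev := (hγ.continuousOn t ht).eventually_mem
        ((chartAt E (γ t)).open_source.mem_nhds hx)
      have h1 := ((hγ.hasDerivWithinAt_velocity hS ht hx).continuousWithinAt.prodMk
        (hV.hasDerivWithinAt hγ hS ht hx).continuousWithinAt).sub
        ((hγ'.hasDerivWithinAt_velocity hS ht hx').continuousWithinAt.prodMk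
        (hV'.hasDerivWithinAt hγ' hS ht hx').continuousWithinAt)
      filter_upwards [h1.eventually_ne (sub_ne_zero.2 fun h ↦ hp
        ⟨(tangentBundle_mk_eq_iff hx _ _).2 ⟨hne, congrArg Prod.fst h⟩,
        (tangentBundle_mk_eq_iff hx _ _).2 ⟨hne, congrArg Prod.snd h⟩⟩), hev] with s hs h2 h3
      exact hs (sub_eq_zero.2 (Prod.ext ((tangentBundle_mk_eq_iff h2 _ _).1 h3.1).2
        ((tangentBundle_mk_eq_iff h2 _ _).1 h3.2).2))
    · filter_upwards [((hγ.continuousOn t ht).prodMk (hγ'.continuousOn t ht)).eventually_mem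
        (isClosed_diagonal.isOpen_compl.mem_nhds hne)] with s hs h1
      exact hs (congrArg (fun p : TangentBundle 𝓘(ℝ, E) M ↦ p.1) h1.1)

/-- A parallel field is determined by its value at one point. -/
lemma IsParallelOn.eqOn (hab : a < b) (hγ : IsGeodesicOn cov γ (Icc a b))
    (hV : IsParallelOn cov γ V (Icc a b)) (hV' : IsParallelOn cov γ V' (Icc a b)) {t₀ : ℝ}
    (ht₀ : t₀ ∈ Icc a b) (h : V t₀ = V' t₀) : ∀ t ∈ Icc a b, V t = V' t := by
  intro t ht
  have := (hV.mk_eqOn hab hγ hγ hV' ht₀ rfl (by rw [h]) t ht).2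
  exact toCoord_injective (mem_chart_source E (γ t))
    ((tangentBundle_mk_eq_iff (mem_chart_source E (γ t)) _ _).1 this).2

lemma isParallelOn_of_forall_chart (hab : a < b) (hγ : IsGeodesicOn cov γ (Icc a b))
    (h : ∀ t ∈ Icc a b, ∀ x₀ : M, γ t ∈ (chartAt E x₀).source →
      HasDerivWithinAt (fun s ↦ toCoord x₀ (γ s) (V s))
      (-christoffel cov x₀ (chartAt E x₀ (γ t)) (toCoord x₀ (γ t) (velocity γ (Icc a b) t))
        (toCoord x₀ (γ t) (V t))) (Icc a b) t) : IsParallelOn cov γ V (Icc a b) := by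
  refine isParallelOn_of_chart hγ (uniqueDiffOn_Icc hab) fun t ht ↦
    ⟨γ t, mem_chart_source E _, ?_⟩
  filter_upwards [self_mem_nhdsWithin, (hγ.continuousOn t ht).eventually_mem
    ((chartAt E (γ t)).open_source.mem_nhds (mem_chart_source E _))] with s hs hs'
  exact h s hs _ hs'

lemma IsParallelOn.add (hab : a < b) (hγ : IsGeodesicOn cov γ (Icc a b))
    (hV : IsParallelOn cov γ V (Icc a b)) (hV' : IsParallelOn cov γ V' (Icc a b)) :
    IsParallelOn cov γ (fun t ↦ V t + V' t) (Icc a b) := by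
  refine isParallelOn_of_forall_chart hab hγ fun t ht x₀ hx ↦ ?_
  have := (hV.hasDerivWithinAt hγ (uniqueDiffOn_Icc hab) ht hx).add
    (hV'.hasDerivWithinAt hγ (uniqueDiffOn_Icc hab) ht hx)
  simp only [map_add]
  refine this.congr_deriv ?_
  abel

lemma IsParallelOn.const_smul (hab : a < b) (hγ : IsGeodesicOn cov γ (Icc a b))
    (hV : IsParallelOn cov γ V (Icc a b)) (r : ℝ) :
    IsParallelOn cov γ (fun t ↦ r • V t) (Icc a b) := by
  refine isParallelOn_of_forall_chart hab hγ fun t ht x₀ hx ↦ ?_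
  have := (hV.hasDerivWithinAt hγ (uniqueDiffOn_Icc hab) ht hx).const_smul r
  simp only [map_smul]
  refine this.congr_deriv ?_
  rw [smul_neg]

/-- The equation is of first order, so agreement of the values at `b` suffices: the one-sided
derivatives then agree through the equation, and smoothness follows from the equation as well. -/
lemma IsParallelOn.glue (hab : a < b) (hbc : b < c) (hγ : IsGeodesicOn cov γ (Icc a c))
    (hV : IsParallelOn cov γ V (Icc a b)) (hV' : IsParallelOn cov γ V' (Icc b c))
    (h : V b = V' b) : IsParallelOn cov γ (fun t ↦ if t ≤ b then V t else V' t) (Icc a c) := by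
  have hac := hab.trans hbc
  have hS := uniqueDiffOn_Icc hac
  have hs1 : Icc a b ⊆ Icc a c := Icc_subset_Icc_right hbc.le
  have hs2 : Icc b c ⊆ Icc a c := Icc_subset_Icc_left hab.le
  refine isParallelOn_of_forall_chart hac hγ fun t ht x₀ hx ↦ ?_
  refine hasDerivWithinAt_Icc_union hab.le hbc.le (fun htb ↦ ?_) fun htb ↦ ?_
  · have ht' : t ∈ Icc a b := ⟨ht.1, htb⟩
    have h1 := hV.hasDerivWithinAt (hγ.mono hS (uniqueDiffOn_Icc hab) hs1)
      (uniqueDiffOn_Icc hab) ht' hx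
    rw [hγ.velocity_eq hs1 (uniqueDiffOn_Icc hab t ht') ht'] at h1
    simp only [htb, if_true]
    refine h1.congr_of_mem (fun s hs ↦ ?_) ht'
    simp [hs.2]
  · have ht' : t ∈ Icc b c := ⟨htb, ht.2⟩
    have hW : ∀ s ∈ Icc b c, (if s ≤ b then V s else V' s) = V' s := by
      intro s hs
      split_ifs with hsb
      · obtain rfl := le_antisymm hsb hs.1
        exact h
      · rfl
    have h1 := hV'.hasDerivWithinAt (hγ.mono hS (uniqueDiffOn_Icc hbc) hs2)
      (uniqueDiffOn_Icc hbc) ht' hx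
    rw [hγ.velocity_eq hs2 (uniqueDiffOn_Icc hbc t ht') ht'] at h1
    rw [hW t ht']
    refine h1.congr_of_mem (fun s hs ↦ ?_) ht'
    rw [hW s hs]

/-- Near `t₀` the local frame is invertible, so it can be normalized at any nearby `c`. The radius
depends neither on the subinterval nor on `v`, as the Lebesgue number argument for global existence
requires. -/
lemma IsGeodesicOn.exists_local_parallel (hab : a < b) (hγ : IsGeodesicOn cov γ (Icc a b))
    {t₀ : ℝ} (ht₀ : t₀ ∈ Icc a b) :
    ∃ ε > 0, ∀ c d, a ≤ c → c < d → d ≤ b → c ∈ Metric.ball t₀ ε → d ∈ Metric.ball t₀ ε →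
      ∀ v : TangentSpace 𝓘(ℝ, E) (γ c), ∃ V : (t : ℝ) → TangentSpace 𝓘(ℝ, E) (γ t),
        IsParallelOn cov γ V (Icc c d) ∧ V c = v := by
  have hS := uniqueDiffOn_Icc hab
  set x₀ := γ t₀
  have hx : γ t₀ ∈ (chartAt E x₀).source := mem_chart_source E _
  have hev := (hγ.continuousOn t₀ ht₀).eventually_mem ((chartAt E x₀).open_source.mem_nhds hx)
  obtain ⟨A, hA₀, hA⟩ := exists_local_frame (chartAt E x₀).open_target
    (contDiffOn_christoffel cov x₀) (u := fun s ↦ chartAt E x₀ (γ s))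
    (w := fun s ↦ toCoord x₀ (γ s) (velocity γ (Icc a b) s)) ht₀ ((chartAt E x₀).map_source hx)
    (by
      filter_upwards [hev, self_mem_nhdsWithin] with s hs hsS
      exact ⟨hγ.hasDerivWithinAt_chart hsS hs, hγ.hasDerivWithinAt_velocity hS hsS hs⟩)
  have hAc := (hA.self_of_nhdsWithin ht₀).continuousWithinAt
  have hinv : ∀ᶠ t in 𝓝[Icc a b] t₀, A t ∈ range ((↑) : (E ≃L[ℝ] E) → E →L[ℝ] E) :=
    hAc.eventually_mem (by rw [hA₀]; exact ContinuousLinearEquiv.nhds (.refl ℝ E))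
  obtain ⟨ε, hε, H⟩ := Metric.mem_nhdsWithin_iff.1 (hev.and (hA.and hinv))
  refine ⟨ε, hε, fun c d hac hcd hdb hc hd v ↦ ?_⟩
  have hcdsub : Icc c d ⊆ Icc a b := Icc_subset_Icc hac hdb
  have hball : Icc c d ⊆ Metric.ball t₀ ε := by
    rw [Real.ball_eq_Ioo] at hc hd ⊢
    exact fun s hs ↦ ⟨hc.1.trans_le hs.1, hs.2.trans_lt hd.2⟩
  have H' := fun s (hs : s ∈ Icc c d) ↦ H ⟨hball hs, hcdsub hs⟩
  have hcm : c ∈ Icc c d := ⟨le_rfl, hcd.le⟩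
  obtain ⟨e, he⟩ := (H' c hcm).2.2
  have hγ' := hγ.mono hS (uniqueDiffOn_Icc hcd) hcdsub
  refine ⟨fun t ↦ ofCoord x₀ (γ t) (A t (e.symm (toCoord x₀ (γ c) v))),
    isParallelOn_of_chart hγ' (uniqueDiffOn_Icc hcd) fun t ht ↦ ⟨x₀, (H' t ht).1, ?_⟩, ?_⟩
  · filter_upwards [self_mem_nhdsWithin] with s hs
    have h1 := ((H' s hs).2.1.mono hcdsub).clm_apply
      (hasDerivWithinAt_const s (Icc c d) (e.symm (toCoord x₀ (γ c) v)))
    rw [toCoord_ofCoord (H' s hs).1, hγ.velocity_eq hcdsub (uniqueDiffOn_Icc hcd s hs) hs]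
    refine (h1.congr_deriv ?_).congr_of_mem (fun r hr ↦ ?_) hs
    · simp
    · rw [toCoord_ofCoord (H' r hr).1]
  · simp only [← he]
    simp [ofCoord_toCoord (H' c hcm).1]

/-- Existence of parallel transport along geodesics. -/
lemma IsGeodesicOn.exists_parallel (hab : a < b) (hγ : IsGeodesicOn cov γ (Icc a b))
    (v : TangentSpace 𝓘(ℝ, E) (γ a)) : ∃ V : (t : ℝ) → TangentSpace 𝓘(ℝ, E) (γ t),
      IsParallelOn cov γ V (Icc a b) ∧ V a = v := by
  choose! ε hε H using fun t₀ (ht₀ : t₀ ∈ Icc a b) ↦ hγ.exists_local_parallel hab ht₀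
  obtain ⟨δ, hδ, hcov⟩ := lebesgue_number_lemma_of_metric (s := Icc a b)
    (c := fun t : Icc a b ↦ Metric.ball (t : ℝ) (ε t)) isCompact_Icc
    (fun _ ↦ Metric.isOpen_ball) fun t ht ↦
      mem_iUnion.2 ⟨⟨t, ht⟩, Metric.mem_ball_self (hε t ht)⟩
  have hloc : ∀ c d, a ≤ c → c < d → d ≤ b → d - c < δ → ∀ v : TangentSpace 𝓘(ℝ, E) (γ c),
      ∃ V : (t : ℝ) → TangentSpace 𝓘(ℝ, E) (γ t), IsParallelOn cov γ V (Icc c d) ∧ V c = v := by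
    intro c d hac hcd hdb hdc v
    obtain ⟨t, ht⟩ := hcov c ⟨hac, hcd.le.trans hdb⟩
    refine H t t.2 c d hac hcd hdb (ht (Metric.mem_ball_self hδ)) (ht ?_) v
    rwa [Metric.mem_ball, Real.dist_eq, abs_of_pos (by linarith)]
  -- Continuation in steps of length δ / 2, strictly below the Lebesgue number δ required by `hloc`.
  have key : ∀ n : ℕ, ∀ τ, a < τ → τ ≤ b → τ ≤ a + n * (δ / 2) →
      ∃ V : (t : ℝ) → TangentSpace 𝓘(ℝ, E) (γ t), IsParallelOn cov γ V (Icc a τ) ∧ V a = v := by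
    intro n
    induction n with
    | zero => intro τ h1 _ h2; simp at h2; linarith
    | succ n ih =>
      intro τ h1 h2 h3
      push_cast at h3
      rcases le_or_gt τ (a + n * (δ / 2)) with h | h
      · exact ih τ h1 h2 h
      · rcases Nat.eq_zero_or_pos n with rfl | hn
        · exact hloc a τ le_rfl h1 h2 (by simp at h3; linarith) v
        · set s := a + n * (δ / 2) with hs
          have hn' : (0 : ℝ) < n := by exact_mod_cast hn
          have has : a < s := by rw [hs]; nlinarith
          obtain ⟨V, hV, hVa⟩ := ih s has (h.le.trans h2) le_rfl
          obtain ⟨V', hV', hVs⟩ := hloc s τ has.le h h2 (by linarith) (V s)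
          refine ⟨_, hV.glue has h (hγ.mono (uniqueDiffOn_Icc hab) (uniqueDiffOn_Icc h1)
            (Icc_subset_Icc_right h2)) hV' hVs.symm, ?_⟩
          simp [has.le, hVa]
  obtain ⟨n, hn⟩ := exists_nat_gt ((b - a) / (δ / 2))
  refine key n b hab le_rfl ?_
  rw [div_lt_iff₀ (by positivity)] at hn
  linarith

/-- Existence of parallel frames along geodesics. -/
lemma IsGeodesicOn.exists_parallelFrame (hab : a < b) (hγ : IsGeodesicOn cov γ (Icc a b)) :
    ∃ (A : (t : ℝ) → E →L[ℝ] TangentSpace 𝓘(ℝ, E) (γ t))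
      (Θ : (t : ℝ) → TangentSpace 𝓘(ℝ, E) (γ t) →L[ℝ] E),
      (∀ w, IsParallelOn cov γ (fun t ↦ A t w) (Icc a b)) ∧
      ∀ t ∈ Icc a b, (∀ w, Θ t (A t w) = w) ∧ ∀ v, A t (Θ t v) = v := by
  choose V hV hVa using fun w : E ↦ hγ.exists_parallel hab (ofCoord (γ a) (γ a) w)
  have ha : a ∈ Icc a b := ⟨le_rfl, hab.le⟩
  classical
  -- The fields `V w` are determined by their initial values, hence linear in `w`, only on the
  -- interval; outside it the frame is set to 0.
  let A : (t : ℝ) → E →L[ℝ] TangentSpace 𝓘(ℝ, E) (γ t) := fun t ↦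
    if ht : t ∈ Icc a b then
      LinearMap.toContinuousLinearMap (𝕜 := ℝ) (E := E) (F' := TangentSpace 𝓘(ℝ, E) (γ t))
        { toFun := fun w ↦ V w t
          map_add' := fun w w' ↦ (hV (w + w')).eqOn hab hγ ((hV w).add hab hγ (hV w')) ha
            (by simp [hVa]) t ht
          map_smul' := fun r w ↦ (hV (r • w)).eqOn hab hγ ((hV w).const_smul hab hγ r) ha
            (by simp [hVa]) t ht }
    else 0
  have hA : ∀ t ∈ Icc a b, ∀ w, A t w = V w t := by
    intro t ht w
    simp only [A, dif_pos ht]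
    rfl
  have hAinj : ∀ t ∈ Icc a b, Function.Injective (toCoord (γ t) (γ t) ∘L A t : E →L[ℝ] E) := by
    intro t ht w w' h
    have h1 : A t w = A t w' := toCoord_injective (mem_chart_source E (γ t)) h
    rw [hA t ht, hA t ht] at h1
    have h2 := (hV w).eqOn hab hγ (hV w') ht h1 a ha
    rw [hVa, hVa] at h2
    simpa [toCoord_ofCoord (mem_chart_source E (γ a))] using
      congrArg (toCoord (γ a) (γ a)) h2
  refine ⟨A, fun t ↦ (toCoord (γ t) (γ t) ∘L A t : E →L[ℝ] E).inverse ∘L toCoord (γ t) (γ t),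
    fun w ↦ ?_, fun t ht ↦ ?_⟩
  · refine isParallelOn_of_forall_chart hab hγ fun t ht x₀ hx ↦ ?_
    have := (hV w).hasDerivWithinAt hγ (uniqueDiffOn_Icc hab) ht hx
    rw [hA t ht]
    exact this.congr_of_mem (fun s hs ↦ by rw [hA s hs]) ht
  · let e : E ≃L[ℝ] E := (LinearEquiv.ofInjectiveEndo
      ((toCoord (γ t) (γ t) ∘L A t : E →L[ℝ] E) : E →ₗ[ℝ] E) (hAinj t ht)).toContinuousLinearEquiv
    have he : (toCoord (γ t) (γ t) ∘L A t : E →L[ℝ] E) = e := by ext w; rfl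
    have hΘ : (toCoord (γ t) (γ t) ∘L A t : E →L[ℝ] E).inverse = e.symm := by
      rw [he]; exact ContinuousLinearMap.inverse_equiv e
    have he' : ∀ w, toCoord (γ t) (γ t) (A t w) = e w := fun w ↦ rfl
    refine ⟨fun w ↦ ?_, fun v ↦ ?_⟩
    · change (toCoord (γ t) (γ t) ∘L A t : E →L[ℝ] E).inverse (e w) = w
      rw [hΘ]
      exact e.symm_apply_apply w
    · apply toCoord_injective (mem_chart_source E (γ t))
      refine (he' _).trans ?_
      change e ((toCoord (γ t) (γ t) ∘L A t : E →L[ℝ] E).inverse _) = _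
      rw [hΘ]
      exact e.apply_symm_apply _

lemma IsGeodesicOn.exists_parallel_through (hab : a < b) (hγ : IsGeodesicOn cov γ (Icc a b))
    {t₀ : ℝ} (ht₀ : t₀ ∈ Icc a b) (v : TangentSpace 𝓘(ℝ, E) (γ t₀)) :
    ∃ V : (t : ℝ) → TangentSpace 𝓘(ℝ, E) (γ t), IsParallelOn cov γ V (Icc a b) ∧ V t₀ = v := by
  obtain ⟨A, Θ, hA, hAΘ⟩ := hγ.exists_parallelFrame hab
  exact ⟨fun t ↦ A t (Θ t₀ v), hA _, (hAΘ t₀ ht₀).2 v⟩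

lemma IsGeodesicOn.isParallelOn_velocity (hab : a < b) (hγ : IsGeodesicOn cov γ (Icc a b)) :
    IsParallelOn cov γ (velocity γ (Icc a b)) (Icc a b) :=
  isParallelOn_of_forall_chart hab hγ fun _ ht _ hx ↦
    hγ.hasDerivWithinAt_velocity (uniqueDiffOn_Icc hab) ht hx

/-! ### Reparametrization -/

variable {d r : ℝ} {ρ : ℝ → ℝ}

lemma IsGeodesicOn.hasDerivWithinAt_comp (hγ : IsGeodesicOn cov γ (Icc a b))
    (hρ : ∀ t, HasDerivAt ρ r t) (hm : MapsTo ρ (Icc c d) (Icc a b)) {t : ℝ} (ht : t ∈ Icc c d)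
    {x₀ : M} (hx : γ (ρ t) ∈ (chartAt E x₀).source) :
    HasDerivWithinAt (fun s ↦ chartAt E x₀ (γ (ρ s)))
      (r • toCoord x₀ (γ (ρ t)) (velocity γ (Icc a b) (ρ t))) (Icc c d) t :=
  (hγ.hasDerivWithinAt_chart (hm ht) hx).scomp t (hρ t).hasDerivWithinAt hm

lemma IsGeodesicOn.comp (hab : a < b) (hcd : c < d) (hγ : IsGeodesicOn cov γ (Icc a b))
    (hρ : ∀ t, HasDerivAt ρ r t) (hm : MapsTo ρ (Icc c d) (Icc a b)) :
    IsGeodesicOn cov (fun t ↦ γ (ρ t)) (Icc c d) := by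
  have hc : ContinuousOn (fun t ↦ γ (ρ t)) (Icc c d) :=
    hγ.continuousOn.comp (fun t _ ↦ (hρ t).continuousAt.continuousWithinAt) hm
  refine isGeodesicOn_of_chart (uniqueDiffOn_Icc hcd) hc fun t ht ↦ ⟨γ (ρ t),
    fun s ↦ r • toCoord (γ (ρ t)) (γ (ρ s)) (velocity γ (Icc a b) (ρ s)),
    mem_chart_source E _, ?_⟩
  filter_upwards [self_mem_nhdsWithin, (hc t ht).eventually_mem
    ((chartAt E (γ (ρ t))).open_source.mem_nhds (mem_chart_source E _))] with s hs hs'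
  refine ⟨hγ.hasDerivWithinAt_comp hρ hm hs hs', ?_⟩
  refine (((hγ.hasDerivWithinAt_velocity (uniqueDiffOn_Icc hab) (hm hs) hs').scomp s
    (hρ s).hasDerivWithinAt hm).const_smul r).congr_deriv ?_
  simp only [map_smul, smul_apply, smul_neg]

lemma IsGeodesicOn.velocity_comp (hcd : c < d) (hγ : IsGeodesicOn cov γ (Icc a b))
    (hρ : ∀ t, HasDerivAt ρ r t) (hm : MapsTo ρ (Icc c d) (Icc a b)) {t : ℝ}
    (ht : t ∈ Icc c d) :
    velocity (E := E) (fun t ↦ γ (ρ t)) (Icc c d) t = r • velocity γ (Icc a b) (ρ t) := by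
  apply toCoord_injective (mem_chart_source E (γ (ρ t)))
  refine (toCoord_velocity (uniqueDiffOn_Icc hcd t ht) ?_ (mem_chart_source E (γ (ρ t)))
    (hγ.hasDerivWithinAt_comp hρ hm ht (mem_chart_source E (γ (ρ t))))).trans
    (map_smul (toCoord (γ (ρ t)) (γ (ρ t))) r _).symm
  exact (hγ.continuousOn.comp (fun t _ ↦ (hρ t).continuousAt.continuousWithinAt) hm) t ht

lemma IsParallelOn.comp (hab : a < b) (hcd : c < d) (hγ : IsGeodesicOn cov γ (Icc a b))
    (hV : IsParallelOn cov γ V (Icc a b))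
    (hρ : ∀ t, HasDerivAt ρ r t) (hm : MapsTo ρ (Icc c d) (Icc a b)) :
    IsParallelOn cov (fun t ↦ γ (ρ t)) (fun t ↦ V (ρ t)) (Icc c d) := by
  refine isParallelOn_of_forall_chart hcd (hγ.comp hab hcd hρ hm) fun t ht x₀ hx ↦ ?_
  refine ((hV.hasDerivWithinAt hγ (uniqueDiffOn_Icc hab) (hm ht) hx).scomp t
    (hρ t).hasDerivWithinAt hm).congr_deriv ?_
  have h : toCoord x₀ (γ (ρ t)) (velocity (E := E) (fun t ↦ γ (ρ t)) (Icc c d) t) =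
      r • toCoord x₀ (γ (ρ t)) (velocity γ (Icc a b) (ρ t)) :=
    (congrArg _ (hγ.velocity_comp hcd hρ hm ht)).trans (map_smul (toCoord x₀ (γ (ρ t))) r _)
  rw [h]
  simp only [map_smul, smul_apply, smul_neg]

lemma isGeodesicOn_const (hab : a < b) (x : M) : IsGeodesicOn cov (fun _ ↦ x) (Icc a b) := by
  refine isGeodesicOn_of_chart (uniqueDiffOn_Icc hab) continuousOn_const fun t ht ↦
    ⟨x, fun _ ↦ 0, mem_chart_source E _, .of_forall fun s ↦ ⟨hasDerivWithinAt_const _ _ _, ?_⟩⟩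
  simpa using hasDerivWithinAt_const s (Icc a b) (0 : E)

/-- Affine rescaling: the geodesic on [0, 1] with initial velocity (b - a) w is run at speed 1 / (b
- a). -/
lemma GeodesicallyComplete.exists_isGeodesicOn (hcov : GeodesicallyComplete cov) (hab : a < b)
    (y : M) (w : TangentSpace 𝓘(ℝ, E) y) : ∃ γ : ℝ → M, IsGeodesicOn cov γ (Icc a b) ∧
      (⟨γ a, velocity γ (Icc a b) a⟩ : TangentBundle 𝓘(ℝ, E) M) = ⟨y, w⟩ := by
  obtain ⟨γ, hγ, h⟩ := hcov y ((b - a) • w)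
  have hba : 0 < b - a := sub_pos.2 hab
  have hρ : ∀ t, HasDerivAt (fun t ↦ (t - a) / (b - a)) (b - a)⁻¹ t := fun t ↦ by
    simpa using ((hasDerivAt_id t).sub_const a).div_const (b - a)
  have hm : MapsTo (fun t ↦ (t - a) / (b - a)) (Icc a b) (Icc 0 1) := fun t ht ↦
    ⟨div_nonneg (by linarith [ht.1]) hba.le, (div_le_one hba).2 (by linarith [ht.2])⟩
  refine ⟨_, hγ.comp one_pos hab hρ hm, ?_⟩
  rw [hγ.velocity_comp hab hρ hm (left_mem_Icc.2 hab.le)]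
  have h0 : (a - a) / (b - a) = 0 := by simp
  have h1 : (b - a)⁻¹ • ((b - a) • w) = w := inv_smul_smul₀ hba.ne' w
  have h2 : (⟨γ 0, (b - a)⁻¹ • velocity γ (Icc 0 1) 0⟩ : TangentBundle 𝓘(ℝ, E) M) =
      ⟨y, (b - a)⁻¹ • ((b - a) • w)⟩ := congrArg (fun p : TangentBundle 𝓘(ℝ, E) M ↦
    (⟨p.1, (b - a)⁻¹ • p.2⟩ : TangentBundle 𝓘(ℝ, E) M)) h
  rw [h1] at h2
  have h3 : ∀ s, s = 0 → (⟨γ s, (b - a)⁻¹ • velocity γ (Icc 0 1) s⟩ :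
      TangentBundle 𝓘(ℝ, E) M) = ⟨γ 0, (b - a)⁻¹ • velocity γ (Icc 0 1) 0⟩ := by
    rintro s rfl; rfl
  exact (h3 _ h0).trans h2

end Parallel

/-! ### Developments: existence, uniqueness and relation to induced maps -/

section InducedCurves

variable {E : Type*} [NormedAddCommGroup E] [NormedSpace ℝ E] [FiniteDimensional ℝ E]
  {M : Type*} [TopologicalSpace M] [ChartedSpace E M] [IsManifold 𝓘(ℝ, E) ∞ M] [T2Space M]
  {F : Type*} [NormedAddCommGroup F] [NormedSpace ℝ F] [FiniteDimensional ℝ F]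
  {N : Type*} [TopologicalSpace N] [ChartedSpace F N] [IsManifold 𝓘(ℝ, F) ∞ N] [T2Space N]

section Congr

variable {cov : TangentConnection E M} [CovariantDerivative.ContMDiffCovariantDerivative cov ∞]
  {γ γ' : ℝ → M} {a b : ℝ} {V : (t : ℝ) → TangentSpace 𝓘(ℝ, E) (γ t)}
  {V' : (t : ℝ) → TangentSpace 𝓘(ℝ, E) (γ' t)}

lemma IsGeodesicOn.congr (hab : a < b) (hγ : IsGeodesicOn cov γ (Icc a b))
    (h : EqOn γ γ' (Icc a b)) : IsGeodesicOn cov γ' (Icc a b) := by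
  have hc : ContinuousOn γ' (Icc a b) := hγ.continuousOn.congr h.symm
  refine isGeodesicOn_of_chart (uniqueDiffOn_Icc hab) hc fun t ht ↦ ⟨γ' t,
    fun s ↦ toCoord (γ' t) (γ s) (velocity γ (Icc a b) s), mem_chart_source E _, ?_⟩
  filter_upwards [self_mem_nhdsWithin, (hc t ht).eventually_mem
    ((chartAt E (γ' t)).open_source.mem_nhds (mem_chart_source E _))] with s hs hs'
  have hs'' : γ s ∈ (chartAt E (γ' t)).source := by rw [h hs]; exact hs'
  refine ⟨(hγ.hasDerivWithinAt_chart hs hs'').congr_of_mem (fun r hr ↦ by rw [h hr]) hs, ?_⟩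
  rw [← h hs]
  exact hγ.hasDerivWithinAt_velocity (uniqueDiffOn_Icc hab) hs hs''

/-- The two velocities live in different types, so they are compared in the total space; the same
device is used for all comparisons along curves that agree only on an interval. -/
lemma IsGeodesicOn.mk_velocity_congr (hab : a < b) (hγ : IsGeodesicOn cov γ (Icc a b))
    (h : EqOn γ γ' (Icc a b)) {t : ℝ} (ht : t ∈ Icc a b) :
    (⟨γ t, velocity γ (Icc a b) t⟩ : TangentBundle 𝓘(ℝ, E) M) =
      ⟨γ' t, velocity γ' (Icc a b) t⟩ := by
  have hx : γ t ∈ (chartAt E (γ t)).source := mem_chart_source E _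
  have hx' : γ' t ∈ (chartAt E (γ t)).source := by rw [← h ht]; exact hx
  refine (tangentBundle_mk_eq_iff hx _ _).2 ⟨h ht, (toCoord_velocity (uniqueDiffOn_Icc hab t ht)
    ((hγ.congr hab h).continuousOn t ht) hx' ?_).symm⟩
  exact (hγ.hasDerivWithinAt_chart ht hx).congr_of_mem
    (fun r hr ↦ congrArg (chartAt E (γ t)) (h hr).symm) ht

lemma IsParallelOn.congr (hab : a < b) (hγ : IsGeodesicOn cov γ (Icc a b))
    (hV : IsParallelOn cov γ V (Icc a b))
    (h : ∀ t ∈ Icc a b, (⟨γ t, V t⟩ : TangentBundle 𝓘(ℝ, E) M) = ⟨γ' t, V' t⟩) :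
    IsParallelOn cov γ' V' (Icc a b) := by
  have h' : EqOn γ γ' (Icc a b) := fun t ht ↦
    congrArg (fun p : TangentBundle 𝓘(ℝ, E) M ↦ p.1) (h t ht)
  have hk : ∀ x₀, ∀ t ∈ Icc a b, toCoord x₀ (γ t) (V t) = toCoord x₀ (γ' t) (V' t) :=
    fun x₀ t ht ↦ congrArg (fun p : TangentBundle 𝓘(ℝ, E) M ↦ toCoord x₀ p.1 p.2) (h t ht)
  refine isParallelOn_of_forall_chart hab (hγ.congr hab h') fun t ht x₀ hx ↦ ?_
  have hv : toCoord x₀ (γ t) (velocity γ (Icc a b) t) =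
      toCoord x₀ (γ' t) (velocity γ' (Icc a b) t) :=
    congrArg (fun p : TangentBundle 𝓘(ℝ, E) M ↦ toCoord x₀ p.1 p.2)
      (hγ.mk_velocity_congr hab h' ht)
  have h1 := hV.hasDerivWithinAt hγ (uniqueDiffOn_Icc hab) ht (x₀ := x₀) (by rwa [h' ht])
  rw [← hk x₀ t ht, ← hv, ← h' ht]
  exact h1.congr_of_mem (fun s hs ↦ (hk x₀ s hs).symm) ht

end Congr

/-- A curve `t ↦ (γ t, μ t, Σ t)` in `Lin(TM, TN)` is a development if `γ` and `μ` are geodesics,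
`Σ` maps the velocity of `γ` to that of `μ`, and `Σ` maps parallel fields to parallel fields. -/
structure IsDevelopmentOn (covM : TangentConnection E M) (covN : TangentConnection F N)
    (c : ℝ → LinBundle E M F N) (S : Set ℝ) : Prop where
  source : IsGeodesicOn covM (fun t ↦ (c t).1.1) S
  target : IsGeodesicOn covN (fun t ↦ (c t).1.2) S
  velocity_eq : ∀ t ∈ S, velocity (fun t ↦ (c t).1.2) S t =
    (c t).2 (velocity (E := E) (fun t ↦ (c t).1.1) S t)
  parallel : ∀ V, IsParallelOn covM (fun t ↦ (c t).1.1) V S →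
    IsParallelOn covN (fun t ↦ (c t).1.2) (fun t ↦ (c t).2 (V t)) S

section LinBundle

lemma LinBundle.ext {p p' : LinBundle E M F N}
    (h : ∀ v, ∃ v', (⟨p.1.1, v⟩ : TangentBundle 𝓘(ℝ, E) M) = ⟨p'.1.1, v'⟩ ∧
      (⟨p.1.2, p.2 v⟩ : TangentBundle 𝓘(ℝ, F) N) = ⟨p'.1.2, p'.2 v'⟩) : p = p' := by
  obtain ⟨⟨x, y⟩, s⟩ := p
  obtain ⟨⟨x', y'⟩, s'⟩ := p'
  obtain ⟨v', h1, h2⟩ := h 0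
  obtain rfl : x = x' := congrArg (fun p : TangentBundle 𝓘(ℝ, E) M ↦ p.1) h1
  obtain rfl : y = y' := congrArg (fun p : TangentBundle 𝓘(ℝ, F) N ↦ p.1) h2
  congr 1
  refine ContinuousLinearMap.ext fun v ↦ ?_
  obtain ⟨v', h1, h2⟩ := h v
  obtain rfl := eq_of_heq (TotalSpace.mk.inj h1).2
  exact eq_of_heq (TotalSpace.mk.inj h2).2

/-- The action of a point of `Lin(TM, TN)` on a tangent vector. -/
lemma LinBundle.mk_apply_congr {p p' : LinBundle E M F N} (h : p = p')
    {v : TangentSpace 𝓘(ℝ, E) p.1.1} {v' : TangentSpace 𝓘(ℝ, E) p'.1.1}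
    (hv : (⟨p.1.1, v⟩ : TangentBundle 𝓘(ℝ, E) M) = ⟨p'.1.1, v'⟩) :
    (⟨p.1.2, p.2 v⟩ : TangentBundle 𝓘(ℝ, F) N) = ⟨p'.1.2, p'.2 v'⟩ := by
  subst h
  rw [eq_of_heq (TotalSpace.mk.inj hv).2]

lemma LinBundle.exists_mk_eq {p p' : LinBundle E M F N} (h : p = p')
    (v : TangentSpace 𝓘(ℝ, E) p.1.1) : ∃ v' : TangentSpace 𝓘(ℝ, E) p'.1.1,
      (⟨p.1.1, v⟩ : TangentBundle 𝓘(ℝ, E) M) = ⟨p'.1.1, v'⟩ := by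
  subst h
  exact ⟨v, rfl⟩

end LinBundle

variable {covM : TangentConnection E M} [CovariantDerivative.ContMDiffCovariantDerivative covM ∞]
  {covN : TangentConnection F N} [CovariantDerivative.ContMDiffCovariantDerivative covN ∞]
  {c c' : ℝ → LinBundle E M F N} {a b : ℝ}

/-- A parallel field along the new geodesic is compared with the parallel field along the old one
that has the same initial value; uniqueness makes them coincide on the interval. -/
lemma IsDevelopmentOn.congr (hab : a < b) (hc : IsDevelopmentOn covM covN c (Icc a b))
    (h : EqOn c c' (Icc a b)) : IsDevelopmentOn covM covN c' (Icc a b) := by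
  have h1 : EqOn (fun t ↦ (c t).1.1) (fun t ↦ (c' t).1.1) (Icc a b) := fun t ht ↦
    congrArg (fun p ↦ p.1.1) (h ht)
  have h2 : EqOn (fun t ↦ (c t).1.2) (fun t ↦ (c' t).1.2) (Icc a b) := fun t ht ↦
    congrArg (fun p ↦ p.1.2) (h ht)
  have hs := hc.source.congr hab h1
  refine ⟨hs, hc.target.congr hab h2, fun t ht ↦ ?_, fun V' hV' ↦ ?_⟩
  · have h3 := LinBundle.mk_apply_congr (h ht) (hc.source.mk_velocity_congr hab h1 ht)
    rw [← hc.velocity_eq t ht] at h3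
    exact eq_of_heq (TotalSpace.mk.inj
      ((hc.target.mk_velocity_congr hab h2 ht).symm.trans h3)).2
  · have ha : a ∈ Icc a b := left_mem_Icc.2 hab.le
    obtain ⟨v, hv⟩ := LinBundle.exists_mk_eq (h ha).symm (V' a)
    obtain ⟨V, hV, hVa⟩ := hc.source.exists_parallel_through hab ha v
    refine (hc.parallel V hV).congr hab hc.target fun t ht ↦ LinBundle.mk_apply_congr (h ht) ?_
    exact (hV.mk_eqOn hab hc.source hs hV' ha (hc.source.mk_velocity_congr hab h1 ha)
      (by rw [hVa]; exact hv.symm) t ht).2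

/-- Developments are determined by the initial point and the initial velocity. -/
lemma IsDevelopmentOn.eqOn_of_velocity (hab : a < b) (hc : IsDevelopmentOn covM covN c (Icc a b))
    (hc' : IsDevelopmentOn covM covN c' (Icc a b)) {t₀ : ℝ} (ht₀ : t₀ ∈ Icc a b)
    (h : c t₀ = c' t₀)
    (hv : (⟨(c t₀).1.1, velocity (fun t ↦ (c t).1.1) (Icc a b) t₀⟩ : TangentBundle 𝓘(ℝ, E) M) =
      ⟨(c' t₀).1.1, velocity (fun t ↦ (c' t).1.1) (Icc a b) t₀⟩) : EqOn c c' (Icc a b) := by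
  intro t ht
  refine LinBundle.ext fun v ↦ ?_
  obtain ⟨V, hV, hVt⟩ := hc.source.exists_parallel_through hab ht v
  obtain ⟨w, hw⟩ := LinBundle.exists_mk_eq h (V t₀)
  obtain ⟨V', hV', hVt'⟩ := hc'.source.exists_parallel_through hab ht₀ w
  rw [← hVt'] at hw
  refine ⟨V' t, ?_, ?_⟩
  · rw [← hVt]
    exact (hV.mk_eqOn hab hc.source hc'.source hV' ht₀ hv hw t ht).2
  · rw [← hVt]
    refine ((hc.parallel V hV).mk_eqOn hab hc.target hc'.target (hc'.parallel V' hV') ht₀ ?_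
      (LinBundle.mk_apply_congr h hw) t ht).2
    rw [hc.velocity_eq t₀ ht₀, hc'.velocity_eq t₀ ht₀]
    exact LinBundle.mk_apply_congr h hv

lemma IsDevelopmentOn.eqOn (hab : a < b) (hc : IsDevelopmentOn covM covN c (Icc a b))
    (hc' : IsDevelopmentOn covM covN c' (Icc a b))
    (hγ : ∀ t ∈ Icc a b, (c t).1.1 = (c' t).1.1) {t₀ : ℝ} (ht₀ : t₀ ∈ Icc a b)
    (h : c t₀ = c' t₀) : EqOn c c' (Icc a b) :=
  hc.eqOn_of_velocity hab hc' ht₀ h (hc.source.mk_velocity_congr hab hγ ht₀)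

lemma IsDevelopmentOn.comp {d d' r : ℝ} {ρ : ℝ → ℝ} (hab : a < b) (hd : d < d')
    (hc : IsDevelopmentOn covM covN c (Icc a b))
    (hρ : ∀ t, HasDerivAt ρ r t) (hm : MapsTo ρ (Icc d d') (Icc a b)) :
    IsDevelopmentOn covM covN (fun t ↦ c (ρ t)) (Icc d d') := by
  have hs := hc.source.comp hab hd hρ hm
  refine ⟨hs, hc.target.comp hab hd hρ hm, fun t ht ↦ ?_, fun V' hV' ↦ ?_⟩
  · refine (hc.target.velocity_comp hd hρ hm ht).trans ?_
    rw [hc.velocity_eq _ (hm ht)]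
    exact (map_smul (c (ρ t)).2 r _).symm.trans
      (congrArg (c (ρ t)).2 (hc.source.velocity_comp hd hρ hm ht).symm)
  · have hdm : d ∈ Icc d d' := left_mem_Icc.2 hd.le
    obtain ⟨V, hV, hVa⟩ := hc.source.exists_parallel_through hab (hm hdm) (V' d)
    have h1 := (hV.comp hab hd hc.source hρ hm).eqOn hd hs hV' hdm hVa
    refine ((hc.parallel V hV).comp hab hd hc.target hρ hm).congr hd
      (hc.target.comp hab hd hρ hm) fun t ht ↦ ?_
    simp only [h1 t ht]

lemma IsDevelopmentOn.mono {d d' : ℝ} (hab : a < b) (hd : d < d')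
    (hc : IsDevelopmentOn covM covN c (Icc a b)) (h : Icc d d' ⊆ Icc a b) :
    IsDevelopmentOn covM covN c (Icc d d') :=
  hc.comp (ρ := id) hab hd (fun t ↦ hasDerivAt_id t) h

/-- Existence of the development along given geodesics. -/
lemma exists_isDevelopmentOn_of_velocity (hab : a < b) {γ : ℝ → M} {μ : ℝ → N}
    (hγ : IsGeodesicOn covM γ (Icc a b)) (hμ : IsGeodesicOn covN μ (Icc a b))
    (σ : TangentSpace 𝓘(ℝ, E) (γ a) →L[ℝ] TangentSpace 𝓘(ℝ, F) (μ a))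
    (hv : velocity μ (Icc a b) a = σ (velocity γ (Icc a b) a)) :
    ∃ T : (t : ℝ) → TangentSpace 𝓘(ℝ, E) (γ t) →L[ℝ] TangentSpace 𝓘(ℝ, F) (μ t),
      IsDevelopmentOn covM covN (fun t ↦ ⟨(γ t, μ t), T t⟩) (Icc a b) ∧ T a = σ := by
  have ha : a ∈ Icc a b := left_mem_Icc.2 hab.le
  obtain ⟨A, Θ, hA, hAΘ⟩ := hγ.exists_parallelFrame hab
  obtain ⟨B, Ψ, hB, hBΨ⟩ := hμ.exists_parallelFrame hab
  -- In terms of parallel frames of `γ` and `μ` this is the constant matrix of `σ`, so parallel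
  -- fields go to parallel fields.
  let T : (t : ℝ) → TangentSpace 𝓘(ℝ, E) (γ t) →L[ℝ] TangentSpace 𝓘(ℝ, F) (μ t) := fun t ↦
    B t ∘L Ψ a ∘L σ ∘L A a ∘L Θ t
  have hTpar : ∀ V, IsParallelOn covM γ V (Icc a b) →
      IsParallelOn covN μ (fun t ↦ T t (V t)) (Icc a b) := by
    intro V hV
    refine (hB (Ψ a (σ (V a)))).congr hab hμ fun t ht ↦ ?_
    have h1 : V t = A t (Θ a (V a)) :=
      hV.eqOn hab hγ (hA (Θ a (V a))) ha ((hAΘ a ha).2 _).symm t ht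
    have h2 : T t (V t) = B t (Ψ a (σ (V a))) := by
      rw [h1]
      change B t (Ψ a (σ (A a (Θ t (A t _))))) = _
      rw [(hAΘ t ht).1, (hAΘ a ha).2]
    rw [h2]
  have hTa : T a = σ := by
    refine ContinuousLinearMap.ext fun v ↦ ?_
    change B a (Ψ a (σ (A a (Θ a v)))) = _
    rw [(hAΘ a ha).2, (hBΨ a ha).2]
  refine ⟨T, ⟨hγ, hμ, ?_, hTpar⟩, hTa⟩
  -- The velocity of a geodesic is parallel, so `μ'` and `T γ'` are parallel fields along `μ` that
  -- agree at `a`.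
  refine (hμ.isParallelOn_velocity hab).eqOn hab hμ
    (hTpar _ (hγ.isParallelOn_velocity hab)) ha ?_
  rw [hTa]
  exact hv

/-- Existence of the development along a geodesic. -/
lemma exists_isDevelopmentOn (hN : GeodesicallyComplete covN) (hab : a < b) {γ : ℝ → M}
    (hγ : IsGeodesicOn covM γ (Icc a b)) {p : LinBundle E M F N} (hp : p.1.1 = γ a) :
    ∃ c, IsDevelopmentOn covM covN c (Icc a b) ∧ (∀ t, (c t).1.1 = γ t) ∧ c a = p := by
  obtain ⟨⟨x, y⟩, σ⟩ := p
  obtain rfl : x = γ a := hp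
  obtain ⟨μ, hμ, hμa⟩ := hN.exists_isGeodesicOn hab y (σ (velocity γ (Icc a b) a))
  obtain rfl : μ a = y := congrArg (fun p : TangentBundle 𝓘(ℝ, F) N ↦ p.1) hμa
  obtain ⟨T, hT, hTa⟩ := exists_isDevelopmentOn_of_velocity hab hγ hμ σ
    (eq_of_heq (TotalSpace.mk.inj hμa).2)
  exact ⟨_, hT, fun t ↦ rfl, by simp only [hTa]⟩

/-- Existence of the development along a geodesic with given final point. -/
lemma exists_isDevelopmentOn_right (hN : GeodesicallyComplete covN) (hab : a < b) {γ : ℝ → M}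
    (hγ : IsGeodesicOn covM γ (Icc a b)) {p : LinBundle E M F N} (hp : p.1.1 = γ b) :
    ∃ c, IsDevelopmentOn covM covN c (Icc a b) ∧ (∀ t, (c t).1.1 = γ t) ∧ c b = p := by
  -- Time reversal: develop along the reversed geodesic from its initial point and reverse the
  -- result.
  have hρ : ∀ t, HasDerivAt (fun t ↦ a + b - t) (-1) t := fun t ↦ by
    simpa using (hasDerivAt_id t).const_sub (a + b)
  have hm : MapsTo (fun t ↦ a + b - t) (Icc a b) (Icc a b) := fun t ht ↦
    ⟨by linarith [ht.2], by linarith [ht.1]⟩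
  obtain ⟨c, hc, h1, h2⟩ := exists_isDevelopmentOn hN hab (hγ.comp hab hab hρ hm) (p := p)
    (by simpa using hp)
  refine ⟨_, hc.comp hab hab hρ hm, fun t ↦ ?_, ?_⟩
  · rw [h1]
    simp
  · simpa using h2

/-! ### Developments and induced maps -/

lemma IsDevelopmentOn.isInducedByGeodesic {γ : ℝ → M} {μ : ℝ → N}
    {T : (t : ℝ) → TangentSpace 𝓘(ℝ, E) (γ t) →L[ℝ] TangentSpace 𝓘(ℝ, F) (μ t)} (hab : a < b)
    (hc : IsDevelopmentOn covM covN (fun t ↦ ⟨(γ t, μ t), T t⟩) (Icc a b)) :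
    IsInducedByGeodesic covM covN γ μ a b (T a) (T b) := by
  have ha : a ∈ Icc a b := left_mem_Icc.2 hab.le
  have hb : b ∈ Icc a b := right_mem_Icc.2 hab.le
  have hγ : IsGeodesicOn covM γ (Icc a b) := hc.source
  have hμ : IsGeodesicOn covN μ (Icc a b) := hc.target
  obtain ⟨A, Θ, hA, hAΘ⟩ := hγ.exists_parallelFrame hab
  obtain ⟨B, Ψ, hB, hBΨ⟩ := hμ.exists_parallelFrame hab
  refine ⟨hab, hγ, hμ, hc.velocity_eq a ha, A a ∘L Θ b, B b ∘L Ψ a,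
    fun v ↦ ⟨fun t ↦ A t (Θ b v), hA _, (hAΘ b hb).2 v, rfl⟩,
    fun v ↦ ⟨fun t ↦ B t (Ψ a v), hB _, (hBΨ a ha).2 v, rfl⟩, ?_⟩
  refine ContinuousLinearMap.ext fun v ↦ ?_
  have h := (hc.parallel _ (hA (Θ b v))).eqOn hab hμ (hB (Ψ a (T a (A a (Θ b v))))) ha
    ((hBΨ a ha).2 _).symm b hb
  change T b (A b (Θ b v)) = _ at h
  rw [(hAΘ b hb).2] at h
  exact h

/-- Interpolates between `σ` and `τ`: the development starting from `σ` ends at `τ`, because it maps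
the parallel field defining `P` to the one defining `Q`. -/
lemma IsInducedByGeodesic.exists_isDevelopmentOn {γ : ℝ → M} {μ : ℝ → N}
    {σ : TangentSpace 𝓘(ℝ, E) (γ a) →L[ℝ] TangentSpace 𝓘(ℝ, F) (μ a)}
    {τ : TangentSpace 𝓘(ℝ, E) (γ b) →L[ℝ] TangentSpace 𝓘(ℝ, F) (μ b)}
    (h : IsInducedByGeodesic covM covN γ μ a b σ τ) :
    ∃ T : (t : ℝ) → TangentSpace 𝓘(ℝ, E) (γ t) →L[ℝ] TangentSpace 𝓘(ℝ, F) (μ t),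
      IsDevelopmentOn covM covN (fun t ↦ ⟨(γ t, μ t), T t⟩) (Icc a b) ∧ T a = σ ∧ T b = τ := by
  obtain ⟨hab, hγ, hμ, hv, P, Q, hP, hQ, rfl⟩ := h
  have ha : a ∈ Icc a b := left_mem_Icc.2 hab.le
  have hb : b ∈ Icc a b := right_mem_Icc.2 hab.le
  obtain ⟨T, hT, hTa⟩ := exists_isDevelopmentOn_of_velocity hab hγ hμ σ hv
  refine ⟨T, hT, hTa, ContinuousLinearMap.ext fun v ↦ ?_⟩
  obtain ⟨V, hV, hVb, hVa⟩ := hP v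
  obtain ⟨W, hW, hWa, hWb⟩ := hQ (σ (P v))
  have h := (hT.parallel V hV).eqOn hab hμ hW ha (by
    change T a (V a) = _
    rw [hTa, hVa, hWa]) b hb
  change T b (V b) = _ at h
  rw [hVb, hWb] at h
  exact h

/-! ### Developments in charts -/

/-- A curve in `Lin(TM, TN)` satisfying the equations of developments in charts. -/
lemma isDevelopmentOn_of_chart (hab : a < b) {γ : ℝ → M} {μ : ℝ → N}
    {T : (t : ℝ) → TangentSpace 𝓘(ℝ, E) (γ t) →L[ℝ] TangentSpace 𝓘(ℝ, F) (μ t)}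
    (hγ : IsGeodesicOn covM γ (Icc a b)) (hμ : ContinuousOn μ (Icc a b))
    (h : ∀ t ∈ Icc a b, ∃ (x₀ : M) (y₀ : N) (s : ℝ → E →L[ℝ] F),
      γ t ∈ (chartAt E x₀).source ∧ μ t ∈ (chartAt F y₀).source ∧
      ∀ᶠ r in 𝓝[Icc a b] t,
        (∀ v, toCoord y₀ (μ r) (T r v) = s r (toCoord x₀ (γ r) v)) ∧
        HasDerivWithinAt (fun r ↦ chartAt F y₀ (μ r))
          (s r (toCoord x₀ (γ r) (velocity γ (Icc a b) r))) (Icc a b) r ∧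
        HasDerivWithinAt s (parallelDeriv (christoffel covM x₀) (christoffel covN y₀)
          (chartAt E x₀ (γ r)) (chartAt F y₀ (μ r)) (s r)
          (toCoord x₀ (γ r) (velocity γ (Icc a b) r))
          (s r (toCoord x₀ (γ r) (velocity γ (Icc a b) r)))) (Icc a b) r) :
    IsDevelopmentOn covM covN (fun t ↦ ⟨(γ t, μ t), T t⟩) (Icc a b) := by
  have hS := uniqueDiffOn_Icc hab
  -- Differentiating S w, the terms S Γ(w) w coming from S' and from w' cancel, and the geodesic
  -- equation of the target remains.
  have hμg : IsGeodesicOn covN μ (Icc a b) := by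
    refine isGeodesicOn_of_chart hS hμ fun t ht ↦ ?_
    obtain ⟨x₀, y₀, s, hx, hy, hs⟩ := h t ht
    refine ⟨y₀, fun r ↦ s r (toCoord x₀ (γ r) (velocity γ (Icc a b) r)), hy, ?_⟩
    filter_upwards [hs, self_mem_nhdsWithin, (hγ.continuousOn t ht).eventually_mem
      ((chartAt E x₀).open_source.mem_nhds hx)] with r hr hrS hrx
    refine ⟨hr.2.1, (hr.2.2.clm_apply (hγ.hasDerivWithinAt_velocity hS hrS hrx)).congr_deriv ?_⟩
    simp only [parallelDeriv, sub_apply, ContinuousLinearMap.comp_apply, map_neg]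
    abel
  have hvel : ∀ t ∈ Icc a b, ∀ (x₀ : M) (y₀ : N) (s : E →L[ℝ] F), μ t ∈ (chartAt F y₀).source →
      HasDerivWithinAt (fun r ↦ chartAt F y₀ (μ r))
          (s (toCoord x₀ (γ t) (velocity γ (Icc a b) t))) (Icc a b) t →
      toCoord y₀ (μ t) (velocity μ (Icc a b) t) = s (toCoord x₀ (γ t) (velocity γ (Icc a b) t)) :=
    fun t ht x₀ y₀ s hy hd ↦ toCoord_velocity (hS t ht) (hμ t ht) hy hd
  refine ⟨hγ, hμg, fun t ht ↦ ?_, fun V hV ↦ ?_⟩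
  · obtain ⟨x₀, y₀, s, hx, hy, hs⟩ := h t ht
    have hs' := hs.self_of_nhdsWithin ht
    apply toCoord_injective hy
    exact (hvel t ht x₀ y₀ _ hy hs'.2.1).trans (hs'.1 _).symm
  · refine isParallelOn_of_chart hμg hS fun t ht ↦ ?_
    obtain ⟨x₀, y₀, s, hx, hy, hs⟩ := h t ht
    refine ⟨y₀, hy, ?_⟩
    have hs2 : ∀ᶠ r in 𝓝[Icc a b] t, ∀ᶠ r' in 𝓝[Icc a b] r,
        ∀ v, toCoord y₀ (μ r') (T r' v) = s r' (toCoord x₀ (γ r') v) :=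
      eventually_eventually_nhdsWithin.2 (hs.mono fun r hr ↦ hr.1)
    filter_upwards [hs, hs2, self_mem_nhdsWithin, (hγ.continuousOn t ht).eventually_mem
      ((chartAt E x₀).open_source.mem_nhds hx), (hμ t ht).eventually_mem
      ((chartAt F y₀).open_source.mem_nhds hy)] with r hr hr2 hrS hrx hry
    have h1 := hr.2.2.clm_apply (hV.hasDerivWithinAt hγ hS hrS hrx)
    have h2 : toCoord y₀ (μ r) (T r (V r)) = s r (toCoord x₀ (γ r) (V r)) := hr.1 _
    have h3 := hvel r hrS x₀ y₀ (s r) hry hr.2.1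
    refine (h1.congr_of_eventuallyEq (hr2.mono fun r' hr' ↦ hr' _) h2).congr_deriv ?_
    rw [h3]
    refine Eq.trans ?_ (congrArg (fun z ↦ -christoffel covN y₀ (chartAt F y₀ (μ r))
      (s r (toCoord x₀ (γ r) (velocity γ (Icc a b) r))) z) h2.symm)
    simp only [parallelDeriv, sub_apply, ContinuousLinearMap.comp_apply, map_neg]
    abel

end InducedCurves

/-! ### Piecewise developments and reachable points -/

section Developments

variable {E : Type*} [NormedAddCommGroup E] [NormedSpace ℝ E]
  {M : Type*} [TopologicalSpace M] [ChartedSpace E M] [IsManifold 𝓘(ℝ, E) ∞ M]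
  {F : Type*} [NormedAddCommGroup F] [NormedSpace ℝ F]
  {N : Type*} [TopologicalSpace N] [ChartedSpace F N] [IsManifold 𝓘(ℝ, F) ∞ N]

/-- Concatenations of finitely many developments. -/
inductive IsPiecewiseDevelopment (covM : TangentConnection E M) (covN : TangentConnection F N)
    (c : ℝ → LinBundle E M F N) (a : ℝ) : ℝ → Prop
  | single {b : ℝ} (hab : a < b) (hc : IsDevelopmentOn covM covN c (Icc a b)) :
      IsPiecewiseDevelopment covM covN c a b
  | append {b d : ℝ} (h : IsPiecewiseDevelopment covM covN c a b) (hbd : b < d)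
      (hc : IsDevelopmentOn covM covN c (Icc b d)) : IsPiecewiseDevelopment covM covN c a d

/-- The final points of piecewise developments starting at `p₀`. -/
def Reachable (covM : TangentConnection E M) (covN : TangentConnection F N)
    (p₀ p : LinBundle E M F N) : Prop :=
  ∃ c a b, IsPiecewiseDevelopment covM covN c a b ∧ c a = p₀ ∧ c b = p

variable {covM : TangentConnection E M} {covN : TangentConnection F N}
  {c c' : ℝ → LinBundle E M F N} {a b : ℝ} {p₀ p : LinBundle E M F N}

lemma IsPiecewiseDevelopment.lt (h : IsPiecewiseDevelopment covM covN c a b) : a < b := by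
  induction h with
  | single hab _ => exact hab
  | append _ hbd _ ih => exact ih.trans hbd

lemma IsPiecewiseDevelopment.isPiecewiseGeodesic (h : IsPiecewiseDevelopment covM covN c a b) :
    IsPiecewiseGeodesic covM (fun t ↦ (c t).1.1) a b := by
  induction h with
  | single hab hc => exact .single hab hc.source
  | append _ hbd hc ih => exact .append ih hbd hc.source

variable [FiniteDimensional ℝ E] [FiniteDimensional ℝ F] [T2Space M] [T2Space N]
  [CovariantDerivative.ContMDiffCovariantDerivative covM ∞]
  [CovariantDerivative.ContMDiffCovariantDerivative covN ∞]

lemma IsPiecewiseDevelopment.congr (h : IsPiecewiseDevelopment covM covN c a b)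
    (hcc' : EqOn c c' (Icc a b)) : IsPiecewiseDevelopment covM covN c' a b := by
  induction h with
  | single hab hc => exact .single hab (hc.congr hab hcc')
  | append h hbd hc ih =>
    exact .append (ih (hcc'.mono (Icc_subset_Icc_right hbd.le))) hbd
      (hc.congr hbd (hcc'.mono (Icc_subset_Icc_left h.lt.le)))

lemma IsPiecewiseDevelopment.isInducedFrom {γ : ℝ → M} {μ : ℝ → N}
    {T : (t : ℝ) → TangentSpace 𝓘(ℝ, E) (γ t) →L[ℝ] TangentSpace 𝓘(ℝ, F) (μ t)}
    (h : IsPiecewiseDevelopment covM covN (fun t ↦ ⟨(γ t, μ t), T t⟩) a b) :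
    IsInducedFrom covM covN γ μ a (T a) b (T b) := by
  induction h with
  | single hab hc => exact .single (hc.isInducedByGeodesic hab)
  | append _ hbd hc ih => exact .append ih (hc.isInducedByGeodesic hbd)

/-- The interpolations of the pieces fit together because the map induced by one piece is the
initial map of the next. -/
lemma IsInducedFrom.exists_isPiecewiseDevelopment {γ : ℝ → M} {μ : ℝ → N}
    {σ : TangentSpace 𝓘(ℝ, E) (γ a) →L[ℝ] TangentSpace 𝓘(ℝ, F) (μ a)}
    {τ : TangentSpace 𝓘(ℝ, E) (γ b) →L[ℝ] TangentSpace 𝓘(ℝ, F) (μ b)}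
    (h : IsInducedFrom covM covN γ μ a σ b τ) :
    ∃ T : (t : ℝ) → TangentSpace 𝓘(ℝ, E) (γ t) →L[ℝ] TangentSpace 𝓘(ℝ, F) (μ t),
      IsPiecewiseDevelopment covM covN (fun t ↦ ⟨(γ t, μ t), T t⟩) a b ∧ T a = σ ∧ T b = τ := by
  induction h with
  | single h =>
    obtain ⟨T, hT, h1, h2⟩ := h.exists_isDevelopmentOn
    exact ⟨T, .single h.lt hT, h1, h2⟩
  | append h h' ih =>
    rename_i b d τ ρ
    obtain ⟨T, hT, rfl, rfl⟩ := ih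
    obtain ⟨T', hT', h1, rfl⟩ := h'.exists_isDevelopmentOn
    have hbd := h'.lt
    refine ⟨fun t ↦ if t ≤ b then T t else T' t, .append (hT.congr fun t ht ↦ ?_) hbd
      (hT'.congr hbd fun t ht ↦ ?_), ?_, ?_⟩
    · simp [ht.2]
    · rcases ht.1.eq_or_lt with rfl | hlt
      · simp [h1]
      · simp [hlt]
    · simp [hT.lt.le]
    · simp [hbd]

lemma Reachable.step (hp : Reachable covM covN p₀ p) {d d' : ℝ} (hd : d < d')
    (hc' : IsDevelopmentOn covM covN c' (Icc d d')) (h : c' d = p) :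
    Reachable covM covN p₀ (c' d') := by
  obtain ⟨c, a, b, hc, rfl, rfl⟩ := hp
  have hab := hc.lt
  have hρ : ∀ t, HasDerivAt (fun t ↦ t - b + d) 1 t := fun t ↦
    ((hasDerivAt_id t).sub_const b).add_const d
  have hm : MapsTo (fun t ↦ t - b + d) (Icc b (b + (d' - d))) (Icc d d') := fun t ht ↦
    ⟨by linarith [ht.1], by linarith [ht.2]⟩
  have hb : b < b + (d' - d) := by linarith
  refine ⟨fun t ↦ if t ≤ b then c t else c' (t - b + d), a, b + (d' - d),
    .append (hc.congr fun t ht ↦ ?_) hb ((hc'.comp hd hb hρ hm).congr hb fun t ht ↦ ?_), ?_, ?_⟩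
  · simp [ht.2]
  · rcases ht.1.eq_or_lt with rfl | hlt
    · simp [h]
    · simp [hlt]
  · simp [hab.le]
  · simp [hd]

/-- Pieces have positive length, so a stationary development is needed: any development starting at
`p₀` is composed with the constant time 0. -/
lemma Reachable.refl (hN : GeodesicallyComplete covN) (p₀ : LinBundle E M F N) :
    Reachable covM covN p₀ p₀ := by
  obtain ⟨c, hc, -, hc0⟩ := exists_isDevelopmentOn (covM := covM) hN zero_lt_one
    (isGeodesicOn_const zero_lt_one p₀.1.1) (p := p₀) rfl
  exact ⟨fun _ ↦ c 0, 0, 1, .single zero_lt_one (hc.comp (ρ := fun _ ↦ 0) zero_lt_one zero_lt_one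
    (fun t ↦ hasDerivAt_const t 0) fun t _ ↦ ⟨le_rfl, zero_le_one⟩), hc0, hc0⟩

/-- The bridge that turns the hypothesis on induced maps into a property of all reachable points. -/
lemma Reachable.exists_isInduced {x₀ : M} {y₀ : N}
    {σ₀ : TangentSpace 𝓘(ℝ, E) x₀ →L[ℝ] TangentSpace 𝓘(ℝ, F) y₀}
    (hp : Reachable covM covN ⟨(x₀, y₀), σ₀⟩ p) :
    ∃ (γ : ℝ → M) (μ : ℝ → N) (a b : ℝ)
      (σ : TangentSpace 𝓘(ℝ, E) (γ b) →L[ℝ] TangentSpace 𝓘(ℝ, F) (μ b)),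
      IsPiecewiseGeodesic covM γ a b ∧ γ a = x₀ ∧ IsInduced covM covN σ₀ γ a b μ σ ∧
      p = ⟨(γ b, μ b), σ⟩ := by
  obtain ⟨c, a, b, hc, h, rfl⟩ := hp
  exact ⟨fun t ↦ (c t).1.1, fun t ↦ (c t).1.2, a, b, (c b).2, hc.isPiecewiseGeodesic,
    congrArg (fun p ↦ p.1.1) h, ⟨(c a).2, h, hc.isInducedFrom (T := fun t ↦ (c t).2)⟩, rfl⟩

end Developments

/-! ### Affine maps as solutions of a total differential system -/

section AffineMaps

section Derivative

variable {X Z : Type*} [NormedAddCommGroup X] [NormedSpace ℝ X]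
  [NormedAddCommGroup Z] [NormedSpace ℝ Z]

/-- Solutions of a smooth total differential equation are smooth. -/
lemma contDiffOn_of_hasFDerivAt {f : X → Z} {G : X × Z → X →L[ℝ] Z} {U : Set X} {O : Set (X × Z)}
    (hU : IsOpen U) (hG : ContDiffOn ℝ ∞ G O) (hO : ∀ x ∈ U, (x, f x) ∈ O)
    (hf : ∀ x ∈ U, HasFDerivAt f (G (x, f x)) x) : ContDiffOn ℝ ∞ f U := by
  rw [contDiffOn_infty]
  intro n
  induction n with
  | zero => exact contDiffOn_zero.2 fun t ht ↦ (hf t ht).continuousAt.continuousWithinAt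
  | succ n ih =>
    push_cast
    rw [contDiffOn_succ_iff_fderiv_of_isOpen hU]
    refine ⟨fun t ht ↦ (hf t ht).differentiableAt.differentiableWithinAt, by simp, ?_⟩
    refine ContDiffOn.congr ((hG.of_le (by exact_mod_cast le_top)).comp
      (contDiffOn_id.prodMk ih) hO) ?_
    intro t ht
    exact (hf t ht).fderiv

end Derivative

variable {E : Type*} [NormedAddCommGroup E] [NormedSpace ℝ E]
  {M : Type*} [TopologicalSpace M] [ChartedSpace E M] [IsManifold 𝓘(ℝ, E) ∞ M]
  {F : Type*} [NormedAddCommGroup F] [NormedSpace ℝ F]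
  {N : Type*} [TopologicalSpace N] [ChartedSpace F N] [IsManifold 𝓘(ℝ, F) ∞ N]

/-- Continuity of `f` comes for free: near `z` its values stay in a single chart, whose inverse
recovers `f` from its coordinate expression. -/
lemma hasMFDerivAt_of_charts {f : M → N} {x₀ z : M} {y₀ : N} (hz : z ∈ (chartAt E x₀).source)
    (hf : ∀ᶠ z' in 𝓝 z, f z' ∈ (chartAt F y₀).source) {L : E →L[ℝ] F}
    (h : HasFDerivAt (fun e ↦ chartAt F y₀ (f ((chartAt E x₀).symm e))) L (chartAt E x₀ z)) :
    HasMFDerivAt 𝓘(ℝ, E) 𝓘(ℝ, F) f z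
      ((ofCoord y₀ (f z) ∘L L) ∘L (toCoord (E := E) x₀ z)) := by
  have h1 : HasMFDerivAt 𝓘(ℝ, E) 𝓘(ℝ, F) (chartAt F y₀ ∘ f) z (L ∘L toCoord (E := E) x₀ z) := by
    refine (h.hasMFDerivAt.comp z (hasMFDerivAt_chart hz)).congr_of_eventuallyEq ?_
    filter_upwards [(chartAt E x₀).open_source.mem_nhds hz] with q hq
    simp [(chartAt E x₀).left_inv hq]
  have hfz : f z ∈ (chartAt F y₀).source := hf.self_of_nhds
  have hc : ContinuousAt f z := by
    have h2 : ContinuousAt ((chartAt F y₀).symm ∘ (chartAt F y₀ ∘ f)) z :=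
      ContinuousAt.comp ((chartAt F y₀).continuousAt_symm ((chartAt F y₀).map_source hfz))
        h1.continuousAt
    refine h2.congr ?_
    filter_upwards [hf] with q hq
    simp [(chartAt F y₀).left_inv hq]
  exact hasMFDerivWithinAt_univ.1 (hasMFDerivWithinAt_of_chart (E := F) hc.continuousWithinAt hfz
    (hasMFDerivWithinAt_univ.2 h1))

lemma toCoord_mfderiv {f : M → N} {x₀ z : M} {y₀ : N} (hz : z ∈ (chartAt E x₀).source)
    (hf : ∀ᶠ z' in 𝓝 z, f z' ∈ (chartAt F y₀).source) {L : E →L[ℝ] F}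
    (h : HasFDerivAt (fun e ↦ chartAt F y₀ (f ((chartAt E x₀).symm e))) L (chartAt E x₀ z))
    (v : TangentSpace 𝓘(ℝ, E) z) :
    toCoord y₀ (f z) (mfderiv 𝓘(ℝ, E) 𝓘(ℝ, F) f z v) = L (toCoord x₀ z v) := by
  rw [(hasMFDerivAt_of_charts hz hf h).mfderiv]
  exact toCoord_ofCoord hf.self_of_nhds _

/-- The first order jet of a map. -/
def jet (f : M → N) (z : M) : LinBundle E M F N := ⟨(z, f z), mfderiv 𝓘(ℝ, E) 𝓘(ℝ, F) f z⟩

lemma linBundle_mk_eq {x x' x₀ : M} {y y' y₀ : N} (hx : x ∈ (chartAt E x₀).source)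
    (hy : y ∈ (chartAt F y₀).source)
    {σ : TangentSpace 𝓘(ℝ, E) x →L[ℝ] TangentSpace 𝓘(ℝ, F) y}
    {σ' : TangentSpace 𝓘(ℝ, E) x' →L[ℝ] TangentSpace 𝓘(ℝ, F) y'} (h1 : x = x') (h2 : y = y')
    (h : ∀ w : E, toCoord y₀ y (σ (ofCoord x₀ x w)) = toCoord y₀ y' (σ' (ofCoord x₀ x' w))) :
    (⟨(x, y), σ⟩ : LinBundle E M F N) = ⟨(x', y'), σ'⟩ := by
  subst h1 h2
  congr 1
  refine ContinuousLinearMap.ext fun v ↦ toCoord_injective hy ?_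
  have := h (toCoord x₀ x v)
  rwa [ofCoord_toCoord hx] at this

variable [FiniteDimensional ℝ E] [FiniteDimensional ℝ F]

/-- A map is affine near `z` if, in suitable charts, its derivative `S` satisfies `∇S = 0`. -/
def IsAffineAt (covM : TangentConnection E M) (covN : TangentConnection F N) (f : M → N)
    (z : M) : Prop :=
  ∃ (x₀ : M) (y₀ : N) (S : E → E →L[ℝ] F), z ∈ (chartAt E x₀).source ∧
    ∀ᶠ z' in 𝓝 z, f z' ∈ (chartAt F y₀).source ∧
      HasFDerivAt (fun e ↦ chartAt F y₀ (f ((chartAt E x₀).symm e))) (S (chartAt E x₀ z'))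
        (chartAt E x₀ z') ∧
      ∃ S' : E →L[ℝ] E →L[ℝ] F, HasFDerivAt S S' (chartAt E x₀ z') ∧
        ∀ d, S' d = parallelDeriv (christoffel covM x₀) (christoffel covN y₀) (chartAt E x₀ z')
          (chartAt F y₀ (f z')) (S (chartAt E x₀ z')) d (S (chartAt E x₀ z') d)

variable {covM : TangentConnection E M} {covN : TangentConnection F N} {f g : M → N} {z : M}

lemma IsAffineAt.eventually (h : IsAffineAt covM covN f z) :
    ∀ᶠ z' in 𝓝 z, IsAffineAt covM covN f z' := by
  obtain ⟨x₀, y₀, S, hz, h⟩ := h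
  filter_upwards [(chartAt E x₀).open_source.mem_nhds hz, eventually_eventually_nhds.2 h]
    with z' h1 h2 using ⟨x₀, y₀, S, h1, h2⟩

lemma IsAffineAt.congr (h : IsAffineAt covM covN f z) (hfg : f =ᶠ[𝓝 z] g) :
    IsAffineAt covM covN g z := by
  obtain ⟨x₀, y₀, S, hz, h⟩ := h
  refine ⟨x₀, y₀, S, hz, ?_⟩
  filter_upwards [h, eventually_eventually_nhds.2 hfg, (chartAt E x₀).open_source.mem_nhds hz]
    with z' h1 h2 h3
  rw [← h2.self_of_nhds]
  refine ⟨h1.1, h1.2.1.congr_of_eventuallyEq ?_, h1.2.2⟩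
  have hc : Tendsto (chartAt E x₀).symm (𝓝 (chartAt E x₀ z')) (𝓝 z') := by
    have := (chartAt E x₀).continuousAt_symm ((chartAt E x₀).map_source h3)
    rwa [ContinuousAt, (chartAt E x₀).left_inv h3] at this
  filter_upwards [hc.eventually h2] with e he
  rw [he]

/-- The right hand side of the equation `∇S = 0` as a linear map. -/
def parallelDerivL (Γ : E → E →L[ℝ] E →L[ℝ] E) (Γ' : F → F →L[ℝ] F →L[ℝ] F)
    (x : E) (y : F) (S : E →L[ℝ] F) : E →L[ℝ] E →L[ℝ] F :=
  (ContinuousLinearMap.compL ℝ E E F S) ∘L (Γ x) -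
    ((ContinuousLinearMap.compL ℝ E F F).flip S) ∘L (Γ' y ∘L S)

lemma parallelDerivL_apply (Γ : E → E →L[ℝ] E →L[ℝ] E) (Γ' : F → F →L[ℝ] F →L[ℝ] F)
    (x : E) (y : F) (S : E →L[ℝ] F) (d : E) :
    parallelDerivL Γ Γ' x y S d = parallelDeriv Γ Γ' x y S d (S d) := rfl

lemma contDiffOn_parallelDerivL {Γ : E → E →L[ℝ] E →L[ℝ] E} {Γ' : F → F →L[ℝ] F →L[ℝ] F}
    {Ω : Set E} {Ω' : Set F} (hΓ : ContDiffOn ℝ ∞ Γ Ω) (hΓ' : ContDiffOn ℝ ∞ Γ' Ω') :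
    ContDiffOn ℝ ∞ (fun z : E × F × (E →L[ℝ] F) ↦ parallelDerivL Γ Γ' z.1 z.2.1 z.2.2)
      (Ω ×ˢ Ω' ×ˢ univ) := by
  have h1 : ContDiffOn ℝ ∞ (fun z : E × F × (E →L[ℝ] F) ↦ Γ z.1) (Ω ×ˢ Ω' ×ˢ univ) :=
    hΓ.comp contDiff_fst.contDiffOn fun z hz ↦ hz.1
  have h2 : ContDiffOn ℝ ∞ (fun z : E × F × (E →L[ℝ] F) ↦ Γ' z.2.1) (Ω ×ˢ Ω' ×ˢ univ) :=
    hΓ'.comp (contDiff_fst.comp contDiff_snd).contDiffOn fun z hz ↦ hz.2.1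
  have h3 : ContDiffOn ℝ ∞ (fun z : E × F × (E →L[ℝ] F) ↦ z.2.2) (Ω ×ˢ Ω' ×ˢ univ) :=
    (contDiff_snd.comp contDiff_snd).contDiffOn
  have h4 : ContDiffOn ℝ ∞ (fun z : E × F × (E →L[ℝ] F) ↦
      ContinuousLinearMap.compL ℝ E E F z.2.2) (Ω ×ˢ Ω' ×ˢ univ) :=
    (ContinuousLinearMap.compL ℝ E E F).contDiff.comp_contDiffOn h3
  have h5 : ContDiffOn ℝ ∞ (fun z : E × F × (E →L[ℝ] F) ↦
      (ContinuousLinearMap.compL ℝ E F F).flip z.2.2) (Ω ×ˢ Ω' ×ˢ univ) :=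
    (ContinuousLinearMap.compL ℝ E F F).flip.contDiff.comp_contDiffOn h3
  exact (h4.clm_comp h1).sub (h5.clm_comp (h2.clm_comp h3))

variable [T2Space M] [T2Space N]
  [CovariantDerivative.ContMDiffCovariantDerivative covM ∞]
  [CovariantDerivative.ContMDiffCovariantDerivative covN ∞]

/-- Bootstrapping: in charts the pair (f, S) solves a total differential equation with smooth right
hand side, which gains one derivative at a time. -/
lemma IsAffineAt.contMDiffAt (h : IsAffineAt covM covN f z) :
    ContMDiffAt 𝓘(ℝ, E) 𝓘(ℝ, F) ∞ f z := by
  obtain ⟨x₀, y₀, S, hz, h⟩ := h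
  obtain ⟨W, hW, hWo, hzW⟩ := eventually_nhds_iff.1
    (h.and ((chartAt E x₀).open_source.mem_nhds hz))
  have hfz := (hW z hzW).1.1
  set U := (chartAt E x₀).target ∩ (chartAt E x₀).symm ⁻¹' W
  have hU : IsOpen U := (chartAt E x₀).isOpen_inter_preimage_symm hWo
  have hUW : ∀ e ∈ U, f ((chartAt E x₀).symm e) ∈ (chartAt F y₀).source ∧
      HasFDerivAt (fun e ↦ chartAt F y₀ (f ((chartAt E x₀).symm e))) (S e) e ∧
      HasFDerivAt S (parallelDerivL (christoffel covM x₀) (christoffel covN y₀) e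
        (chartAt F y₀ (f ((chartAt E x₀).symm e))) (S e)) e := by
    intro e he
    obtain ⟨⟨h1, h2, S', h3, h4⟩, -⟩ := hW _ he.2
    rw [(chartAt E x₀).right_inv he.1] at h2 h3 h4
    refine ⟨h1, h2, ?_⟩
    convert! h3 using 1
    ext d : 1
    rw [h4, parallelDerivL_apply]
  have h1 : ContDiffOn ℝ ∞ (fun e ↦ (chartAt F y₀ (f ((chartAt E x₀).symm e)), S e)) U := by
    refine contDiffOn_of_hasFDerivAt (O := (chartAt E x₀).target ×ˢ (chartAt F y₀).target ×ˢ univ)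
      (G := fun z ↦ z.2.2.prod
        (parallelDerivL (christoffel covM x₀) (christoffel covN y₀) z.1 z.2.1 z.2.2)) hU ?_
      (fun e he ↦ ⟨he.1, (chartAt F y₀).map_source (hUW e he).1, mem_univ _⟩)
      fun e he ↦ (hUW e he).2.1.prodMk (hUW e he).2.2
    have h3 : ContDiffOn ℝ ∞ (fun z : E × F × (E →L[ℝ] F) ↦ z.2.2)
        ((chartAt E x₀).target ×ˢ (chartAt F y₀).target ×ˢ univ) :=
      (contDiff_snd.comp contDiff_snd).contDiffOn
    exact (ContinuousLinearMap.prodₗᵢ (𝕜 := ℝ) (E := E) (F := F)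
      (G := E →L[ℝ] F) ℝ).toContinuousLinearEquiv.contDiff.comp_contDiffOn
      (h3.prodMk (contDiffOn_parallelDerivL (contDiffOn_christoffel covM x₀)
        (contDiffOn_christoffel covN y₀)))
  have h2 : ContDiffAt ℝ ∞ (fun e ↦ chartAt F y₀ (f ((chartAt E x₀).symm e)))
      (chartAt E x₀ z) := (h1.contDiffAt (hU.mem_nhds
      ⟨(chartAt E x₀).map_source hz, by simpa [(chartAt E x₀).left_inv hz] using hzW⟩)).fst
  have h3 : ContMDiffAt 𝓘(ℝ, E) 𝓘(ℝ, E) ∞ (chartAt E x₀) z :=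
    (contMDiffOn_chart (x := x₀)).contMDiffAt ((chartAt E x₀).open_source.mem_nhds hz)
  have h4 : ContMDiffAt 𝓘(ℝ, E) 𝓘(ℝ, F) ∞
      ((fun e ↦ chartAt F y₀ (f ((chartAt E x₀).symm e))) ∘ chartAt E x₀) z :=
    h2.contMDiffAt.comp z h3
  have h5 : ContMDiffAt 𝓘(ℝ, F) 𝓘(ℝ, F) ∞ (chartAt F y₀).symm
      (((fun e ↦ chartAt F y₀ (f ((chartAt E x₀).symm e))) ∘ chartAt E x₀) z) := by
    apply contMDiffAt_chart_symm
    simpa [(chartAt E x₀).left_inv hz] using (chartAt F y₀).map_source hfz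
  refine (h5.comp z h4).congr_of_eventuallyEq ?_
  filter_upwards [hWo.mem_nhds hzW] with z' hz'
  simp [(chartAt E x₀).left_inv (hW z' hz').2, (chartAt F y₀).left_inv (hW z' hz').1.1]

/-- A map that is affine in charts is affine. -/
lemma isAffineMap_of_isAffineAt (h : ∀ z, IsAffineAt covM covN f z) : IsAffineMap covM covN f := by
  refine ⟨fun z ↦ (h z).contMDiffAt, fun X hX z v ↦ ?_⟩
  obtain ⟨x₀, y₀, S, hz, h'⟩ := h z
  obtain ⟨hfz, hf, S', hS', hS'd⟩ := h'.self_of_nhds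
  have hXd : MDifferentiableAt 𝓘(ℝ, E) 𝓘(ℝ, E).tangent
      (fun z ↦ (⟨z, X z⟩ : TangentBundle 𝓘(ℝ, E) M)) z := (hX z).mdifferentiableAt (by simp)
  have hXd' := ((mdifferentiableAt_field_iff hz X).1 hXd).hasFDerivAt
  have hev := h'.and ((chartAt E x₀).open_source.mem_nhds hz)
  -- The formula for the derivative is needed on a neighbourhood, since the covariant derivative
  -- along `f` differentiates df ∘ X.
  have hmf : ∀ᶠ z' in 𝓝 z, ∀ v, toCoord y₀ (f z') (mfderiv 𝓘(ℝ, E) 𝓘(ℝ, F) f z' v) =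
      S (chartAt E x₀ z') (toCoord x₀ z' v) := by
    filter_upwards [eventually_eventually_nhds.2 hev] with z' hz'
    exact toCoord_mfderiv hz'.self_of_nhds.2 (hz'.mono fun _ h ↦ h.1.1) hz'.self_of_nhds.1.2.1
  have h1 : HasMFDerivAt 𝓘(ℝ, E) 𝓘(ℝ, F) (chartAt F y₀ ∘ f) z
      (show E →L[ℝ] F from S (chartAt E x₀ z) ∘L toCoord x₀ z) := by
    refine (hf.hasMFDerivAt.comp z (hasMFDerivAt_chart hz)).congr_of_eventuallyEq ?_
    filter_upwards [(chartAt E x₀).open_source.mem_nhds hz] with q hq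
    simp [(chartAt E x₀).left_inv hq]
  have h2 : HasMFDerivAt 𝓘(ℝ, E) 𝓘(ℝ, F)
      (fun q ↦ toCoord y₀ (f q) (mfderiv 𝓘(ℝ, E) 𝓘(ℝ, F) f q (X q))) z
      (show E →L[ℝ] F from (S (chartAt E x₀ z) ∘L fderiv ℝ (coordField x₀ X) (chartAt E x₀ z) +
        S'.flip (coordField x₀ X (chartAt E x₀ z))) ∘L toCoord x₀ z) := by
    refine ((hS'.clm_apply hXd').hasMFDerivAt.comp z
      (hasMFDerivAt_chart hz)).congr_of_eventuallyEq ?_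
    filter_upwards [hmf, (chartAt E x₀).open_source.mem_nhds hz] with q hq hq'
    rw [hq, Function.comp_apply, coordField_chart hq']
  have h3 := toCoord_covAlong covN (p := z) (f := f)
    (s := fun q ↦ mfderiv 𝓘(ℝ, E) 𝓘(ℝ, F) f q (X q)) (S := univ) hfz
    (uniqueMDiffWithinAt_univ 𝓘(ℝ, E)) (h z).contMDiffAt.continuousAt.continuousWithinAt
    (hasMFDerivWithinAt_univ.2 h1) (hasMFDerivWithinAt_univ.2 h2) v
  apply toCoord_injective hfz
  refine Eq.trans ?_ h3.symm
  have h4 : toCoord y₀ (f z) (mfderiv 𝓘(ℝ, E) 𝓘(ℝ, F) f z (X z)) =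
      S (chartAt E x₀ z) (toCoord x₀ z (X z)) := hmf.self_of_nhds _
  have h5 : toCoord y₀ (f z) (mfderiv 𝓘(ℝ, E) 𝓘(ℝ, F) f z (covM X z v)) =
      S (chartAt E x₀ z) (toCoord x₀ z (covM X z v)) := hmf.self_of_nhds _
  rw [h4]
  refine h5.trans ?_
  rw [toCoord_cov covM hz hXd v, coordField_chart hz]
  change _ = S (chartAt E x₀ z) (fderiv ℝ (coordField x₀ X) (chartAt E x₀ z) (toCoord x₀ z v)) +
    S' (toCoord x₀ z v) (toCoord x₀ z (X z)) + christoffel covN y₀ (chartAt F y₀ (f z))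
      (S (chartAt E x₀ z) (toCoord x₀ z v)) _
  rw [hS'd]
  simp only [parallelDeriv, sub_apply, ContinuousLinearMap.comp_apply, map_add]
  abel

/-- Affine maps send geodesics to developments. -/
lemma isDevelopmentOn_jet {γ : ℝ → M} {a b : ℝ} (hab : a < b)
    (hγ : IsGeodesicOn covM γ (Icc a b)) (h : ∀ t ∈ Icc a b, IsAffineAt covM covN f (γ t)) :
    IsDevelopmentOn covM covN (fun t ↦ jet f (γ t)) (Icc a b) := by
  refine isDevelopmentOn_of_chart (μ := f ∘ γ) hab hγ (fun t ht ↦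
    (h t ht).contMDiffAt.continuousAt.comp_continuousWithinAt (hγ.continuousOn t ht))
    fun t ht ↦ ?_
  obtain ⟨x₀, y₀, S, hz, h'⟩ := h t ht
  refine ⟨x₀, y₀, fun r ↦ S (chartAt E x₀ (γ r)), hz, h'.self_of_nhds.1, ?_⟩
  have hev := h'.and ((chartAt E x₀).open_source.mem_nhds hz)
  filter_upwards [(hγ.continuousOn t ht).eventually (eventually_eventually_nhds.2 hev),
    self_mem_nhdsWithin] with r hr hrS
  obtain ⟨⟨h1, h2, S', h3, h4⟩, h5⟩ := hr.self_of_nhds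
  have hd := hγ.hasDerivWithinAt_chart hrS h5
  refine ⟨toCoord_mfderiv h5 (hr.mono fun _ h ↦ h.1.1) h2, ?_, ?_⟩
  · refine (h2.comp_hasDerivWithinAt r hd).congr_of_eventuallyEq_of_mem ?_ hrS
    filter_upwards [(hγ.continuousOn r hrS).eventually hr] with r' hr'
    simp [(chartAt E x₀).left_inv hr'.2]
  · exact (h3.comp_hasDerivWithinAt r hd).congr_deriv (h4 _)

end AffineMaps

/-! ### Local existence of affine maps with given jet -/

section LocalExistence

variable {E : Type*} [NormedAddCommGroup E] [NormedSpace ℝ E] [FiniteDimensional ℝ E]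
  {M : Type*} [TopologicalSpace M] [ChartedSpace E M] [IsManifold 𝓘(ℝ, E) ∞ M] [T2Space M]
  {F : Type*} [NormedAddCommGroup F] [NormedSpace ℝ F] [FiniteDimensional ℝ F]
  {N : Type*} [TopologicalSpace N] [ChartedSpace F N] [IsManifold 𝓘(ℝ, F) ∞ N] [T2Space N]
  {covM : TangentConnection E M} {covN : TangentConnection F N}

/-- `p` relates the torsions and the curvatures. -/
def LinBundle.Relates (covM : TangentConnection E M) (covN : TangentConnection F N)
    (p : LinBundle E M F N) : Prop :=
  RelatesTorsion covM covN p.2 ∧ RelatesCurvature covM covN p.2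

variable [CovariantDerivative.ContMDiffCovariantDerivative covM ∞]
  [CovariantDerivative.ContMDiffCovariantDerivative covN ∞]

/-- The point of `Lin(TM, TN)` with given coordinates. -/
def ofCoordinates (x₀ : M) (y₀ : N) (x : E) (y : F) (s : E →L[ℝ] F) : LinBundle E M F N :=
  ⟨((chartAt E x₀).symm x, (chartAt F y₀).symm y),
    (ofCoord y₀ ((chartAt F y₀).symm y) ∘L s) ∘L toCoord x₀ ((chartAt E x₀).symm x)⟩

lemma toCoord_ofCoordinates {x₀ : M} {y₀ : N} {x : E} {y : F} {s : E →L[ℝ] F}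
    (hy : y ∈ (chartAt F y₀).target) (v : TangentSpace 𝓘(ℝ, E) ((chartAt E x₀).symm x)) :
    toCoord y₀ ((chartAt F y₀).symm y) ((ofCoordinates x₀ y₀ x y s).2 v) =
      s (toCoord x₀ ((chartAt E x₀).symm x) v) :=
  toCoord_ofCoord ((chartAt F y₀).map_target hy) _

lemma ofCoordinates_eq {x₀ : M} {y₀ : N} {p : LinBundle E M F N}
    (hx : p.1.1 ∈ (chartAt E x₀).source) (hy : p.1.2 ∈ (chartAt F y₀).source) {s : E →L[ℝ] F}
    (hs : ∀ w, s w = toCoord y₀ p.1.2 (p.2 (ofCoord x₀ p.1.1 w))) :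
    ofCoordinates x₀ y₀ (chartAt E x₀ p.1.1) (chartAt F y₀ p.1.2) s = p := by
  have hx' := (chartAt E x₀).left_inv hx
  have hy' := (chartAt F y₀).left_inv hy
  refine linBundle_mk_eq (x₀ := x₀) (y₀ := y₀) (by rwa [hx']) (by rwa [hy']) hx' hy' fun w ↦ ?_
  rw [← hs w]
  refine (toCoord_ofCoordinates ((chartAt F y₀).map_source hy) _).trans ?_
  rw [toCoord_ofCoord (by rwa [hx'])]

section Coordinates

variable {x x₀ : M} {y y₀ : N} {σ : TangentSpace 𝓘(ℝ, E) x →L[ℝ] TangentSpace 𝓘(ℝ, F) y}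
  {s : E →L[ℝ] F}

lemma RelatesTorsion.coordTorsion (h : RelatesTorsion covM covN σ)
    (hx : x ∈ (chartAt E x₀).source) (hy : y ∈ (chartAt F y₀).source)
    (hs : ∀ v, toCoord y₀ y (σ v) = s (toCoord x₀ x v)) (u v : E) :
    s (coordTorsion (christoffel covM x₀) (chartAt E x₀ x) u v) =
      coordTorsion (christoffel covN y₀) (chartAt F y₀ y) (s u) (s v) := by
  have h1 := congrArg (toCoord y₀ y) (h (ofCoord x₀ x u) (ofCoord x₀ x v))
  simpa only [toCoord_torsion covN hy, hs, toCoord_torsion covM hx, toCoord_ofCoord hx] using h1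

lemma RelatesCurvature.coordCurvature (h : RelatesCurvature covM covN σ)
    (hx : x ∈ (chartAt E x₀).source) (hy : y ∈ (chartAt F y₀).source)
    (hs : ∀ v, toCoord y₀ y (σ v) = s (toCoord x₀ x v)) (u v w : E) :
    s (coordCurvature (christoffel covM x₀) (chartAt E x₀ x) u v w) =
      coordCurvature (christoffel covN y₀) (chartAt F y₀ y) (s u) (s v) (s w) := by
  have h1 := congrArg (toCoord y₀ y) (h (ofCoord x₀ x u) (ofCoord x₀ x v) (ofCoord x₀ x w))
  simpa only [toCoord_curvature covN hy, hs, toCoord_curvature covM hx, toCoord_ofCoord hx]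
    using h1

end Coordinates

lemma LinBundle.Relates.coord {x₀ : M} {y₀ : N} {x : E} {y : F} {s : E →L[ℝ] F}
    (h : (ofCoordinates x₀ y₀ x y s).Relates covM covN) (hx : x ∈ (chartAt E x₀).target)
    (hy : y ∈ (chartAt F y₀).target) :
    (∀ u v, s (coordTorsion (christoffel covM x₀) x u v) =
      coordTorsion (christoffel covN y₀) y (s u) (s v)) ∧
    (∀ u v w, s (coordCurvature (christoffel covM x₀) x u v w) =
      coordCurvature (christoffel covN y₀) y (s u) (s v) (s w)) := by
  have hx' := (chartAt E x₀).map_target hx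
  have hy' := (chartAt F y₀).map_target hy
  have h1 := RelatesTorsion.coordTorsion h.1 hx' hy' (toCoord_ofCoordinates hy)
  have h2 := RelatesCurvature.coordCurvature h.2 hx' hy' (toCoord_ofCoordinates hy)
  have hx₁ : chartAt E x₀ (ofCoordinates x₀ y₀ x y s).1.1 = x := (chartAt E x₀).right_inv hx
  have hy₁ : chartAt F y₀ (ofCoordinates x₀ y₀ x y s).1.2 = y := (chartAt F y₀).right_inv hy
  rw [hx₁, hy₁] at h1 h2
  exact ⟨h1, h2⟩

/-- Solutions of the equations of developments in coordinates are developments. -/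
lemma isDevelopmentOn_ofCoordinates {x₀ : M} {y₀ : N} {a b : ℝ} (hab : a < b)
    {q : ℝ → E × E × F × (E →L[ℝ] F)}
    (hq : ∀ t ∈ Icc a b, (q t).1 ∈ (chartAt E x₀).target ∧ (q t).2.2.1 ∈ (chartAt F y₀).target ∧
      HasDerivAt q (developmentField (christoffel covM x₀) (christoffel covN y₀) (q t)) t) :
    IsDevelopmentOn covM covN
      (fun t ↦ ofCoordinates x₀ y₀ (q t).1 (q t).2.2.1 (q t).2.2.2) (Icc a b) := by
  have hS := uniqueDiffOn_Icc hab
  have h1 : ∀ t ∈ Icc a b, HasDerivAt (fun t ↦ (q t).1) (q t).2.1 t := fun t ht ↦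
    hasDerivAt_fst (hq t ht).2.2
  have h2 : ∀ t ∈ Icc a b, HasDerivAt (fun t ↦ (q t).2.1)
      (-christoffel covM x₀ (q t).1 (q t).2.1 (q t).2.1) t := fun t ht ↦
    hasDerivAt_fst (hasDerivAt_snd (hq t ht).2.2)
  have h3 : ∀ t ∈ Icc a b, HasDerivAt (fun t ↦ (q t).2.2.1) ((q t).2.2.2 (q t).2.1) t :=
    fun t ht ↦ hasDerivAt_fst (hasDerivAt_snd (hasDerivAt_snd (hq t ht).2.2))
  have h4 : ∀ t ∈ Icc a b, HasDerivAt (fun t ↦ (q t).2.2.2)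
      (parallelDeriv (christoffel covM x₀) (christoffel covN y₀) (q t).1 (q t).2.2.1
        (q t).2.2.2 (q t).2.1 ((q t).2.2.2 (q t).2.1)) t :=
    fun t ht ↦ hasDerivAt_snd (hasDerivAt_snd (hasDerivAt_snd (hq t ht).2.2))
  have hx : ∀ t ∈ Icc a b, (chartAt E x₀).symm (q t).1 ∈ (chartAt E x₀).source :=
    fun t ht ↦ (chartAt E x₀).map_target (hq t ht).1
  have hy : ∀ t ∈ Icc a b, (chartAt F y₀).symm (q t).2.2.1 ∈ (chartAt F y₀).source :=
    fun t ht ↦ (chartAt F y₀).map_target (hq t ht).2.1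
  have hcγ : ContinuousOn (fun t ↦ (chartAt E x₀).symm (q t).1) (Icc a b) := fun t ht ↦
    (((chartAt E x₀).continuousAt_symm (hq t ht).1).comp
      (f := fun t ↦ (q t).1) (h1 t ht).continuousAt).continuousWithinAt
  have hcμ : ContinuousOn (fun t ↦ (chartAt F y₀).symm (q t).2.2.1) (Icc a b) := fun t ht ↦
    (((chartAt F y₀).continuousAt_symm (hq t ht).2.1).comp
      (f := fun t ↦ (q t).2.2.1) (h3 t ht).continuousAt).continuousWithinAt
  have hdγ : ∀ t ∈ Icc a b, HasDerivWithinAt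
      (fun t ↦ chartAt E x₀ ((chartAt E x₀).symm (q t).1)) (q t).2.1 (Icc a b) t := fun t ht ↦
    (h1 t ht).hasDerivWithinAt.congr_of_mem
      (fun r hr ↦ (chartAt E x₀).right_inv (hq r hr).1) ht
  have hdμ : ∀ t ∈ Icc a b, HasDerivWithinAt
      (fun t ↦ chartAt F y₀ ((chartAt F y₀).symm (q t).2.2.1)) ((q t).2.2.2 (q t).2.1)
      (Icc a b) t := fun t ht ↦
    (h3 t ht).hasDerivWithinAt.congr_of_mem
      (fun r hr ↦ (chartAt F y₀).right_inv (hq r hr).2.1) ht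
  have hγ : IsGeodesicOn covM (fun t ↦ (chartAt E x₀).symm (q t).1) (Icc a b) := by
    refine isGeodesicOn_of_chart hS hcγ fun t ht ↦ ⟨x₀, fun t ↦ (q t).2.1, hx t ht, ?_⟩
    filter_upwards [self_mem_nhdsWithin] with r hr
    rw [(chartAt E x₀).right_inv (hq r hr).1]
    exact ⟨hdγ r hr, (h2 r hr).hasDerivWithinAt⟩
  refine isDevelopmentOn_of_chart hab hγ hcμ fun t ht ↦
    ⟨x₀, y₀, fun t ↦ (q t).2.2.2, hx t ht, hy t ht, ?_⟩
  filter_upwards [self_mem_nhdsWithin] with r hr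
  have hv : toCoord x₀ ((chartAt E x₀).symm (q r).1) (velocity (E := E)
      (fun t ↦ (chartAt E x₀).symm (q t).1) (Icc a b) r) = (q r).2.1 :=
    toCoord_velocity (hS r hr) (hcγ r hr) (hx r hr) (hdγ r hr)
  rw [hv, (chartAt E x₀).right_inv (hq r hr).1, (chartAt F y₀).right_inv (hq r hr).2.1]
  exact ⟨fun v ↦ toCoord_ofCoordinates (hq r hr).2.1 v, hdμ r hr, (h4 r hr).hasDerivWithinAt⟩

/-- The development along the geodesics issuing from a point. If all these developments relate
the torsions and the curvatures, their final points are the jets of an affine map. -/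
theorem exists_radial (covM : TangentConnection E M)
    [CovariantDerivative.ContMDiffCovariantDerivative covM ∞] (covN : TangentConnection F N)
    [CovariantDerivative.ContMDiffCovariantDerivative covN ∞] (p : LinBundle E M F N) :
    ∃ (B : Set E) (V : Set M) (ν : M → E) (T : ℝ) (c : E → ℝ → LinBundle E M F N),
      IsOpen V ∧ p.1.1 ∈ V ∧ 0 < T ∧ MapsTo ν V B ∧
      (∀ v ∈ B, IsDevelopmentOn covM covN (c v) (Icc 0 T) ∧ c v 0 = p) ∧
      (∀ z ∈ V, (c (ν z) T).1.1 = z) ∧ (∀ t ∈ Icc 0 T, c (ν p.1.1) t = p) ∧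
      ContinuousOn (fun z : M × ℝ ↦ (c (ν z.1) z.2).1.1) (V ×ˢ Icc 0 T) ∧
      ((∀ v ∈ B, ∀ t ∈ Icc 0 T, (c v t).Relates covM covN) → ∀ z ∈ V,
        IsAffineAt covM covN (fun z ↦ (c (ν z) T).1.2) z ∧
        c (ν z) T = jet (fun z ↦ (c (ν z) T).1.2) z) := by
  obtain ⟨⟨x₀, y₀⟩, σ⟩ := p
  set O : Set (E × E × F × (E →L[ℝ] F)) :=
    {z | z.1 ∈ (chartAt E x₀).target ∧ z.2.2.1 ∈ (chartAt F y₀).target} with hOdef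
  have hO : IsOpen O := ((chartAt E x₀).open_target.preimage continuous_fst).inter
    ((chartAt F y₀).open_target.preimage
      (continuous_fst.comp (continuous_snd.comp continuous_snd)))
  have hx₀ := mem_chart_source E x₀
  have hy₀ := mem_chart_source F y₀
  set S₀ : E →L[ℝ] F := toCoord y₀ y₀ ∘L σ ∘L ofCoord x₀ x₀
  obtain ⟨q, r, T, e, hr, hT, hq0, hq, hqc, her, heq, hxe, he0, hqz, hrel⟩ :=
    exists_radialDevelopment (chartAt E x₀).open_target (contDiffOn_christoffel covM x₀)
      (chartAt F y₀).open_target (contDiffOn_christoffel covN y₀) hO (fun z hz ↦ hz)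
      (x₀ := chartAt E x₀ x₀) (y₀ := chartAt F y₀ y₀) (S₀ := S₀)
      ⟨(chartAt E x₀).map_source hx₀, (chartAt F y₀).map_source hy₀⟩
  have hT' : T ∈ Icc 0 T := ⟨hT.le, le_rfl⟩
  let c : E → ℝ → LinBundle E M F N := fun v t ↦
    ofCoordinates x₀ y₀ (q (v, t)).1 (q (v, t)).2.2.1 (q (v, t)).2.2.2
  have hcp : ofCoordinates x₀ y₀ (chartAt E x₀ x₀) (chartAt F y₀ y₀) S₀ = ⟨(x₀, y₀), σ⟩ :=
    ofCoordinates_eq (p := ⟨(x₀, y₀), σ⟩) hx₀ hy₀ fun w ↦ rfl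
  have hν : ∀ z ∈ (chartAt E x₀).source ∩ chartAt E x₀ ⁻¹' e.target,
      e.symm (chartAt E x₀ z) ∈ Metric.ball 0 r := fun z hz ↦ her (e.map_target hz.2)
  have heT : ∀ u ∈ e.target, (q (e.symm u, T)).1 = u := fun u hu ↦ by
    rw [← heq _ (e.map_target hu), e.right_inv hu]
  refine ⟨Metric.ball 0 r, (chartAt E x₀).source ∩ chartAt E x₀ ⁻¹' e.target,
    fun z ↦ e.symm (chartAt E x₀ z), T, c,
    (chartAt E x₀).isOpen_inter_preimage e.open_target, ⟨hx₀, hxe⟩, hT, hν,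
    fun v hv ↦ ⟨isDevelopmentOn_ofCoordinates (q := fun t ↦ q (v, t)) hT fun t ht ↦
      ⟨(hq v hv t ht).1.1, (hq v hv t ht).1.2, (hq v hv t ht).2⟩, ?_⟩,
    fun z hz ↦ ?_, fun t ht ↦ ?_, ?_, fun H z hz ↦ ?_⟩
  · simp only [c, hq0 v hv]
    exact hcp
  · change (chartAt E x₀).symm (q (e.symm (chartAt E x₀ z), T)).1 = z
    rw [heT _ hz.2, (chartAt E x₀).left_inv hz.1]
  · simp only [c, he0, hqz t ht]
    exact hcp
  · have h1 : ContinuousOn (fun z : M × ℝ ↦ (e.symm (chartAt E x₀ z.1), z.2))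
        (((chartAt E x₀).source ∩ chartAt E x₀ ⁻¹' e.target) ×ˢ Icc 0 T) := by
      refine ContinuousOn.prodMk ?_ continuousOn_snd
      refine e.continuousOn_symm.comp ((chartAt E x₀).continuousOn.comp continuousOn_fst ?_) ?_
      · exact fun z hz ↦ hz.1.1
      · exact fun z hz ↦ hz.1.2
    have h2 := hqc.comp h1 fun z hz ↦ ⟨hν _ hz.1, hz.2⟩
    exact (chartAt E x₀).continuousOn_symm.comp h2.fst fun z hz ↦
      (hq _ (hν _ hz.1) _ hz.2).1.1
  · have H' := hrel fun v hv t ht ↦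
      (H v hv t ht).coord (hq v hv t ht).1.1 (hq v hv t ht).1.2
    have hev : ∀ z ∈ (chartAt E x₀).source ∩ chartAt E x₀ ⁻¹' e.target,
        (c (e.symm (chartAt E x₀ z)) T).1.2 ∈ (chartAt F y₀).source ∧
        chartAt F y₀ (c (e.symm (chartAt E x₀ z)) T).1.2 =
          (q (e.symm (chartAt E x₀ z), T)).2.2.1 := fun z hz ↦
      ⟨(chartAt F y₀).map_target (hq _ (hν z hz) T hT').1.2,
        (chartAt F y₀).right_inv (hq _ (hν z hz) T hT').1.2⟩
    have hV := ((chartAt E x₀).isOpen_inter_preimage e.open_target).mem_nhds hz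
    have hd : ∀ u ∈ e.target, HasFDerivAt (fun u ↦ chartAt F y₀
        (c (e.symm (chartAt E x₀ ((chartAt E x₀).symm u))) T).1.2) (q (e.symm u, T)).2.2.2 u := by
      intro u hu
      refine (H' u hu).1.congr_of_eventuallyEq ?_
      filter_upwards [e.open_target.mem_nhds hu] with u' hu'
      have h1 : u' ∈ (chartAt E x₀).target := by
        rw [← heT u' hu']
        exact (hq _ (her (e.map_target hu')) T hT').1.1
      have h2 : (chartAt E x₀).symm u' ∈ (chartAt E x₀).source ∩ chartAt E x₀ ⁻¹' e.target :=
        ⟨(chartAt E x₀).map_target h1, by simpa [(chartAt E x₀).right_inv h1] using hu'⟩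
      rw [(hev _ h2).2, (chartAt E x₀).right_inv h1]
    refine ⟨⟨x₀, y₀, fun u ↦ (q (e.symm u, T)).2.2.2, hz.1, ?_⟩, ?_⟩
    · filter_upwards [hV] with z' hz'
      obtain ⟨S', h3, h4⟩ := (H' _ hz'.2).2
      refine ⟨(hev z' hz').1, hd _ hz'.2, S', h3, fun d ↦ ?_⟩
      rw [(hev z' hz').2]
      exact h4 d
    · have hmf := toCoord_mfderiv (y₀ := y₀) hz.1 (f := fun z ↦ (c (e.symm (chartAt E x₀ z)) T).1.2)
        (by filter_upwards [hV] with z' hz' using (hev z' hz').1) (hd _ hz.2)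
      have hx1 : (chartAt E x₀).symm (q (e.symm (chartAt E x₀ z), T)).1 = z := by
        rw [heT _ hz.2, (chartAt E x₀).left_inv hz.1]
      have hx2 : (chartAt E x₀).symm (q (e.symm (chartAt E x₀ z), T)).1 ∈
        (chartAt E x₀).source := by rw [hx1]; exact hz.1
      refine linBundle_mk_eq hx2 (hev z hz).1 hx1 rfl fun w ↦ ?_
      refine (toCoord_ofCoordinates (hq _ (hν z hz) T hT').1.2 _).trans ?_
      refine Eq.trans ?_ (hmf _).symm
      rw [toCoord_ofCoord hx2, toCoord_ofCoord hz.1]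

end LocalExistence

/-! ### The covering of M by reachable jets -/

section Globalization

section Covering

open unitInterval

/-- A separated local homeomorphism is a covering map if every point of the base has a
neighbourhood `V` with a contraction to this point along paths that can be lifted with given
initial or final points. -/
theorem _root_.IsLocalHomeomorph.isCoveringMap_of_lifts {L X : Type*} [TopologicalSpace L]
    [TopologicalSpace X] {p : L → X} (hp : IsLocalHomeomorph p) (sep : IsSeparatedMap p)
    (h : ∀ x : X, ∃ (V : Set X) (G : C(I × V, X)), IsOpen V ∧ x ∈ V ∧ (∀ z, G (0, z) = x) ∧
      (∀ z, G (1, z) = z) ∧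
      (∀ z, ∀ e, p e = x → ∃ Γ : C(I, L), (∀ t, p (Γ t) = G (t, z)) ∧ Γ 0 = e) ∧
      (∀ z : V, ∀ e, p e = z → ∃ Γ : C(I, L), (∀ t, p (Γ t) = G (t, z)) ∧ Γ 1 = e)) :
    IsCoveringMap p := by
  intro x
  obtain ⟨V, G, hV, hxV, hG0, hG1, h0, h1⟩ := h x
  -- On the fibre `p` is both constant and locally injective, so the fibre is discrete.
  have hdisc : DiscreteTopology (p ⁻¹' {x}) := by
    rw [discreteTopology_iff_locallyInjective x]
    have := hp.isLocallyInjective.comp_right (g := ((↑) : p ⁻¹' {x} → L))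
      continuous_subtype_val Subtype.val_injective
    exact (funext fun e : p ⁻¹' {x} ↦ e.2 : p ∘ ((↑) : p ⁻¹' {x} → L) = fun _ ↦ x) ▸ this
  choose Γ hΓ hΓ0 using fun a : V × p ⁻¹' {x} ↦ h0 a.1 a.2 a.2.2
  have huniq : ∀ (z : V) (Γ₁ Γ₂ : C(I, L)), (∀ t, p (Γ₁ t) = G (t, z)) →
      (∀ t, p (Γ₂ t) = G (t, z)) → ∀ t₀, Γ₁ t₀ = Γ₂ t₀ → ∀ t, Γ₁ t = Γ₂ t :=
    fun z Γ₁ Γ₂ h₁ h₂ t₀ h t ↦ congrFun (sep.eq_of_comp_eq hp.isLocallyInjective Γ₁.continuous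
      Γ₂.continuous (funext fun t ↦ (h₁ t).trans (h₂ t).symm) t₀ h) t
  -- The lifts are chosen independently; for a separated local homeomorphism, continuity in t and of
  -- the initial values implies joint continuity.
  have hcont : Continuous fun ta : I × (V × p ⁻¹' {x}) ↦ Γ ta.2 ta.1 := by
    refine hp.continuous_lift sep (G.comp ⟨fun ta : I × (V × p ⁻¹' {x}) ↦ (ta.1, ta.2.1),
      by fun_prop⟩) (funext fun ta ↦ hΓ ta.2 ta.1) ?_ fun a ↦ (Γ a).continuous
    simp only [hΓ0]
    fun_prop
  set Φ : V × p ⁻¹' {x} → L := fun a ↦ Γ a 1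
  have hΦ : Continuous Φ := hcont.comp (by fun_prop : Continuous fun a ↦ ((1 : I), a))
  have hpΦ : ∀ a, p (Φ a) = a.1 := fun a ↦ (hΓ a 1).trans (hG1 _)
  have hinj : Function.Injective Φ := by
    rintro ⟨z, e⟩ ⟨z', e'⟩ hzz
    obtain rfl : z = z' := Subtype.ext (by rw [← hpΦ (z, e), hzz, hpΦ])
    have := huniq z _ _ (hΓ (z, e)) (hΓ (z, e')) 1 hzz 0
    rw [hΓ0, hΓ0] at this
    exact Prod.ext rfl (Subtype.ext this)
  -- For each fibre element, the corresponding slice of `Φ` is a continuous section over `V` and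
  -- thus an open embedding; the image of an open set is a union of images under slices.
  have hopen : IsOpenMap Φ := by
    intro O hO
    have hemb : ∀ e, IsOpenEmbedding fun z ↦ Φ (z, e) := fun e ↦
      hp.isOpenEmbedding_of_comp (by
        rw [(funext fun z ↦ hpΦ (z, e) : (p ∘ fun z ↦ Φ (z, e)) = ((↑) : V → X))]
        exact hV.isOpenEmbedding_subtypeVal) (hΦ.comp (by fun_prop))
    have : Φ '' O = ⋃ e, (fun z ↦ Φ (z, e)) '' {z | (z, e) ∈ O} := by
      ext q
      simp only [mem_image, Prod.exists, mem_iUnion, mem_ofPred_eq]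
      exact exists_comm
    rw [this]
    exact isOpen_iUnion fun e ↦ (hemb e).isOpenMap _ (hO.preimage (by fun_prop))
  -- Surjectivity uses the lifts with given final point: transporting a point back to the fibre over
  -- `x` and forward again returns it.
  have hrange : range Φ = p ⁻¹' V := by
    ext q
    refine ⟨?_, fun hq ↦ ?_⟩
    · rintro ⟨a, rfl⟩
      rw [mem_preimage, hpΦ]
      exact a.1.2
    · obtain ⟨Γ', hΓ', hΓ1⟩ := h1 ⟨p q, hq⟩ q rfl
      have he : p (Γ' 0) = x := (hΓ' 0).trans (hG0 _)
      refine ⟨(⟨p q, hq⟩, ⟨Γ' 0, he⟩), ?_⟩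
      exact (huniq _ _ _ (hΓ _) hΓ' 0 (hΓ0 _) 1).trans hΓ1
  have hΦe : IsOpenEmbedding Φ := .of_continuous_injective_isOpenMap hΦ hinj hopen
  refine ⟨hdisc, V, hxV, hV, hV.preimage hp.continuous,
    ((hΦe.isEmbedding.toHomeomorph).trans (Homeomorph.setCongr hrange)).symm, fun q ↦ ?_⟩
  set a := ((hΦe.isEmbedding.toHomeomorph).trans (Homeomorph.setCongr hrange)).symm q with ha
  have : q = ((hΦe.isEmbedding.toHomeomorph).trans (Homeomorph.setCongr hrange)) a := by simp [ha]
  rw [← hpΦ a, this]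
  rfl

end Covering

variable {E : Type*} [NormedAddCommGroup E] [NormedSpace ℝ E] [FiniteDimensional ℝ E]
  {M : Type*} [TopologicalSpace M] [ChartedSpace E M] [IsManifold 𝓘(ℝ, E) ∞ M] [T2Space M]
  {F : Type*} [NormedAddCommGroup F] [NormedSpace ℝ F] [FiniteDimensional ℝ F]
  {N : Type*} [TopologicalSpace N] [ChartedSpace F N] [IsManifold 𝓘(ℝ, F) ∞ N] [T2Space N]
  {covM : TangentConnection E M} [CovariantDerivative.ContMDiffCovariantDerivative covM ∞]
  {covN : TangentConnection F N} [CovariantDerivative.ContMDiffCovariantDerivative covN ∞]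
  {f g : M → N} {p₀ p : LinBundle E M F N}

/-- Neighbourhoods with a contraction along geodesics. -/
lemma exists_normalNeighborhood (covM : TangentConnection E M)
    [CovariantDerivative.ContMDiffCovariantDerivative covM ∞] (x : M) :
    ∃ (V : Set M) (G : M → ℝ → M), IsOpen V ∧ x ∈ V ∧
      (∀ z ∈ V, IsGeodesicOn covM (G z) (Icc 0 1) ∧ G z 0 = x ∧ G z 1 = z) ∧
      (∀ t ∈ Icc 0 1, G x t = x) ∧
      ContinuousOn (fun z : M × ℝ ↦ G z.1 z.2) (V ×ˢ Icc 0 1) := by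
  -- The identity of the tangent space at `x` is developed from M to M. Only the radial geodesics
  -- are used, and time is then rescaled from [0, T] to [0, 1].
  obtain ⟨B, V, ν, T, c, hV, hxV, hT, hν, hc, hcT, hcx, hcont, -⟩ :=
    exists_radial covM covM (⟨(x, x), ContinuousLinearMap.id ℝ _⟩ : LinBundle E M E M)
  have hρ : ∀ t, HasDerivAt (fun t ↦ T * t) T t := fun t ↦ by
    simpa using (hasDerivAt_id t).const_mul T
  have hm : MapsTo (fun t ↦ T * t) (Icc 0 1) (Icc 0 T) := fun t ht ↦
    ⟨mul_nonneg hT.le ht.1, mul_le_of_le_one_right hT.le ht.2⟩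
  refine ⟨V, fun z t ↦ (c (ν z) (T * t)).1.1, hV, hxV, fun z hz ↦ ⟨?_, ?_, ?_⟩,
    fun t ht ↦ ?_, ?_⟩
  · exact ((hc _ (hν hz)).1.comp hT one_pos hρ hm).source
  · simp [(hc _ (hν hz)).2]
  · simp [hcT z hz]
  · exact congrArg (fun p ↦ p.1.1) (hcx _ (hm ht))
  · exact hcont.comp (f := fun z : M × ℝ ↦ (z.1, T * z.2)) (by fun_prop)
      fun z hz ↦ ⟨hz.1, hm hz.2⟩

/-- Two affine maps with the same first order jet at a point coincide near this point; if the jets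
are different, then they are different at all nearby points. -/
lemma IsAffineAt.eventually_jet_eq_iff {x : M} (hf : IsAffineAt covM covN f x)
    (hg : IsAffineAt covM covN g x) : ∀ᶠ z in 𝓝 x,
      ((jet f x : LinBundle E M F N) = jet g x ↔ (jet f z : LinBundle E M F N) = jet g z) := by
  obtain ⟨V, G, hV, hxV, hG, hGx, hGc⟩ := exists_normalNeighborhood covM x
  -- The radial geodesic to `x` itself is constant, so by compactness of [0, 1] those to nearby
  -- points stay where both maps are affine. Uniqueness of developments along them, from either end,
  -- gives the two implications.
  have h1 : ∀ᶠ z in 𝓝 x, ∀ t ∈ Icc (0 : ℝ) 1, t ∈ Icc (0 : ℝ) 1 →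
      IsAffineAt covM covN f (G z t) ∧ IsAffineAt covM covN g (G z t) := by
    refine isCompact_Icc.eventually_forall_of_forall_eventually fun t ht ↦ ?_
    have h2 : Tendsto (fun z : M × ℝ ↦ G z.1 z.2) (𝓝[V ×ˢ Icc 0 1] (x, t)) (𝓝 x) := by
      have := hGc (x, t) ⟨hxV, ht⟩
      rwa [ContinuousWithinAt, hGx t ht] at this
    have h3 := eventually_nhdsWithin_iff.1 (h2.eventually (hf.eventually.and hg.eventually))
    have h4 : ∀ᶠ z : M × ℝ in 𝓝 (x, t), z.1 ∈ V :=
      continuousAt_fst.eventually (hV.mem_nhds hxV)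
    filter_upwards [h3, h4] with z hz hzV hzt using hz ⟨hzV, hzt⟩
  filter_upwards [h1, hV.mem_nhds hxV] with z hz hzV
  obtain ⟨hγ, h0, h1⟩ := hG z hzV
  have hF := isDevelopmentOn_jet one_pos hγ fun t ht ↦ (hz t ht ht).1
  have hG := isDevelopmentOn_jet one_pos hγ fun t ht ↦ (hz t ht ht).2
  have hm0 : (0 : ℝ) ∈ Icc (0 : ℝ) 1 := ⟨le_rfl, zero_le_one⟩
  have hm1 : (1 : ℝ) ∈ Icc (0 : ℝ) 1 := ⟨zero_le_one, le_rfl⟩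
  constructor
  · intro h
    have := hF.eqOn one_pos hG (fun _ _ ↦ rfl) hm0 (by simp only [h0, h]) hm1
    simpa only [h1] using this
  · intro h
    have := hF.eqOn one_pos hG (fun _ _ ↦ rfl) hm1 (by simp only [h1, h]) hm0
    simpa only [h0] using this

/-- Existence of affine maps with given first order jet. -/
lemma Reachable.exists_isAffineAt
    (hrel : ∀ p, Reachable covM covN p₀ p → p.Relates covM covN)
    (hp : Reachable covM covN p₀ p) : ∃ f : M → N, IsAffineAt covM covN f p.1.1 ∧
      jet f p.1.1 = p ∧ ∀ᶠ z in 𝓝 p.1.1, Reachable covM covN p₀ (jet f z) := by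
  obtain ⟨B, V, ν, T, c, hV, hxV, hT, hν, hc, hcT, hcx, hcont, H⟩ := exists_radial covM covN p
  -- Each intermediate point of a radial development is reachable, so `hrel` supplies the tensor
  -- relations exactly where the radial construction uses them.
  have hreach : ∀ v ∈ B, ∀ t ∈ Icc 0 T, Reachable covM covN p₀ (c v t) := by
    intro v hv t ht
    rcases ht.1.eq_or_lt with rfl | h0
    · rwa [(hc v hv).2]
    · exact hp.step h0 ((hc v hv).1.mono hT h0 (Icc_subset_Icc_right ht.2)) (hc v hv).2
  have hTm : T ∈ Icc 0 T := ⟨hT.le, le_rfl⟩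
  have H' := H fun v hv t ht ↦ hrel _ (hreach v hv t ht)
  refine ⟨_, (H' _ hxV).1, (H' _ hxV).2.symm.trans (hcx T hTm), ?_⟩
  filter_upwards [hV.mem_nhds hxV] with z hz
  rw [← (H' z hz).2]
  exact hreach _ (hν hz) T hTm

/-! ### The étale space of affine maps -/

/-- The reachable points of `Lin(TM, TN)`, with the topology for which the jets of affine maps are
open. -/
@[ext] structure Leaf (covM : TangentConnection E M) (covN : TangentConnection F N)
    (p₀ : LinBundle E M F N) where
  point : LinBundle E M F N
  reachable : Reachable covM covN p₀ point

/-- The projection to `M`. -/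
def Leaf.proj (q : Leaf covM covN p₀) : M := q.1.1.1

/-- The quantifier runs over all affine maps with the given jet, so the axioms need neither their
existence nor their uniqueness. Testing only those `q'` that have the jet as underlying point avoids
asking that nearby jets be reachable. -/
instance : TopologicalSpace (Leaf covM covN p₀) where
  IsOpen W := ∀ q ∈ W, ∀ f : M → N, IsAffineAt covM covN f q.proj → jet f q.proj = q.1 →
    ∀ᶠ z in 𝓝 q.proj, ∀ q' : Leaf covM covN p₀, q'.1 = jet f z → q' ∈ W
  isOpen_univ := fun _ _ _ _ _ ↦ .of_forall fun _ _ _ ↦ mem_univ _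
  isOpen_inter := fun W W' h h' q hq f hf hfq ↦ by
    filter_upwards [h q hq.1 f hf hfq, h' q hq.2 f hf hfq] with z hz hz' q' hq'
    exact ⟨hz q' hq', hz' q' hq'⟩
  isOpen_sUnion := fun s hs q ⟨W, hW, hq⟩ f hf hfq ↦ by
    filter_upwards [hs W hW q hq f hf hfq] with z hz q' hq' using ⟨W, hW, hz q' hq'⟩

lemma Leaf.isOpen_iff {W : Set (Leaf covM covN p₀)} : IsOpen W ↔
    ∀ q ∈ W, ∀ f : M → N, IsAffineAt covM covN f q.proj → jet f q.proj = q.1 →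
    ∀ᶠ z in 𝓝 q.proj, ∀ q' : Leaf covM covN p₀, q'.1 = jet f z → q' ∈ W := Iff.rfl

lemma Leaf.continuous_proj : Continuous (proj : Leaf covM covN p₀ → M) := by
  refine continuous_def.2 fun U hU ↦ isOpen_iff.2 fun q hq f _ _ ↦ ?_
  filter_upwards [hU.mem_nhds hq] with z hz q' hq'
  have : q'.proj = z := congrArg (fun p ↦ p.1.1) hq'
  rwa [mem_preimage, this]

/-- An affine map with the same jet as `f` at a point has the same jets nearby, so openness may be
tested on `f`. -/
lemma Leaf.isOpen_section {W : Set M} (hW : IsOpen W) (hf : ∀ z ∈ W, IsAffineAt covM covN f z) :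
    IsOpen {q : Leaf covM covN p₀ | q.proj ∈ W ∧ q.1 = jet f q.proj} := by
  refine isOpen_iff.2 fun q ⟨hqW, hq⟩ g hg hgq ↦ ?_
  filter_upwards [hW.mem_nhds hqW, (hf _ hqW).eventually_jet_eq_iff hg] with z hz hfg q' hq'
  have hz' : q'.proj = z := congrArg (fun p ↦ p.1.1) hq'
  refine ⟨by rwa [hz'], ?_⟩
  rw [hz', hq', hfg.1 (hq.symm.trans hgq.symm)]

lemma Leaf.isLocalHomeomorph_proj
    (hrel : ∀ p, Reachable covM covN p₀ p → p.Relates covM covN) :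
    IsLocalHomeomorph (proj : Leaf covM covN p₀ → M) := by
  classical
  refine IsLocalHomeomorph.mk _ fun q ↦ ?_
  obtain ⟨f, hf, hfq, hfr⟩ := q.2.exists_isAffineAt hrel
  obtain ⟨W, hW, hWo, hqW⟩ := eventually_nhds_iff.1 (hf.eventually.and hfr)
  let s : M → Leaf covM covN p₀ := fun z ↦ if hz : z ∈ W then ⟨jet f z, (hW z hz).2⟩ else q
  have hs : ∀ z ∈ W, (s z).1 = jet f z := fun z hz ↦ congrArg Leaf.point (dif_pos hz)
  have hs' : ∀ z ∈ W, (s z).proj = z := fun z hz ↦ congrArg (fun p ↦ p.1.1) (hs z hz)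
  refine ⟨{
    toFun := proj
    invFun := s
    source := {q : Leaf covM covN p₀ | q.proj ∈ W ∧ q.1 = jet f q.proj}
    target := W
    map_source' := fun q hq ↦ hq.1
    map_target' := fun z hz ↦ ⟨by rwa [hs' z hz], by rw [hs' z hz, hs z hz]⟩
    left_inv' := fun q hq ↦ Leaf.ext ((hs _ hq.1).trans hq.2.symm)
    right_inv' := hs'
    open_source := isOpen_section hWo fun z hz ↦ (hW z hz).1
    open_target := hWo
    continuousOn_toFun := continuous_proj.continuousOn
    continuousOn_invFun := ?_ }, ⟨hqW, hfq.symm⟩, fun _ _ ↦ rfl⟩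
  refine (hWo.continuousOn_iff).2 fun {z} hz ↦ ?_
  rw [ContinuousAt, tendsto_nhds]
  intro O hO hzO
  have h1 := isOpen_iff.1 hO _ hzO f (by rw [hs' z hz]; exact (hW z hz).1)
    (by rw [hs' z hz, hs z hz])
  rw [hs' z hz] at h1
  filter_upwards [h1, hWo.mem_nhds hz] with z' h1 hz' using h1 _ (hs z' hz')

/-- Different jets over the same point extend to affine maps whose jets differ at all nearby points,
so the corresponding open sections are disjoint. -/
lemma Leaf.isSeparatedMap_proj
    (hrel : ∀ p, Reachable covM covN p₀ p → p.Relates covM covN) :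
    IsSeparatedMap (proj : Leaf covM covN p₀ → M) := by
  intro q q' hqq' hne
  obtain ⟨f, hf, hfq, -⟩ := q.2.exists_isAffineAt hrel
  obtain ⟨g, hg, hgq, -⟩ := q'.2.exists_isAffineAt hrel
  change IsAffineAt covM covN f q.proj at hf
  change jet f q.proj = q.1 at hfq
  change IsAffineAt covM covN g q'.proj at hg
  change jet g q'.proj = q'.1 at hgq
  rw [← hqq'] at hg hgq
  obtain ⟨W, hW, hWo, hqW⟩ := eventually_nhds_iff.1
    (hf.eventually.and (hg.eventually.and (hf.eventually_jet_eq_iff hg)))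
  refine ⟨_, _, isOpen_section hWo fun z hz ↦ (hW z hz).1,
    isOpen_section hWo fun z hz ↦ (hW z hz).2.1, ⟨hqW, hfq.symm⟩,
    ⟨by rwa [← hqq'], by rw [← hqq', hgq]⟩, disjoint_left.2 fun r hr hr' ↦ hne ?_⟩
  have h1 := (hW _ hr.1).2.2.2 (hr.2.symm.trans hr'.2)
  exact Leaf.ext (hfq.symm.trans (h1.trans hgq))

/-- Developments live on nondegenerate closed intervals, so a local property along a curve has to be
localized to such an interval. -/
lemma exists_Icc_mem_nhdsWithin {a b t : ℝ} (hab : a < b) (ht : t ∈ Icc a b) {P : ℝ → Prop}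
    (hP : ∀ᶠ s in 𝓝[Icc a b] t, P s) : ∃ α β, α < β ∧ t ∈ Icc α β ∧ Icc α β ⊆ Icc a b ∧
      Icc α β ∈ 𝓝[Icc a b] t ∧ ∀ s ∈ Icc α β, P s := by
  obtain ⟨δ, hδ, h⟩ := Metric.mem_nhdsWithin_iff.1 hP
  refine ⟨max a (t - δ / 2), min b (t + δ / 2), ?_, ?_, ?_, ?_, ?_⟩
  · rw [max_lt_iff, lt_min_iff, lt_min_iff]
    exact ⟨⟨hab, by linarith [ht.1]⟩, by linarith [ht.2], by linarith⟩
  · exact ⟨max_le ht.1 (by linarith), le_min ht.2 (by linarith)⟩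
  · exact Icc_subset_Icc (le_max_left _ _) (min_le_left _ _)
  · rw [← Icc_inter_Icc]
    exact inter_mem self_mem_nhdsWithin
      (mem_nhdsWithin_of_mem_nhds (Icc_mem_nhds (by linarith) (by linarith)))
  · intro s hs
    rw [← Icc_inter_Icc] at hs
    refine h ⟨?_, hs.1⟩
    rw [Metric.mem_ball, Real.dist_eq, abs_lt]
    exact ⟨by linarith [hs.2.1], by linarith [hs.2.2]⟩

/-- Developments are continuous for the topology of the étale space. -/
lemma IsDevelopmentOn.continuous_leaf
    (hrel : ∀ p, Reachable covM covN p₀ p → p.Relates covM covN) {c : ℝ → LinBundle E M F N}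
    {a b : ℝ} (hab : a < b)
    (hc : IsDevelopmentOn covM covN c (Icc a b))
    (hr : ∀ t ∈ Icc a b, Reachable covM covN p₀ (c t)) :
    Continuous fun t : Icc a b ↦ (⟨c t, hr t t.2⟩ : Leaf covM covN p₀) := by
  refine continuous_iff_continuousAt.2 fun t ↦ tendsto_nhds.2 fun O hO htO ↦ ?_
  obtain ⟨f, hf, hfq, -⟩ := (hr t t.2).exists_isAffineAt hrel
  have h1 := Leaf.isOpen_iff.1 hO _ htO f hf hfq
  have hγ := hc.source.continuousOn t t.2
  obtain ⟨α, β, hαβ, htαβ, hsub, hmem, hP⟩ := exists_Icc_mem_nhdsWithin hab t.2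
    (hγ.eventually (h1.and hf.eventually))
  -- Near `t` the development coincides with the jets of `f` along its geodesic, since both are
  -- developments with the same value at `t`.
  have h2 := (hc.mono hab hαβ hsub).eqOn hαβ
    (isDevelopmentOn_jet hαβ (hc.mono hab hαβ hsub).source fun s hs ↦ (hP s hs).2)
    (fun _ _ ↦ rfl) htαβ hfq.symm
  have h3 : ∀ᶠ s : Icc a b in 𝓝 t, (s : ℝ) ∈ Icc α β :=
    preimage_coe_mem_nhds_subtype.2 hmem
  filter_upwards [h3] with s hs
  exact (hP s hs).1 _ (h2 hs)

/-- The étale space is a covering of `M`. -/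
theorem Leaf.isCoveringMap_proj (hN : GeodesicallyComplete covN)
    (hrel : ∀ p, Reachable covM covN p₀ p → p.Relates covM covN) :
    IsCoveringMap (proj : Leaf covM covN p₀ → M) := by
  refine (isLocalHomeomorph_proj hrel).isCoveringMap_of_lifts (isSeparatedMap_proj hrel)
    fun x ↦ ?_
  obtain ⟨V, G, hV, hxV, hG, -, hGc⟩ := exists_normalNeighborhood covM x
  have hcont : Continuous fun tz : unitInterval × V ↦ G tz.2 tz.1 :=
    hGc.comp_continuous (f := fun tz : unitInterval × V ↦ ((tz.2 : M), (tz.1 : ℝ))) (by fun_prop)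
      fun tz ↦ ⟨tz.2.2, tz.1.2⟩
  have hm0 : (0 : ℝ) ∈ Icc (0 : ℝ) 1 := ⟨le_rfl, zero_le_one⟩
  have hm1 : (1 : ℝ) ∈ Icc (0 : ℝ) 1 := ⟨zero_le_one, le_rfl⟩
  refine ⟨V, ⟨_, hcont⟩, hV, hxV, fun z ↦ (hG z z.2).2.1, fun z ↦ (hG z z.2).2.2,
    fun z e he ↦ ?_, fun z e he ↦ ?_⟩
  -- Lifting a radial geodesic with given initial point amounts to developing along it, which
  -- completeness of N allows.
  · obtain ⟨c, hc, hcγ, hc0⟩ := exists_isDevelopmentOn (covM := covM) hN one_pos (hG z z.2).1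
      (p := e.1) (he.trans (hG z z.2).2.1.symm)
    have hr : ∀ t ∈ Icc (0 : ℝ) 1, Reachable covM covN p₀ (c t) := by
      intro t ht
      rcases ht.1.eq_or_lt with rfl | h0
      · rw [hc0]; exact e.2
      · exact e.2.step h0 (hc.mono one_pos h0 (Icc_subset_Icc_right ht.2)) hc0
    exact ⟨⟨fun t : unitInterval ↦ ⟨c t, hr t t.2⟩, hc.continuous_leaf hrel one_pos hr⟩,
      fun t ↦ hcγ t, Leaf.ext hc0⟩
  · obtain ⟨c, hc, hcγ, hc1⟩ := exists_isDevelopmentOn_right (covM := covM) hN one_pos (hG z z.2).1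
      (p := e.1) (he.trans (hG z z.2).2.2.symm)
    have hr : ∀ t ∈ Icc (0 : ℝ) 1, Reachable covM covN p₀ (c t) := by
      intro t ht
      rcases ht.2.eq_or_lt with rfl | h1
      · rw [hc1]; exact e.2
      -- Here the known point is the final one, so `c t` is reached from it by running the
      -- development backwards over [t, 1].
      · have hρ : ∀ s, HasDerivAt (fun s ↦ t + 1 - s) (-1) s := fun s ↦ by
          simpa using (hasDerivAt_id s).const_sub (t + 1)
        have := e.2.step (c' := fun s ↦ c (t + 1 - s)) h1 (hc.comp one_pos h1 hρ fun s hs ↦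
          ⟨by linarith [hs.2, ht.1], by linarith [hs.1]⟩) (by simpa using hc1)
        simpa using this
    exact ⟨⟨fun t : unitInterval ↦ ⟨c t, hr t t.2⟩, hc.continuous_leaf hrel one_pos hr⟩,
      fun t ↦ hcγ t, Leaf.ext hc1⟩

end Globalization

/-! ### The global affine map -/

section Conclusion

variable {E : Type*} [NormedAddCommGroup E] [NormedSpace ℝ E]
  {M : Type*} [TopologicalSpace M] [ChartedSpace E M] [IsManifold 𝓘(ℝ, E) ∞ M]
  {F : Type*} [NormedAddCommGroup F] [NormedSpace ℝ F]
  {N : Type*} [TopologicalSpace N] [ChartedSpace F N] [IsManifold 𝓘(ℝ, F) ∞ N]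
  {covM : TangentConnection E M} {covN : TangentConnection F N}
  {f g : M → N} {p₀ : LinBundle E M F N}

lemma jet_congr {z : M} (h : f =ᶠ[𝓝 z] g) : (jet f z : LinBundle E M F N) = jet g z := by
  have key : ∀ (y y' : N) (A B : E →L[ℝ] F), y = y' → A = B →
      (⟨(z, y), A⟩ : LinBundle E M F N) = ⟨(z, y'), B⟩ := by
    rintro y y' A B rfl rfl
    rfl
  exact key _ _ _ _ h.self_of_nhds h.mfderiv_eq

variable [FiniteDimensional ℝ E] [FiniteDimensional ℝ F] [T2Space M] [T2Space N]
  [CovariantDerivative.ContMDiffCovariantDerivative covM ∞]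
  [CovariantDerivative.ContMDiffCovariantDerivative covN ∞]

lemma isPiecewiseDevelopment_jet (hf : ∀ z, IsAffineAt covM covN f z) {γ : ℝ → M} {a b : ℝ}
    (hγ : IsPiecewiseGeodesic covM γ a b) :
    IsPiecewiseDevelopment covM covN (fun t ↦ jet f (γ t)) a b := by
  induction hγ with
  | single hab hγ => exact .single hab (isDevelopmentOn_jet hab hγ fun _ _ ↦ hf _)
  | append _ hbc hγ ih => exact .append ih hbc (isDevelopmentOn_jet hbc hγ fun _ _ ↦ hf _)

/-- Uniqueness of developments, piece by piece: once a development starts at a jet of an affine map,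
it consists of jets of that map. This gives the uniqueness of induced data. -/
lemma IsPiecewiseDevelopment.eqOn_jet (hf : ∀ z, IsAffineAt covM covN f z)
    {c : ℝ → LinBundle E M F N} {a b : ℝ} (hc : IsPiecewiseDevelopment covM covN c a b)
    (h : c a = jet f (c a).1.1) : EqOn c (fun t ↦ jet f (c t).1.1) (Icc a b) := by
  induction hc with
  | single hab hc =>
    exact hc.eqOn hab (isDevelopmentOn_jet hab hc.source fun _ _ ↦ hf _) (fun _ _ ↦ rfl)
      (left_mem_Icc.2 hab.le) h
  | append h' hbd hc ih =>
    rw [← Icc_union_Icc_eq_Icc h'.lt.le hbd.le]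
    exact ih.union (hc.eqOn hbd (isDevelopmentOn_jet hbd hc.source fun _ _ ↦ hf _)
      (fun _ _ ↦ rfl) (left_mem_Icc.2 hbd.le) (ih (right_mem_Icc.2 h'.lt.le)))

/-- The global section of the étale space over a simply connected manifold. -/
theorem exists_forall_isAffineAt [SimplyConnectedSpace M] (hN : GeodesicallyComplete covN)
    (hrel : ∀ p, Reachable covM covN p₀ p → p.Relates covM covN) :
    ∃ f : M → N, (∀ z, IsAffineAt covM covN f z) ∧ jet f p₀.1.1 = p₀ := by
  have : LocallyPathConnectedSpace M := ChartedSpace.locallyPathConnectedSpace E M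
  -- The identity of the simply connected, locally path connected M lifts through the covering; the
  -- lift is a global section through `p₀`.
  obtain ⟨s, ⟨hs₀, hs⟩, -⟩ := (Leaf.isCoveringMap_proj hN hrel).existsUnique_continuousMap_lifts
    (ContinuousMap.id M) p₀.1.1 ⟨p₀, .refl hN p₀⟩ rfl
  have hsz : ∀ z, (s z).proj = z := fun z ↦ congrFun hs z
  -- A continuous section lies locally in the open set of jets of a single affine map `g`, so its
  -- N-component is `g` near z and its value at z is the jet of `g`.
  have key : ∀ z, ∃ g : M → N, IsAffineAt covM covN g z ∧ (s z).1 = jet g z ∧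
      (fun z ↦ (s z).1.1.2) =ᶠ[𝓝 z] g := by
    intro z
    obtain ⟨g, hg, hgs, -⟩ := (s z).reachable.exists_isAffineAt hrel
    change IsAffineAt covM covN g (s z).proj at hg
    change jet g (s z).proj = (s z).1 at hgs
    rw [hsz] at hg hgs
    obtain ⟨W, hW, hWo, hzW⟩ := eventually_nhds_iff.1 hg.eventually
    refine ⟨g, hg, hgs.symm, ?_⟩
    have h1 := s.continuous.continuousAt.eventually
      ((Leaf.isOpen_section (p₀ := p₀) hWo hW).mem_nhds
      (x := s z) ⟨by rwa [hsz], by rw [hsz, hgs]⟩)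
    filter_upwards [h1] with z' hz'
    have h2 := hz'.2
    rw [hsz] at h2
    exact congrArg (fun p ↦ p.1.2) h2
  refine ⟨fun z ↦ (s z).1.1.2, fun z ↦ ?_, ?_⟩
  · obtain ⟨g, hg, -, hgs⟩ := key z
    exact hg.congr hgs.symm
  · obtain ⟨g, -, hg, hgs⟩ := key p₀.1.1
    rw [jet_congr hgs, ← hg, hs₀]

end Conclusion

end AffineGeometry

end

theorem theorem5p3
    {E : Type*} [NormedAddCommGroup E] [NormedSpace ℝ E] [FiniteDimensional ℝ E]
    {M : Type*} [TopologicalSpace M] [ChartedSpace E M] [IsManifold 𝓘(ℝ, E) ∞ M]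
    [T2Space M] [SimplyConnectedSpace M]
    {F : Type*} [NormedAddCommGroup F] [NormedSpace ℝ F] [FiniteDimensional ℝ F]
    {N : Type*} [TopologicalSpace N] [ChartedSpace F N] [IsManifold 𝓘(ℝ, F) ∞ N]
    [T2Space N]
    (covM : AffineGeometry.TangentConnection E M)
    [CovariantDerivative.ContMDiffCovariantDerivative covM ∞]
    (covN : AffineGeometry.TangentConnection F N)
    [CovariantDerivative.ContMDiffCovariantDerivative covN ∞]
    (hN : AffineGeometry.GeodesicallyComplete covN)
    (x₀ : M) (y₀ : N)
    (σ₀ : TangentSpace 𝓘(ℝ, E) x₀ →L[ℝ] TangentSpace 𝓘(ℝ, F) y₀)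
    (hσ : ∀ (a b : ℝ) (γ : ℝ → M),
      AffineGeometry.IsPiecewiseGeodesic covM γ a b → γ a = x₀ →
      ∀ (μ : ℝ → N) (σ : TangentSpace 𝓘(ℝ, E) (γ b) →L[ℝ] TangentSpace 𝓘(ℝ, F) (μ b)),
        AffineGeometry.IsInduced covM covN σ₀ γ a b μ σ →
          AffineGeometry.RelatesTorsion covM covN σ ∧
          AffineGeometry.RelatesCurvature covM covN σ) :
    ∃ f : M → N,
      AffineGeometry.IsAffineMap covM covN f ∧
      -- `f ∘ γ` and `df(γ(b))` are the curve and the linear map induced by `γ` and `σ₀`,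
      -- and nothing else is
      (∀ (a b : ℝ) (γ : ℝ → M),
        AffineGeometry.IsPiecewiseGeodesic covM γ a b → γ a = x₀ →
        AffineGeometry.IsInduced covM covN σ₀ γ a b (f ∘ γ)
          (mfderiv 𝓘(ℝ, E) 𝓘(ℝ, F) f (γ b)) ∧
        ∀ (μ : ℝ → N) (σ : TangentSpace 𝓘(ℝ, E) (γ b) →L[ℝ] TangentSpace 𝓘(ℝ, F) (μ b)),
          AffineGeometry.IsInduced covM covN σ₀ γ a b μ σ →
            Set.EqOn (f ∘ γ) μ (Set.Icc a b) ∧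
            (⟨(γ b, f (γ b)), mfderiv 𝓘(ℝ, E) 𝓘(ℝ, F) f (γ b)⟩ :
              AffineGeometry.LinBundle E M F N) = ⟨(γ b, μ b), σ⟩) ∧
      f x₀ = y₀ ∧
      (⟨(x₀, f x₀), mfderiv 𝓘(ℝ, E) 𝓘(ℝ, F) f x₀⟩ : AffineGeometry.LinBundle E M F N) =
        ⟨(x₀, y₀), σ₀⟩ := by
  have hrel : ∀ p, AffineGeometry.Reachable covM covN ⟨(x₀, y₀), σ₀⟩ p →
      AffineGeometry.LinBundle.Relates covM covN p := by
    intro p hp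
    obtain ⟨γ, μ, a, b, σ, hγ, hγa, hind, rfl⟩ := hp.exists_isInduced
    exact hσ a b γ hγ hγa μ σ hind
  obtain ⟨f, hf, hf₀⟩ := AffineGeometry.exists_forall_isAffineAt hN hrel
  change AffineGeometry.jet f x₀ = _ at hf₀
  refine ⟨f, AffineGeometry.isAffineMap_of_isAffineAt hf, fun a b γ hγ hγa ↦ ?_,
    congrArg (fun p ↦ p.1.2) hf₀, hf₀⟩
  -- The jets of f along `γ` start at (x₀, y₀, σ₀); this gives existence of the induced data as well
  -- as, through `eqOn_jet`, their uniqueness.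
  have hjet : AffineGeometry.jet f (γ a) = (⟨(x₀, y₀), σ₀⟩ :
      AffineGeometry.LinBundle E M F N) := by rw [hγa, hf₀]
  refine ⟨⟨mfderiv 𝓘(ℝ, E) 𝓘(ℝ, F) f (γ a), hjet,
    (AffineGeometry.isPiecewiseDevelopment_jet hf hγ).isInducedFrom (μ := f ∘ γ)
      (T := fun t ↦ mfderiv 𝓘(ℝ, E) 𝓘(ℝ, F) f (γ t))⟩, fun μ σ hind ↦ ?_⟩
  obtain ⟨σa, hσa, hind⟩ := hind
  obtain ⟨T, hT, rfl, rfl⟩ := hind.exists_isPiecewiseDevelopment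
  have h := hT.eqOn_jet hf (hσa.trans hjet.symm)
  exact ⟨fun t ht ↦ congrArg (fun p ↦ p.1.2) (h ht).symm,
    (h (Set.right_mem_Icc.2 hT.lt.le)).symm⟩
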